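/- Let $N$ be a nonnegative integer and let $E_{ij}$ be the standard basis of $\mathfrak{gl}_N=\mathfrak{gl}_N(\mathbb C)$. Put $\widehat{\mathfrak g}^{+}=\mathfrak b^{+}\oplus t^{-1}\mathfrak{gl}_N[t^{-1}]$, a Lie subalgebra of $\mathfrak{gl}_N[t^{-1}]$, where $\mathfrak b^{+}$ is spanned by the $E_{ij}$ with $i\le j$. Let $\mathcal L^{+}(u)=[\mathcal L^{+}_{ij}(u)]$ be the $N\times N$ matrix with entries $$\mathcal L^{+}_{ij}(u)=-\bigl(1+\operatorname{sgn}(j-i)\bigr)E_{ij}-2\sum_{n\ge 1}E_{ij}t^{-n}u^{n}\in \mathrm U(\widehat{\mathfrak g}^{+})[[u]],\qquad \operatorname{sgn}(0)=0,$$ and let $\mathcal L=2u\,\partial_u-\mathcal L^{+}(u)$, a matrix of differential operators with coefficients in $\mathrm U(\widehat{\mathfrak g}^{+})[[u]]$. With $e_{ij}\in\operatorname{End}\mathbb C^N$ the matrix units, set $$T(y)=\sum_{i}e_{ii}\otimes e_{ii}+\frac1{1-y}\sum_{i<j}e_{ij}\otimes e_{ji}+\frac1{1+y}\sum_{i>j}e_{ij}\otimes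 e_{ji},$$ expanded in powers of $y$, and define differential operators $\theta_m$ ($m\ge1$) by $$\sum_{m\ge1}\theta_m y^m=\sum_{s\ge1}y^s\,\operatorname{tr}_{1,\dots,s}\,T_{s-1\,s}(y)\cdots T_{1\,2}(y)\,\mathcal L_1\cdots\mathcal L_s,$$ where subscripts indicate copies of $\operatorname{End}\mathbb C^N$ in $(\operatorname{End}\mathbb C^N)^{\otimes s}$ and the trace is over all $s$ copies. Then: 1. For each $m\ge 1$ there are unique power series $\theta_m^{(0)},\dots,\theta_m^{(m)}\in\mathrm U(\widehat{\mathfrak g}^{+})[[u]]$ with $\theta_m=\sum_{k=0}^m\theta_m^{(k)}\partial_u^{\,m-k}$. 2. The coefficients of all the power series $\theta_m^{(k)}$ ($m\ge1$, $0\le k\le m$) generate a commutative subalgebra of $\mathrm U(\widehat{\mathfrak g}^{+})$. 3. For each $m\ge1$, every coefficient of the series $\theta_m^{(m)}-(-1)^m\operatorname{tr}\mathcal L^{+}(u)^m$ lies in the span of the products of at most $m-1$ elements of $\widehat{\mathfrak g}^{+}$. 4. Let $r(x)=\sum_{i,j}\bigl(\frac{1+x}{1-x}+\operatorname{sgn}(j-i)\bigr)e_{ij}\otimes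 e_{ji}$ be the trigonometric classical $r$-matrix. For all $l\ge0$ and nonzero $a_1,\dots,a_l\in\mathbb C$ there is a homomorphism of unital algebras $\rho:\mathrm U(\widehat{\mathfrak g}^{+})\to(\operatorname{End}\mathbb C^N)^{\otimes l}$ that sends $\mathcal L^{+}(u)$ to $r_{01}(u/a_1)+\dots+r_{0l}(u/a_l)$, expanded at $u=0$ (the matrix $\mathcal L^+(u)$ being in copy $0$); the images under $\rho$ of the coefficients of all the $\theta_m^{(k)}$ commute pairwise. -/

import Mathlib

open PowerSeries
open scoped Kronecker

noncomputable section

namespace TrigGaudin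

attribute [local instance 100] LieRing.ofAssociativeRing

/-- The Lie algebra `𝔟⁺ ⊕ t⁻¹ 𝔤𝔩_N[t⁻¹]`, as a Lie subalgebra of `𝔤𝔩_N[t⁻¹]`. Elements of
`𝔤𝔩_N[t⁻¹]` are matrices over `ℂ[X]`, where `X` stands for `t⁻¹`, with the commutator as bracket;
the condition says that the constant term lies in `𝔟⁺ = span {E_{ij} : i ≤ j}`. -/
def gPlus (N : ℕ) : LieSubalgebra ℂ (Matrix (Fin N) (Fin N) (Polynomial ℂ)) where
  carrier := {A | ∀ i j, j < i → (A i j).coeff 0 = 0}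
  zero_mem' := by intro i j _; simp
  add_mem' := by
    intro A B hA hB i j hij
    simp [hA i j hij, hB i j hij]
  smul_mem' := by
    intro c A hA i j hij
    simp [hA i j hij]
  lie_mem' := by
    have key : ∀ A B : Matrix (Fin N) (Fin N) (Polynomial ℂ),
        (∀ i j, j < i → (A i j).coeff 0 = 0) → (∀ i j, j < i → (B i j).coeff 0 = 0) →
        ∀ i j, j < i → ((A * B) i j).coeff 0 = 0 := by
      intro A B hA hB i j hij
      rw [Matrix.mul_apply, Polynomial.finsetSum_coeff]
      refine Finset.sum_eq_zero fun k _ => ?_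
      rw [Polynomial.mul_coeff_zero]
      rcases lt_or_ge k i with h | h
      · rw [hA i k h, zero_mul]
      · rw [hB k j (lt_of_lt_of_le hij h), mul_zero]
    intro A B hA hB i j hij
    rw [LieRing.of_associative_ring_bracket, Matrix.sub_apply, Polynomial.coeff_sub,
      key A B hA hB i j hij, key B A hB hA i j hij, sub_zero]

/-- The universal enveloping algebra of `𝔟⁺ ⊕ t⁻¹ 𝔤𝔩_N[t⁻¹]`. -/
abbrev UPlus (N : ℕ) : Type := UniversalEnvelopingAlgebra ℂ (gPlus N)

/-- The number `sgn(j - i)`. -/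
def sgn {N : ℕ} (i j : Fin N) : ℤ := Int.sign ((j : ℤ) - (i : ℤ))

/-- The element `-2 E_{ij} t⁻ⁿ` for `n ≥ 1`, and `-(1 + sgn(j - i)) E_{ij}` for `n = 0`. -/
def lPlusElem (N : ℕ) (i j : Fin N) (n : ℕ) : gPlus N :=
  ⟨Matrix.single i j
      (Polynomial.monomial n (if n = 0 then -(1 + (sgn i j : ℂ)) else -2)), by
    intro a b hab
    by_cases h : i = a ∧ j = b
    · obtain ⟨rfl, rfl⟩ := h
      rw [Matrix.single_apply_same, Polynomial.coeff_monomial]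
      split_ifs
      · have : sgn i j = -1 := Int.sign_eq_neg_one_of_neg (by
          have : (j : ℕ) < (i : ℕ) := hab
          omega)
        simp [this]
      · rfl
    · rw [Matrix.single_apply_of_ne _ _ _ _ _ h, Polynomial.coeff_zero]⟩

/-- The matrix `ℒ⁺(u)`, whose entries are power series in `u` with coefficients in `UPlus N`. -/
def lPlus (N : ℕ) : Matrix (Fin N) (Fin N) (UPlus N)⟦X⟧ :=
  fun i j => PowerSeries.mk fun n => UniversalEnvelopingAlgebra.ι ℂ (lPlusElem N i j n)

/-- The algebra in which differential operators with coefficients in `UPlus N ⟦u⟧` live: they act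
faithfully on `UPlus N ⟦u⟧`, coefficients acting by left multiplication. -/
abbrev OpAlg (N : ℕ) : Type := Module.End ℂ (UPlus N)⟦X⟧

/-- A power series, as the operator of left multiplication by it. -/
abbrev mulOp (N : ℕ) : (UPlus N)⟦X⟧ →ₐ[ℂ] OpAlg N := Algebra.lmul ℂ (UPlus N)⟦X⟧

/-- The derivation `∂_u`. -/
def du (N : ℕ) : OpAlg N where
  toFun f := PowerSeries.mk fun n => ((n : ℂ) + 1) • coeff (n + 1) f
  map_add' f g := by ext n; simp
  map_smul' c f := by ext n; simp [smul_comm c]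

/-- The matrix `ℒ = 2 u ∂_u - ℒ⁺(u)` of differential operators. -/
def lOp (N : ℕ) : Matrix (Fin N) (Fin N) (OpAlg N) :=
  Matrix.diagonal (fun _ => 2 * mulOp N X * du N) - (lPlus N).map (mulOp N)

/-- `(End ℂ^N)^{⊗ s} ⊗ A`, as matrices over `A` indexed by the standard basis of `(ℂ^N)^{⊗ s}`. -/
abbrev TensorMat (N s : ℕ) (A : Type) : Type := Matrix (Fin s → Fin N) (Fin s → Fin N) A

/-- The copy `M_a` of `M ∈ End ℂ^N ⊗ A` in the `a`-th tensor factor. -/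
def leg {N s : ℕ} {A : Type} [Zero A] (a : Fin s) (M : Matrix (Fin N) (Fin N) A) :
    TensorMat N s A :=
  fun I J => if ∀ c, c ≠ a → I c = J c then M (I a) (J a) else 0

/-- The copy `M_{ab}` of `M ∈ End ℂ^N ⊗ End ℂ^N ⊗ A` in the `a`-th and `b`-th tensor factors. -/
def leg₂ {N s : ℕ} {A : Type} [Zero A] (a b : Fin s)
    (M : Matrix (Fin N × Fin N) (Fin N × Fin N) A) : TensorMat N s A :=
  fun I J => if ∀ c, c ≠ a → c ≠ b → I c = J c then M (I a, I b) (J a, J b) else 0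

/-- `e_{ij} ⊗ e_{ji}`. -/
def flipUnit {N : ℕ} (A : Type) [Semiring A] (i j : Fin N) :
    Matrix (Fin N × Fin N) (Fin N × Fin N) A :=
  Matrix.single i j 1 ⊗ₖ Matrix.single j i 1

/-- The function `T(y)`, with its rational functions of `y` expanded as power series at `y = 0`. -/
def tMatrix (N : ℕ) : Matrix (Fin N × Fin N) (Fin N × Fin N) ℂ⟦X⟧ :=
  ∑ i, flipUnit ℂ⟦X⟧ i i
    + (1 - X : ℂ⟦X⟧)⁻¹ • ∑ i, ∑ j, (if i < j then flipUnit ℂ⟦X⟧ i j else 0)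
    + (1 + X : ℂ⟦X⟧)⁻¹ • ∑ i, ∑ j, (if j < i then flipUnit ℂ⟦X⟧ i j else 0)

/-- The series in `y` given by `tr_{1,…,s+1} T_{s,s+1}(y) ⋯ T_{12}(y) ℒ_1 ⋯ ℒ_{s+1}`. -/
def traceTerm (N s : ℕ) : (OpAlg N)⟦X⟧ :=
  Matrix.trace
    ((List.ofFn fun a : Fin s => leg₂ (s := s + 1) a.castSucc a.succ
        ((tMatrix N).map (PowerSeries.map (algebraMap ℂ (OpAlg N))))).reverse.prod
      * (List.ofFn fun a : Fin (s + 1) => leg a ((lOp N).map (C (R := OpAlg N)))).prod)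

/-- The operator `θ_m`, the coefficient of `y^m` in
`∑_{s ≥ 1} y^s tr_{1,…,s} T_{s-1,s}(y) ⋯ T_{12}(y) ℒ_1 ⋯ ℒ_s`; the terms with `s > m` do not
contribute. -/
def theta (N m : ℕ) : OpAlg N :=
  ∑ s ∈ Finset.range m, coeff m (X ^ (s + 1) * traceTerm N s)

/-- The span of all products of at most `d` elements of the Lie algebra. -/
def degreeLE (N d : ℕ) : Submodule ℂ (UPlus N) :=
  (1 ⊔ LinearMap.range (UniversalEnvelopingAlgebra.ι ℂ : gPlus N →ₗ⁅ℂ⁆ UPlus N).toLinearMap) ^ d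

/-- The trigonometric classical `r`-matrix
`r(x) = ∑_{i,j} ((1 + x)/(1 - x) + sgn(j - i)) e_{ij} ⊗ e_{ji}`, expanded at `x = 0`. -/
def rMatrix (N : ℕ) : Matrix (Fin N × Fin N) (Fin N × Fin N) ℂ⟦X⟧ :=
  ∑ i, ∑ j, ((1 + X) * (1 - X : ℂ⟦X⟧)⁻¹ + C (sgn i j : ℂ)) • flipUnit ℂ⟦X⟧ i j

/-- `r_{01}(u/a_1) + ⋯ + r_{0l}(u/a_l)`, expanded at `u = 0`. -/
def rSum (N : ℕ) {l : ℕ} (a : Fin l → ℂ) : TensorMat N (l + 1) ℂ⟦X⟧ :=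
  ∑ k : Fin l, leg₂ 0 k.succ ((rMatrix N).map (rescale (a k)⁻¹))

/-- The set of all coefficients of the power series `θ_m^{(k)}`, `m ≥ 1`, `0 ≤ k ≤ m`. -/
def coeffSet {N : ℕ} (θ : ℕ → ℕ → (UPlus N)⟦X⟧) : Set (UPlus N) :=
  {x | ∃ m k n : ℕ, 1 ≤ m ∧ k ≤ m ∧ x = coeff n (θ m k)}

end TrigGaudin

end

open TrigGaudin

noncomputable section

namespace TrigGaudin

attribute [local instance 100] LieRing.ofAssociativeRing

open Matrix Equiv

/-! ### Matrices acting in a single tensor factor -/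

section Legs

variable {N n : ℕ} {A : Type} [Ring A]

/-! The operators θ_m are the classical limit of a commuting family of quantum transfer matrices.

The defining trace collapses first. The product of the T's carries the last index j past all the
others, so the trace is a sum over closed paths through j in which every intermediate vertex i has
weight 1/(1 - sgn(j-i)y). Resumming the geometric series gives θ_m = ∑_j ((ℒ + Γ_j)^m)_{jj} with Γ_j
= diag_i sgn(j-i) (`theta_eq`). Hence θ_m has order at most m, and its last coefficient is θ_m(1).
Only the -ℒ⁺ part of ℒ + Γ_j raises the degree in the enveloping algebra, which gives the leading
term (`coeff_pow_apply_one_sub_mem`).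

On the quantum side let L(u) be a monodromy matrix, a product of trigonometric R-matrices over
finitely many sites. Put t_k(u) = ∑_j (c_j L(u) c_j L(uq⁻²) ⋯)_{jj}, where c_j has diagonal entries
q^{-sgn(j-i)}. This is the trace of L_1(u) L_2(uq⁻²) ⋯ L_k against a long cycle, in the permutation
action conjugated by q^{number of inversions}. In that action an adjacent transposition P is a local
flip, and R(u, uq⁻²) is a multiple of 1 - P. So a string of L's with ratio q⁻² preserves the
symmetric tensors of each adjacent P (the Manin property). Two consequences are combined: (a) traces
of strings against antisymmetrizers commute, by fusion: a product of R-matrices intertwines the two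
orders of two strings and is compatible with both antisymmetrizers (`commute_altTrace_aux`); (b) a
noncommutative Newton identity (`hookTrace_succ`) recovers cycle traces from alternating ones, so
cycle traces commute too (`commute_cycTrace_cycTrace`).

Now put q = 1 + h with h a formal parameter. After division by a scalar series L = 1 + hR, where R
reduces mod h to a sum of classical r-matrices. With δ the substitution u ↦ q⁻²u one has 1 - c_j L δ
= h·Q_j, and Q_j reduces mod h to the image of ℒ + Γ_j (`one_sub_diffLax`,
`intertwines_firstOrder`). By the binomial theorem ∑_j ((1 - c_j L δ)^m)_{jj}, applied to scalar
series, is a combination of transfer matrices. These commute. Cancelling powers of h and setting h =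
0 shows that the images of the coefficients of θ_m(u^p) commute in every tensor product of dual
evaluation modules (`commute_map_coeff`).

These modules separate the points of the enveloping algebra (`eq_zero_of_uRep_eq_zero`): an
alternating sum over subsets of d sites kills degree below d and sees the symmetrized top symbol in
degree d. So commutativity holds in the algebra itself. The coefficients of the series θ_m^{(k)} are
recovered triangularly from θ_m(u^p) (`coeff_mem_of_eq_sum`). The Gaudin model is the tensor product
with evaluation parameters 1/a_k. -/

theorem leg_eq_zero_or (a : Fin n) (M : Matrix (Fin N) (Fin N) A) (I J : Fin n → Fin N) :
    leg a M I J = if J = Function.update I a (J a) then M (I a) (J a) else 0 := by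
  unfold leg
  refine if_congr ⟨fun h => ?_, fun h c hc => ?_⟩ rfl rfl
  · funext c
    by_cases hc : c = a
    · subst hc; simp
    · simp [hc, h c hc]
  · rw [h]; simp [hc]

theorem leg_mulVec (a : Fin n) (M : Matrix (Fin N) (Fin N) A) (f : (Fin n → Fin N) → A)
    (I : Fin n → Fin N) :
    (leg a M *ᵥ f) I = ∑ p, M (I a) p * f (Function.update I a p) := by
  simp only [mulVec, dotProduct, leg_eq_zero_or, ite_mul, zero_mul]
  rw [← Finset.sum_filter]
  refine (Finset.sum_bij' (fun p _ => Function.update I a p) (fun J _ => J a) ?_ ?_ ?_ ?_ ?_).symm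
  · intro p _; simp
  · intro J _; simp
  · intro p _; simp
  · intro J hJ
    rw [Finset.mem_filter] at hJ
    exact hJ.2.symm
  · intro p _; simp

/-- Legs and flips act on vectors by substituting or exchanging indices, so comparing actions on
vectors replaces sums over multi-indices in the proofs of matrix identities. -/
theorem ext_mulVec {ι : Type*} [Fintype ι] {M M' : Matrix ι ι A}
    (h : ∀ f : ι → A, ∀ i, (M *ᵥ f) i = (M' *ᵥ f) i) : M = M' := by
  classical
  exact ext_of_mulVec_single fun i => funext fun j => h _ _

theorem leg_one (a : Fin n) : leg a (1 : Matrix (Fin N) (Fin N) A) = 1 := by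
  refine ext_mulVec fun f I => ?_
  rw [leg_mulVec]
  simp [Matrix.one_apply]

theorem leg_mul (a : Fin n) (M M' : Matrix (Fin N) (Fin N) A) :
    leg a (M * M') = leg a M * leg a M' := by
  refine ext_mulVec fun f I => ?_
  rw [← mulVec_mulVec]
  simp only [leg_mulVec, Function.update_self, Function.update_idem, Matrix.mul_apply,
    Finset.sum_mul, Finset.mul_sum]
  rw [Finset.sum_comm]
  simp only [mul_assoc]

theorem leg_add (a : Fin n) (M M' : Matrix (Fin N) (Fin N) A) :
    leg a (M + M') = leg a M + leg a M' := by
  ext I J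
  simp only [leg, Matrix.add_apply]
  split_ifs <;> simp

/-- `leg a` as a ring homomorphism. -/
def legHom (N : ℕ) (A : Type) [Ring A] (a : Fin n) :
    Matrix (Fin N) (Fin N) A →+* TensorMat N n A where
  toFun := leg a
  map_one' := leg_one a
  map_mul' := leg_mul a
  map_zero' := by ext I J; simp [leg]
  map_add' := leg_add a

theorem leg_comm_of_ne {a b : Fin n} (hab : a ≠ b) (M M' : Matrix (Fin N) (Fin N) A)
    (h : ∀ i j k l, M i j * M' k l = M' k l * M i j) :
    leg a M * leg b M' = leg b M' * leg a M := by
  refine ext_mulVec fun f I => ?_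
  rw [← mulVec_mulVec, ← mulVec_mulVec]
  simp only [leg_mulVec, Finset.mul_sum]
  rw [Finset.sum_comm]
  refine Finset.sum_congr rfl fun p _ => Finset.sum_congr rfl fun r _ => ?_
  rw [Function.update_of_ne hab.symm, Function.update_of_ne hab, ← mul_assoc, ← mul_assoc, h,
    Function.update_comm hab]

theorem leg_map {A' : Type} [Ring A'] (φ : A →+* A') (a : Fin n) (M : Matrix (Fin N) (Fin N) A) :
    (leg a M).map φ = leg a (M.map φ) := by
  ext I J
  simp only [leg, Matrix.map_apply]
  split_ifs <;> simp

end Legs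

/-! ### Weighted flips and exchange relations -/

section TwoLegs

variable {N n : ℕ} {F : Type} [CommRing F] {B : Type} [Ring B] [Algebra F B]

/-- The operator `f ↦ α(I_a, I_b) f(I) + β(I_a, I_b) f(I with I_a and I_b exchanged)`. -/
def twoLeg (a b : Fin n) (α β : Fin N → Fin N → F) : TensorMat N n F :=
  fun I J => (if J = I then α (I a) (I b) else 0) + if J = I ∘ swap a b then β (I a) (I b) else 0

/-- The image of a scalar matrix under the structure map of an algebra. -/
abbrev lift (B : Type) [Ring B] [Algebra F B] {ι : Type*} [Fintype ι] [DecidableEq ι] :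
    Matrix ι ι F →+* Matrix ι ι B :=
  (algebraMap F B).mapMatrix

theorem lift_twoLeg_mulVec (a b : Fin n) (α β : Fin N → Fin N → F) (f : (Fin n → Fin N) → B)
    (I : Fin n → Fin N) :
    (lift B (twoLeg a b α β) *ᵥ f) I
      = α (I a) (I b) • f I + β (I a) (I b) • f (I ∘ swap a b) := by
  simp only [mulVec, dotProduct, RingHom.mapMatrix_apply, Matrix.map_apply, twoLeg, map_add,
    add_mul, Finset.sum_add_distrib]
  congr 1
  · rw [Finset.sum_eq_single I]
    · simp [Algebra.smul_def]
    · intro J _ hJ; simp [hJ]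
    · simp
  · rw [Finset.sum_eq_single (I ∘ swap a b)]
    · simp [Algebra.smul_def]
    · intro J _ hJ; simp [hJ]
    · simp

theorem twoLeg_mulVec (a b : Fin n) (α β : Fin N → Fin N → F) (f : (Fin n → Fin N) → F)
    (I : Fin n → Fin N) :
    (twoLeg a b α β *ᵥ f) I = α (I a) (I b) * f I + β (I a) (I b) * f (I ∘ swap a b) := by
  have := lift_twoLeg_mulVec (B := F) a b α β f I
  rw [show lift F (twoLeg a b α β) = twoLeg a b α β by ext; rfl] at this
  simpa using this

theorem twoLeg_comm {a b c d : Fin n} (hac : a ≠ c) (had : a ≠ d) (hbc : b ≠ c) (hbd : b ≠ d)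
    (α β α' β' : Fin N → Fin N → F) :
    twoLeg a b α β * twoLeg c d α' β' = twoLeg c d α' β' * twoLeg a b α β := by
  refine ext_mulVec fun f I => ?_
  rw [← mulVec_mulVec, ← mulVec_mulVec]
  have h : I ∘ swap a b ∘ swap c d = I ∘ swap c d ∘ swap a b := by
    rw [← Perm.coe_mul, ← Perm.coe_mul, (Perm.disjoint_iff_disjoint_support.2 ?_).commute.eq]
    by_cases h1 : a = b
    · subst h1; simp
    by_cases h2 : c = d
    · subst h2; simp
    simp [Perm.support_swap h1, Perm.support_swap h2, hac.symm, had.symm, hbc.symm, hbd.symm]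
  simp only [twoLeg_mulVec, Function.comp_apply, swap_apply_of_ne_of_ne hac.symm hbc.symm,
    swap_apply_of_ne_of_ne had.symm hbd.symm, swap_apply_of_ne_of_ne hac had,
    swap_apply_of_ne_of_ne hbc hbd, Function.comp_assoc, h]
  ring

theorem lift_twoLeg_comm_leg {a b c : Fin n} (hac : a ≠ c) (hbc : b ≠ c)
    (α β : Fin N → Fin N → F) (M : Matrix (Fin N) (Fin N) B) :
    lift B (twoLeg a b α β) * leg c M = leg c M * lift B (twoLeg a b α β) := by
  refine ext_mulVec fun f I => ?_
  rw [← mulVec_mulVec, ← mulVec_mulVec]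
  have h : ∀ p, Function.update (I ∘ swap a b) c p = Function.update I c p ∘ swap a b := by
    intro p
    funext x
    by_cases hx : x = c
    · subst hx; simp [swap_apply_of_ne_of_ne hac.symm hbc.symm]
    · have : swap a b x ≠ c := by
        intro h
        apply hx
        rw [← swap_apply_of_ne_of_ne hac.symm hbc.symm] at h
        exact (swap a b).injective h
      simp [hx, this]
  simp only [lift_twoLeg_mulVec, leg_mulVec, Function.comp_apply,
    swap_apply_of_ne_of_ne hac.symm hbc.symm, Function.update_of_ne hac, Function.update_of_ne hbc,
    h, Finset.smul_sum, mul_add, Finset.sum_add_distrib, mul_smul_comm]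

/-- Exchange relation between the entries of two matrices, with the scalar matrix
`f ↦ α(i, j) f(i, j) + β(i, j) f(j, i)` in the role of the `R`-matrix. -/
def Exchange (α β : Fin N → Fin N → F) (L L' : Matrix (Fin N) (Fin N) B) : Prop :=
  ∀ i j k l, α i j • (L i k * L' j l) + β i j • (L j k * L' i l)
    = α k l • (L' j l * L i k) + β l k • (L' j k * L i l)

/-- The entrywise relation is R_{ab} L_a L'_b = L'_b L_a R_{ab} read off at the value of the test
vector with entries p, r in positions a, b. Here it is reassembled. -/
theorem Exchange.leg {a b : Fin n} (hab : a ≠ b) {α β : Fin N → Fin N → F}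
    {L L' : Matrix (Fin N) (Fin N) B} (h : Exchange α β L L') :
    lift B (twoLeg a b α β) * (leg a L * leg b L')
      = leg b L' * leg a L * lift B (twoLeg a b α β) := by
  refine ext_mulVec fun f I => ?_
  simp only [← mulVec_mulVec]
  have hs : ∀ p r, Function.update (Function.update I b r) a p ∘ swap a b
      = Function.update (Function.update I b p) a r := by
    intro p r
    funext x
    by_cases hx : x = a
    · subst hx; simp [hab.symm]
    · by_cases hxb : x = b
      · subst hxb; simp [hx]
      · simp [hx, hxb, swap_apply_of_ne_of_ne hx hxb]
  have hs' : ∀ p r, Function.update (Function.update (I ∘ swap a b) a p) b r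
      = Function.update (Function.update I b r) a p := by
    intro p r
    funext x
    by_cases hx : x = a
    · subst hx; simp [hab]
    · by_cases hxb : x = b
      · subst hxb; simp [hx]
      · simp [hx, hxb, swap_apply_of_ne_of_ne hx hxb]
  simp only [lift_twoLeg_mulVec, leg_mulVec, Function.comp_apply, swap_apply_left,
    swap_apply_right, Function.update_of_ne hab, Function.update_of_ne hab.symm,
    Function.update_self, hs, hs', Finset.smul_sum, mul_add, Finset.mul_sum,
    Finset.sum_add_distrib, mul_smul_comm]
  simp only [Function.update_comm hab, ← mul_assoc]
  rw [Finset.sum_comm (f := fun r p => α p r • _)]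
  simp only [← Finset.sum_add_distrib]
  refine Finset.sum_congr rfl fun p _ => Finset.sum_congr rfl fun r _ => ?_
  have := congrArg (· * f (Function.update (Function.update I b r) a p)) (h (I a) (I b) p r)
  simpa [add_mul] using this

end TwoLegs

/-! ### The trigonometric quantum R-matrix and its Lax form -/

section RMatrix

variable {N n : ℕ} {F : Type} [CommRing F]

/-- The coefficient of `e_{ii} ⊗ e_{jj}` in the quantum `R`-matrix; `q'` stands for `q⁻¹`. -/
def rDiag (q q' u v : F) (i j : Fin N) : F := if i = j then q * v - q' * u else v - u

/-- The coefficient of `e_{ij} ⊗ e_{ji}`, `i ≠ j`, in the quantum `R`-matrix. -/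
def rFlip (q q' u v : F) (i j : Fin N) : F :=
  if i < j then (q - q') * v else if j < i then (q - q') * u else 0

theorem rFlip_self (q q' u v : F) (i : Fin N) : rFlip q q' u v i i = 0 := by simp [rFlip]

-- The Yang–Baxter equation, case by case in the relative order of i, j, k. The relation qq' = 1
-- enters only when exactly two neighbouring indices coincide. The R-matrix is homogeneous in its
-- two parameters, so one may rescale u and v by x in two of the three factors only; this freedom
-- later accommodates inhomogeneities.
set_option linter.unusedSimpArgs false in
theorem yangBaxter_fun {q q' : F} (hq : q * q' = 1) (u v w x : F)
    (f : Fin N → Fin N → Fin N → F) (i j k : Fin N) :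
    rDiag q q' u v i j *
        (rDiag q q' (u * x) w i k *
            (rDiag q q' (v * x) w j k * f i j k + rFlip q q' (v * x) w j k * f i k j) +
          rFlip q q' (u * x) w i k *
            (rDiag q q' (v * x) w j i * f k j i + rFlip q q' (v * x) w j i * f k i j)) +
      rFlip q q' u v i j *
        (rDiag q q' (u * x) w j k *
            (rDiag q q' (v * x) w i k * f j i k + rFlip q q' (v * x) w i k * f j k i) +
          rFlip q q' (u * x) w j k *
            (rDiag q q' (v * x) w i j * f k i j + rFlip q q' (v * x) w i j * f k j i)) =
    rDiag q q' (v * x) w j k *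
        (rDiag q q' (u * x) w i k *
            (rDiag q q' u v i j * f i j k + rFlip q q' u v i j * f j i k) +
          rFlip q q' (u * x) w i k *
            (rDiag q q' u v k j * f k j i + rFlip q q' u v k j * f j k i)) +
      rFlip q q' (v * x) w j k *
        (rDiag q q' (u * x) w i j *
            (rDiag q q' u v i k * f i k j + rFlip q q' u v i k * f k i j) +
          rFlip q q' (u * x) w i j *
            (rDiag q q' u v j k * f j k i + rFlip q q' u v j k * f k j i)) := by
  rcases lt_trichotomy i j with h1 | h1 | h1
  · rcases lt_trichotomy j k with h2 | h2 | h2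
    · have h3 := h1.trans h2
      simp only [rDiag, rFlip, h1, h2, h3, h1.ne, h2.ne, h3.ne, h1.ne', h2.ne', h3.ne',
        h1.not_gt, h2.not_gt, h3.not_gt, if_true, if_false]
      ring
    · subst h2
      simp only [rDiag, rFlip, h1, h1.ne, h1.ne', h1.not_gt, lt_irrefl, if_true, if_false]
      linear_combination (q' - q) * w * (u - v) * (v * x - w) * f j j i * hq
    · rcases lt_trichotomy i k with h3 | h3 | h3
      · simp only [rDiag, rFlip, h1, h2, h3, h1.ne, h2.ne, h3.ne, h1.ne', h2.ne', h3.ne',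
          h1.not_gt, h2.not_gt, h3.not_gt, if_true, if_false]
        ring
      · subst h3
        simp only [rDiag, rFlip, h1, h1.ne, h1.ne', h1.not_gt, lt_irrefl, if_true, if_false]
        ring
      · simp only [rDiag, rFlip, h1, h2, h3, h1.ne, h2.ne, h3.ne, h1.ne', h2.ne', h3.ne',
          h1.not_gt, h2.not_gt, h3.not_gt, if_true, if_false]
        ring
  · subst h1
    rcases lt_trichotomy i k with h3 | h3 | h3
    · simp only [rDiag, rFlip, h3, h3.ne, h3.ne', h3.not_gt, lt_irrefl, if_true, if_false]
      linear_combination -(q' - q) * w * (u - v) * (v * x - w) * f k i i * hq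
    · subst h3
      simp only [rDiag, rFlip, lt_irrefl, if_true, if_false]
      ring
    · simp only [rDiag, rFlip, h3, h3.ne, h3.ne', h3.not_gt, lt_irrefl, if_true, if_false]
      linear_combination -(q' - q) * (u * x) * (u - v) * (v * x - w) * f k i i * hq
  · rcases lt_trichotomy j k with h2 | h2 | h2
    · rcases lt_trichotomy i k with h3 | h3 | h3
      · simp only [rDiag, rFlip, h1, h2, h3, h1.ne, h2.ne, h3.ne, h1.ne', h2.ne', h3.ne',
          h1.not_gt, h2.not_gt, h3.not_gt, if_true, if_false]
        ring
      · subst h3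
        simp only [rDiag, rFlip, h1, h1.ne, h1.ne', h1.not_gt, lt_irrefl, if_true, if_false]
        ring
      · simp only [rDiag, rFlip, h1, h2, h3, h1.ne, h2.ne, h3.ne, h1.ne', h2.ne', h3.ne',
          h1.not_gt, h2.not_gt, h3.not_gt, if_true, if_false]
        ring
    · subst h2
      simp only [rDiag, rFlip, h1, h1.ne, h1.ne', h1.not_gt, lt_irrefl, if_true, if_false]
      linear_combination (q' - q) * (u * x) * (u - v) * (v * x - w) * f j j i * hq
    · have h3 := h2.trans h1
      simp only [rDiag, rFlip, h1, h2, h3, h1.ne, h2.ne, h3.ne, h1.ne', h2.ne', h3.ne',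
        h1.not_gt, h2.not_gt, h3.not_gt, if_true, if_false]
      ring

/-- The quantum `R`-matrix acting in the tensor factors `a` and `b`. -/
def rLeg (q q' u v : F) (a b : Fin n) : TensorMat N n F :=
  twoLeg a b (rDiag q q' u v) (rFlip q q' u v)

theorem yangBaxter {q q' : F} (hq : q * q' = 1) (u v w : F) {a b c : Fin n} (hab : a ≠ b)
    (hac : a ≠ c) (hbc : b ≠ c) :
    (rLeg q q' u v a b * rLeg q q' u w a c * rLeg q q' v w b c : TensorMat N n F)
      = rLeg q q' v w b c * rLeg q q' u w a c * rLeg q q' u v a b := by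
  refine ext_mulVec fun f I => ?_
  -- The three operators change only the entries at a, b, c. Freezing the rest of I reduces the
  -- claim to the identity for functions of three indices.
  let t : Fin N → Fin N → Fin N → Fin n → Fin N := fun i j k =>
    Function.update (Function.update (Function.update I a i) b j) c k
  have ta : ∀ i j k, t i j k a = i := fun i j k => by simp [t, hab, hac]
  have tb : ∀ i j k, t i j k b = j := fun i j k => by simp [t, hbc]
  have tc : ∀ i j k, t i j k c = k := fun i j k => by simp [t]
  have tx : ∀ i j k x, x ≠ a → x ≠ b → x ≠ c → t i j k x = I x := fun i j k x h1 h2 h3 => by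
    simp [t, h1, h2, h3]
  have key : ∀ J J' : Fin n → Fin N, J a = J' a → J b = J' b → J c = J' c →
      (∀ x, x ≠ a → x ≠ b → x ≠ c → J x = J' x) → J = J' := by
    intro J J' h1 h2 h3 h4
    funext x
    by_cases hxa : x = a
    · rw [hxa, h1]
    by_cases hxb : x = b
    · rw [hxb, h2]
    by_cases hxc : x = c
    · rw [hxc, h3]
    exact h4 x hxa hxb hxc
  have sab : ∀ i j k, t i j k ∘ swap a b = t j i k := fun i j k =>
    key _ _ (by simp [ta, tb]) (by simp [ta, tb])
      (by simp [tc, swap_apply_of_ne_of_ne hac.symm hbc.symm])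
      fun x h1 h2 h3 => by simp [swap_apply_of_ne_of_ne h1 h2, tx _ _ _ x h1 h2 h3]
  have sac : ∀ i j k, t i j k ∘ swap a c = t k j i := fun i j k =>
    key _ _ (by simp [ta, tc]) (by simp [tb, swap_apply_of_ne_of_ne hab.symm hbc])
      (by simp [ta, tc])
      fun x h1 h2 h3 => by simp [swap_apply_of_ne_of_ne h1 h3, tx _ _ _ x h1 h2 h3]
  have sbc : ∀ i j k, t i j k ∘ swap b c = t i k j := fun i j k =>
    key _ _ (by simp [ta, swap_apply_of_ne_of_ne hab hac]) (by simp [tb, tc])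
      (by simp [tb, tc])
      fun x h1 h2 h3 => by simp [swap_apply_of_ne_of_ne h2 h3, tx _ _ _ x h1 h2 h3]
  have hI : I = t (I a) (I b) (I c) :=
    key _ _ (ta _ _ _).symm (tb _ _ _).symm (tc _ _ _).symm
      fun x h1 h2 h3 => (tx _ _ _ x h1 h2 h3).symm
  rw [hI]
  generalize I a = i, I b = j, I c = k
  simp only [← mulVec_mulVec, rLeg, twoLeg_mulVec, sab, sac, sbc, ta, tb, tc]
  simpa only [mul_one] using yangBaxter_fun hq u v w 1 (fun i j k => f (t i j k)) i j k

theorem rLeg_mul_rLeg {q q' : F} (hq : q * q' = 1) (u v : F) {a b : Fin n} (hab : a ≠ b) :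
    (rLeg q q' u v a b * rLeg q q' v u b a : TensorMat N n F)
      = ((q * v - q' * u) * (q * u - q' * v)) • 1 := by
  refine ext_mulVec fun f I => ?_
  simp only [← mulVec_mulVec, rLeg, twoLeg_mulVec, Function.comp_apply, swap_apply_left,
    swap_apply_right, smul_mulVec, one_mulVec, Pi.smul_apply, smul_eq_mul, swap_comm b a,
    Function.comp_assoc]
  rw [← Perm.coe_mul, Equiv.swap_mul_self, Perm.coe_one, Function.comp_id]
  rcases lt_trichotomy (I a) (I b) with h | h | h
  · simp only [rDiag, rFlip, h, h.ne, h.ne', h.not_gt, if_true, if_false]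
    linear_combination (u - v) ^ 2 * f I * hq
  · have : I ∘ swap a b = I := by
      funext x
      by_cases hxa : x = a
      · subst hxa; simp [h]
      by_cases hxb : x = b
      · subst hxb; simp [h]
      simp [swap_apply_of_ne_of_ne hxa hxb]
    simp only [rDiag, rFlip, h, lt_irrefl, if_true, if_false, this]
    ring
  · simp only [rDiag, rFlip, h, h.ne, h.ne', h.not_gt, if_true, if_false]
    linear_combination (u - v) ^ 2 * f I * hq

/-- The quantum `R`-matrix as an `N × N` matrix (first factor) over `End ℂ^N` (second factor). -/
def rLax (N : ℕ) (q q' u v : F) : Matrix (Fin N) (Fin N) (Matrix (Fin N) (Fin N) F) :=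
  fun i k => (if i = k then diagonal (rDiag q q' u v i) else 0) + single k i (rFlip q q' u v i k)

theorem rLax_mulVec (q q' u v : F) (i k : Fin N) (g : Fin N → F) (p : Fin N) :
    (rLax N q q' u v i k *ᵥ g) p = (if i = k then rDiag q q' u v i p * g p else 0)
      + if p = k then rFlip q q' u v i p * g i else 0 := by
  rw [rLax, add_mulVec, Pi.add_apply]
  congr 1
  · split_ifs
    · rw [mulVec_diagonal]
    · simp
  · by_cases h : p = k
    · subst h; simp [single_mulVec]
    · simp [single_mulVec, h]

/-- This is the Yang–Baxter equation with the third tensor factor regarded as the algebra in which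
the entries of L live. -/
theorem rLax_exchange {q q' : F} (hq : q * q' = 1) (u v w x : F) :
    Exchange (rDiag q q' u v) (rFlip q q' u v) (rLax N q q' (u * x) w) (rLax N q q' (v * x) w) := by
  intro i j k l
  refine ext_mulVec fun g p => ?_
  let δ : Fin N → Fin N → F := fun x y => if x = y then 1 else 0
  have hL : ∀ u i k (g : Fin N → F) p, (rLax N q q' u w i k *ᵥ g) p
      = δ i k * rDiag q q' u w i p * g p + δ p k * rFlip q q' u w i p * g i := by
    intro u i k g p
    rw [rLax_mulVec]
    simp only [δ]
    split_ifs <;> simp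
  -- The deltas fix the first two indices as the column indices k, l. The relations `ha` and `hb`
  -- then move the weights between (k, l) and the current pair of indices.
  have h := yangBaxter_fun hq u v w x (fun i j p => δ i k * δ j l * g p) i j p
  have ha : ∀ x y, rDiag q q' u v k l * (δ x k * δ y l) = rDiag q q' u v x y * (δ x k * δ y l) := by
    intro x y
    simp only [δ]
    split_ifs <;> simp_all
  have hb : ∀ x y, rFlip q q' u v l k * (δ x l * δ y k) = rFlip q q' u v x y * (δ x l * δ y k) := by
    intro x y
    simp only [δ]
    split_ifs <;> simp_all
  simp only [add_mulVec, smul_mulVec, ← mulVec_mulVec, Pi.add_apply, Pi.smul_apply, smul_eq_mul,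
    hL]
  linear_combination h
    - rDiag q q' (v * x) w j p * rDiag q q' (u * x) w i p * g p * (ha i j + hb i j)
    - rDiag q q' (v * x) w j p * rFlip q q' (u * x) w i p * g i * (ha p j + hb p j)
    - rFlip q q' (v * x) w j p * rDiag q q' (u * x) w i j * g j * (ha i p + hb i p)
    - rFlip q q' (v * x) w j p * rFlip q q' (u * x) w i j * g i * (ha j p + hb j p)

section Exchange

variable {B : Type} [Ring B] [Algebra F B]

theorem Exchange.one (α β : Fin N → Fin N → F) (hβ : ∀ i, β i i = 0) :
    Exchange α β (1 : Matrix (Fin N) (Fin N) B) 1 := by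
  intro i j k l
  simp only [Matrix.one_apply]
  split_ifs <;> simp_all

theorem Exchange.map {B' : Type} [Ring B'] [Algebra F B'] (φ : B →+* B')
    (hφ : ∀ (c : F) b, φ (c • b) = c • φ b)
    {α β : Fin N → Fin N → F} {L L' : Matrix (Fin N) (Fin N) B} (h : Exchange α β L L') :
    Exchange α β (L.map φ) (L'.map φ) := by
  intro i j k l
  have := congrArg φ (h i j k l)
  simpa only [map_add, map_mul, hφ, Matrix.map_apply] using this

/-- The coproduct: if the entries of M, M' commute with those of L', L, the R-matrix can be carried
through the L-factors and then through the M-factors. This is what lets sites be multiplied into a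
monodromy matrix. -/
theorem Exchange.mul {α β : Fin N → Fin N → F} {L L' M M' : Matrix (Fin N) (Fin N) B}
    (h : Exchange α β L L') (h' : Exchange α β M M')
    (hc : ∀ i j k l, M i j * L' k l = L' k l * M i j)
    (hc' : ∀ i j k l, L i j * M' k l = M' k l * L i j) :
    Exchange α β (L * M) (L' * M') := by
  intro i j k l
  have e1 : ∀ i j k l, (L * M) i k * (L' * M') j l
      = ∑ p, ∑ r, (L i p * L' j r) * (M p k * M' r l) := by
    intro i j k l
    simp only [Matrix.mul_apply, Finset.sum_mul, Finset.mul_sum]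
    rw [Finset.sum_comm]
    refine Finset.sum_congr rfl fun p _ => Finset.sum_congr rfl fun r _ => ?_
    simp only [mul_assoc]
    rw [← mul_assoc (M _ _), hc]
    simp only [mul_assoc]
  have e2 : ∀ i j k l, (L' * M') j l * (L * M) i k
      = ∑ p, ∑ r, (L' j r * L i p) * (M' r l * M p k) := by
    intro i j k l
    simp only [Matrix.mul_apply, Finset.sum_mul, Finset.mul_sum]
    refine Finset.sum_congr rfl fun p _ => Finset.sum_congr rfl fun r _ => ?_
    simp only [mul_assoc]
    rw [← mul_assoc (M' _ _), ← hc']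
    simp only [mul_assoc]
  simp only [e1, e2, Finset.smul_sum, ← Finset.sum_add_distrib]
  calc _ = ∑ p, ∑ r, (α i j • (L i p * L' j r) + β i j • (L j p * L' i r)) * (M p k * M' r l) := by
        simp only [add_mul, smul_mul_assoc]
    _ = ∑ p, ∑ r, (α p r • (L' j r * L i p) + β r p • (L' j p * L i r)) * (M p k * M' r l) := by
        simp only [h i j]
    _ = ∑ p, ∑ r, (L' j r * L i p) * (α p r • (M p k * M' r l) + β p r • (M r k * M' p l)) := by
        simp only [add_mul, mul_add, Finset.sum_add_distrib, smul_mul_assoc, mul_smul_comm]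
        congr 1
        exact Finset.sum_comm
    _ = _ := by
        simp only [h' _ _ k l, mul_add, mul_smul_comm]

end Exchange

end RMatrix

/-! ### Ordered products of legs -/

section LegProd

variable {N n : ℕ} {A : Type} [Ring A]

/-- The product of the `(M a)_a`, in the order of the list. -/
def legProd (l : List (Fin n)) (M : Fin n → Matrix (Fin N) (Fin N) A) : TensorMat N n A :=
  (l.map fun a => leg a (M a)).prod

theorem legProd_append (l l' : List (Fin n)) (M : Fin n → Matrix (Fin N) (Fin N) A) :
    legProd (l ++ l') M = legProd l M * legProd l' M := by
  simp [legProd]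

/-- Distinct legs touch distinct indices, so no summation survives: an entry of the product is an
ordered product of entries. -/
theorem legProd_apply {l : List (Fin n)} (hl : l.Nodup) (M : Fin n → Matrix (Fin N) (Fin N) A)
    (I J : Fin n → Fin N) :
    legProd l M I J
      = if ∀ c, c ∉ l → I c = J c then (l.map fun a => M a (I a) (J a)).prod else 0 := by
  induction l generalizing I with
  | nil =>
    simp only [legProd, List.map_nil, List.prod_nil, Matrix.one_apply]
    exact if_congr (by simp [funext_iff]) rfl rfl
  | cons a l ih =>
    rw [List.nodup_cons] at hl
    have h1 : legProd (a :: l) M I J = (leg a (M a) *ᵥ fun K => legProd l M K J) I := by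
      simp only [legProd, List.map_cons, List.prod_cons, Matrix.mul_apply, mulVec, dotProduct]
    rw [h1, leg_mulVec]
    simp only [ih hl.2]
    have h2 : ∀ p, (l.map fun x => M x (Function.update I a p x) (J x))
        = l.map fun x => M x (I x) (J x) := by
      intro p
      refine List.map_congr_left fun x hx => ?_
      rw [Function.update_of_ne (by rintro rfl; exact hl.1 hx)]
    simp only [h2]
    rw [Finset.sum_eq_single (J a)]
    · rw [mul_ite, mul_zero, List.map_cons, List.prod_cons]
      refine if_congr ⟨fun h c hc => ?_, fun h c hc => ?_⟩ rfl rfl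
      · rw [List.mem_cons, not_or] at hc
        have := h c hc.2
        rwa [Function.update_of_ne hc.1] at this
      · by_cases hca : c = a
        · subst hca; simp
        · rw [Function.update_of_ne hca]
          exact h c (by simp [hca, hc])
    · intro p _ hp
      rw [if_neg, mul_zero]
      intro h
      have := h a hl.1
      rw [Function.update_self] at this
      exact hp this
    · simp

theorem legProd_apply_of_forall_mem {l : List (Fin n)} (hl : l.Nodup) (hm : ∀ c, c ∈ l)
    (M : Fin n → Matrix (Fin N) (Fin N) A) (I J : Fin n → Fin N) :
    legProd l M I J = (l.map fun a => M a (I a) (J a)).prod := by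
  rw [legProd_apply hl, if_pos fun c hc => absurd (hm c) hc]

end LegProd

/-! ### The permutation action conjugated by q to the number of inversions -/

section PermMat

variable {N n : ℕ} {F : Type} [Field F]

/-- The weight of an ordered pair. -/
def pairWt (q : F) (i j : Fin N) : F := if j < i then q else 1

/-- `q` to the number of inversions of a multi-index. -/
def invWt (q : F) (I : Fin n → Fin N) : F := ∏ x, ∏ y, if x < y then pairWt q (I x) (I y) else 1

theorem pairWt_ne_zero {q : F} (hq : q ≠ 0) (i j : Fin N) : pairWt q i j ≠ 0 := by
  unfold pairWt
  split_ifs <;> simp [hq]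

theorem invWt_ne_zero {q : F} (hq : q ≠ 0) (I : Fin n → Fin N) : invWt q I ≠ 0 := by
  unfold invWt
  refine Finset.prod_ne_zero_iff.2 fun x _ => Finset.prod_ne_zero_iff.2 fun y _ => ?_
  split_ifs
  exacts [pairWt_ne_zero hq _ _, one_ne_zero]

/-- The action of the symmetric group on `(ℂ^N)^{⊗ n}`, deformed by `q`. -/
def permMat (N : ℕ) {q : F} (hq : q ≠ 0) : Perm (Fin n) →* TensorMat N n F where
  toFun σ := Matrix.of fun I J => if J = I ∘ σ then invWt q I / invWt q J else 0
  map_one' := by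
    ext I J
    simp only [Perm.coe_one, Function.comp_id, Matrix.one_apply, Matrix.of_apply]
    by_cases h : I = J
    · subst h; simp [invWt_ne_zero hq]
    · simp [h, Ne.symm h]
  map_mul' σ τ := by
    ext I J
    rw [Matrix.mul_apply, Finset.sum_eq_single (I ∘ σ)]
    · simp only [Matrix.of_apply]
      by_cases h : J = (I ∘ σ) ∘ τ
      · subst h
        have := invWt_ne_zero hq (I ∘ σ)
        simp only [Perm.coe_mul, Function.comp_assoc, if_true]
        field_simp
      · simp only [Perm.coe_mul, Function.comp_assoc, if_true] at h ⊢
        simp [h]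
    · intro K _ hK
      simp [hK]
    · simp

theorem permMat_apply {q : F} (hq : q ≠ 0) (σ : Perm (Fin n)) (I J : Fin n → Fin N) :
    permMat N hq σ I J = if J = I ∘ σ then invWt q I / invWt q J else 0 := rfl

/-- The coefficient of `e_{ij} ⊗ e_{ji}` in the deformed flip. -/
def flipWt (q : F) (i j : Fin N) : F := if i < j then q⁻¹ else if j < i then q else 1

/-- Exchanging neighbours a, b preserves the order of every pair of positions except (a, b) itself,
so the factor of this pair is the only one that changes. -/
theorem invWt_swap (q : F) (I : Fin n → Fin N) {a b : Fin n} (hab : (b : ℕ) = a + 1) :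
    invWt q (I ∘ swap a b) * pairWt q (I a) (I b) = invWt q I * pairWt q (I b) (I a) := by
  have hne : a ≠ b := by rintro rfl; omega
  have hlt : a < b := Fin.lt_def.2 (by omega)
  have h1 : invWt q (I ∘ swap a b)
      = ∏ x, ∏ y, if swap a b x < swap a b y then pairWt q (I x) (I y) else 1 := by
    unfold invWt
    rw [← Equiv.prod_comp (swap a b)]
    refine Finset.prod_congr rfl fun x _ => ?_
    rw [← Equiv.prod_comp (swap a b)]
    simp
  have h2 : ∀ c d : Fin n, ∀ z : F,
      (∏ x : Fin n, ∏ y : Fin n, if x = c ∧ y = d then z else 1) = z := by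
    intro c d z
    rw [Finset.prod_eq_single c, Finset.prod_eq_single d]
    · simp
    · intro y _ hy; simp [hy]
    · simp
    · intro x _ hx; simp [hx]
    · simp
  rw [h1, invWt, ← h2 a b (pairWt q (I a) (I b)), ← h2 b a (pairWt q (I b) (I a))]
  simp only [← Finset.prod_mul_distrib]
  refine Finset.prod_congr rfl fun x _ => Finset.prod_congr rfl fun y _ => ?_
  by_cases hxa : x = a
  · subst hxa
    by_cases hyb : y = b
    · subst hyb
      simp [hlt, hlt.not_gt, hne]
    · by_cases hya : y = x
      · subst hya; simp [hne]
      · have : b < y ↔ x < y := by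
          simp only [Fin.lt_def, Fin.ext_iff] at *
          omega
        simp [hne, hyb, swap_apply_of_ne_of_ne hya hyb, this]
  · by_cases hxb : x = b
    · subst hxb
      by_cases hya : y = a
      · subst hya
        simp [hlt, hlt.not_gt, hne.symm]
      · by_cases hyb : y = x
        · subst hyb; simp [hxa]
        · have : a < y ↔ x < y := by
            simp only [Fin.lt_def, Fin.ext_iff] at *
            omega
          simp [hxa, hya, swap_apply_of_ne_of_ne hya hyb, this]
    · by_cases hya : y = a
      · subst hya
        have : x < b ↔ x < y := by
          simp only [Fin.lt_def, Fin.ext_iff] at *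
          omega
        simp [hxa, hxb, swap_apply_of_ne_of_ne hxa hxb, this]
      · by_cases hyb : y = b
        · subst hyb
          have : x < a ↔ x < y := by
            simp only [Fin.lt_def, Fin.ext_iff] at *
            omega
          simp [hxa, hxb, swap_apply_of_ne_of_ne hxa hxb, this]
        · simp [hxa, hxb, swap_apply_of_ne_of_ne hxa hxb, swap_apply_of_ne_of_ne hya hyb]

/-- The inversion number depends on the whole multi-index, but its change under an adjacent
transposition depends on two entries only. The conjugated action is therefore local on neighbours,
which links it to the R-matrix; for distant positions the entries in between would intervene. -/
theorem permMat_swap {q : F} (hq : q ≠ 0) {a b : Fin n} (hab : (b : ℕ) = a + 1) :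
    permMat N hq (swap a b) = twoLeg a b (fun _ _ => 0) (flipWt q) := by
  ext I J
  rw [permMat_apply, twoLeg]
  simp only [ite_self, zero_add]
  by_cases h : J = I ∘ swap a b
  · rw [if_pos h, if_pos h, h]
    have h1 := invWt_swap q I hab
    rw [div_eq_iff (invWt_ne_zero hq _)]
    have h2 := pairWt_ne_zero hq (I b) (I a)
    refine mul_right_cancel₀ h2 ?_
    rw [← h1]
    have h3 : pairWt q (I a) (I b) = flipWt q (I a) (I b) * pairWt q (I b) (I a) := by
      unfold pairWt flipWt
      rcases lt_trichotomy (I a) (I b) with h | h | h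
      · simp [h, h.not_gt, hq]
      · simp [h]
      · simp [h, h.not_gt]
    rw [h3]
    ring
  · rw [if_neg h, if_neg h]

/-- The juxtaposition of two permutations. -/
def sumPerm (m l : ℕ) : Perm (Fin m) × Perm (Fin l) →* Perm (Fin (m + l)) :=
  finSumFinEquiv.permCongrHom.toMonoidHom.comp (Perm.sumCongrHom _ _)

@[simp]
theorem sumPerm_castAdd {m l : ℕ} (σ : Perm (Fin m) × Perm (Fin l)) (a : Fin m) :
    sumPerm m l σ (Fin.castAdd l a) = Fin.castAdd l (σ.1 a) := by
  simp [sumPerm, Equiv.permCongr_apply]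

@[simp]
theorem sumPerm_natAdd {m l : ℕ} (σ : Perm (Fin m) × Perm (Fin l)) (b : Fin l) :
    sumPerm m l σ (Fin.natAdd m b) = Fin.natAdd m (σ.2 b) := by
  simp [sumPerm, Equiv.permCongr_apply]

theorem sign_sumPerm {m l : ℕ} (σ : Perm (Fin m) × Perm (Fin l)) :
    Perm.sign (sumPerm m l σ) = Perm.sign σ.1 * Perm.sign σ.2 := by
  simp only [sumPerm, MonoidHom.comp_apply, MulEquiv.toMonoidHom_eq_coe, MonoidHom.coe_coe,
    Equiv.permCongrHom_coe, Perm.sign_permCongr]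
  exact Perm.sign_sumCongr _ _

theorem invWt_add {m l : ℕ} (q : F) (I : Fin (m + l) → Fin N) :
    invWt q I = invWt q (I ∘ Fin.castAdd l) * invWt q (I ∘ Fin.natAdd m)
      * ∏ a : Fin m, ∏ b : Fin l, pairWt q (I (Fin.castAdd l a)) (I (Fin.natAdd m b)) := by
  have h1 : ∀ (a : Fin m) (b : Fin l), Fin.castAdd l a < Fin.natAdd m b := fun a b => by
    simp only [Fin.lt_def, Fin.val_castAdd, Fin.val_natAdd]; omega
  have h2 : ∀ a a' : Fin m, Fin.castAdd l a < Fin.castAdd l a' ↔ a < a' := fun _ _ => Iff.rfl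
  simp only [invWt, Fin.prod_univ_add, h1, h2, (h1 _ _).not_gt, if_true, if_false,
    Finset.prod_const_one, Finset.prod_mul_distrib, Function.comp_apply,
    Fin.natAdd_lt_natAdd_iff]
  ring

/-- Permuting inside the two blocks does not alter the number of inversions between them, so these
cancel in the ratio. -/
theorem invWt_div_sumPerm {m l : ℕ} {q : F} (hq : q ≠ 0) (σ : Perm (Fin m) × Perm (Fin l))
    (I : Fin (m + l) → Fin N) :
    invWt q I / invWt q (I ∘ sumPerm m l σ)
      = (invWt q (I ∘ Fin.castAdd l) / invWt q ((I ∘ Fin.castAdd l) ∘ σ.1))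
        * (invWt q (I ∘ Fin.natAdd m) / invWt q ((I ∘ Fin.natAdd m) ∘ σ.2)) := by
  have h : invWt q (I ∘ sumPerm m l σ)
      = invWt q ((I ∘ Fin.castAdd l) ∘ σ.1) * invWt q ((I ∘ Fin.natAdd m) ∘ σ.2)
      * ∏ a : Fin m, ∏ b : Fin l, pairWt q (I (Fin.castAdd l a)) (I (Fin.natAdd m b)) := by
    rw [invWt_add]
    congr 1
    · congr 2 <;> funext x <;> simp
    · rw [← Equiv.prod_comp σ.1 fun a =>
        ∏ b : Fin l, pairWt q (I (Fin.castAdd l a)) (I (Fin.natAdd m b))]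
      refine Finset.prod_congr rfl fun a _ => ?_
      rw [← Equiv.prod_comp σ.2 fun b => pairWt q (I (Fin.castAdd l (σ.1 a))) (I (Fin.natAdd m b))]
      simp
  have hp : ∏ a : Fin m, ∏ b : Fin l, pairWt q (I (Fin.castAdd l a)) (I (Fin.natAdd m b)) ≠ 0 :=
    Finset.prod_ne_zero_iff.2 fun x _ => Finset.prod_ne_zero_iff.2 fun y _ => pairWt_ne_zero hq _ _
  have h1 := invWt_ne_zero hq ((I ∘ Fin.castAdd l) ∘ σ.1)
  have h2 := invWt_ne_zero hq ((I ∘ Fin.natAdd m) ∘ σ.2)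
  rw [h, invWt_add q I]
  field_simp

end PermMat

/-! ### Traces of strings and the Manin property -/

section Strings

variable {N n : ℕ} {F : Type} [Field F] {B : Type} [Ring B] [Algebra F B]

/-- The product `(M_s)_1 (M_{s+1})_2 ⋯ (M_{s+n-1})_n`. -/
def strMat (n s : ℕ) (M : ℕ → Matrix (Fin N) (Fin N) B) : TensorMat N n B :=
  legProd (List.finRange n) fun a => M (s + a)

/-- Over a noncommutative ring the trace is not cyclic, but matrices with scalar entries can still
be moved around it. Every cyclic move below is of this kind. -/
theorem trace_lift_mul_comm {ι : Type*} [Fintype ι] [DecidableEq ι] (S : Matrix ι ι F)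
    (Z : Matrix ι ι B) : trace (lift B S * Z) = trace (Z * lift B S) := by
  simp only [trace, diag, Matrix.mul_apply, RingHom.mapMatrix_apply, Matrix.map_apply]
  rw [Finset.sum_comm]
  simp only [Algebra.commutes]

theorem trace_permMat_mul {q : F} (hq : q ≠ 0) (σ : Perm (Fin n)) (Z : TensorMat N n B) :
    trace (lift B (permMat N hq σ) * Z)
      = ∑ I, (invWt q I / invWt q (I ∘ σ)) • Z (I ∘ σ) I := by
  simp only [trace, diag, Matrix.mul_apply, RingHom.mapMatrix_apply, Matrix.map_apply,
    permMat_apply]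
  refine Finset.sum_congr rfl fun I _ => ?_
  rw [Finset.sum_eq_single (I ∘ σ)]
  · simp [Algebra.smul_def]
  · intro J _ hJ; simp [hJ]
  · simp

/-- The trace of a permutation times a string. -/
def permTrace {q : F} (hq : q ≠ 0) (n s : ℕ) (M : ℕ → Matrix (Fin N) (Fin N) B)
    (σ : Perm (Fin n)) : B :=
  trace (lift B (permMat N hq σ) * strMat n s M)

theorem finRange_add (m l : ℕ) : List.finRange (m + l)
    = (List.finRange m).map (Fin.castAdd l) ++ (List.finRange l).map (Fin.natAdd m) := by
  have h : List.finRange (m + l) = List.ofFn fun i : Fin (m + l) => i := by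
    rw [List.ofFn_eq_map, List.map_id']
  rw [h, List.ofFn_add, ← List.ofFn_eq_map, ← List.ofFn_eq_map]
  rfl

theorem sum_fin_add {m l : ℕ} {A : Type*} [AddCommMonoid A]
    (g : (Fin m → Fin N) → (Fin l → Fin N) → A) :
    ∑ I : Fin (m + l) → Fin N, g (I ∘ Fin.castAdd l) (I ∘ Fin.natAdd m) = ∑ I, ∑ J, g I J := by
  rw [← Fintype.sum_prod_type', ← Equiv.sum_comp (Fin.appendEquiv m l)]
  refine Finset.sum_congr rfl fun x _ => ?_
  congr 1 <;> funext a <;> simp [Fin.appendEquiv]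

theorem trace_sumPerm {m l : ℕ} {q : F} (hq : q ≠ 0) (σ : Perm (Fin m) × Perm (Fin l))
    (X : Fin (m + l) → Matrix (Fin N) (Fin N) B) :
    trace (lift B (permMat N hq (sumPerm m l σ)) *
        (legProd ((List.finRange m).map (Fin.castAdd l)) X
          * legProd ((List.finRange l).map (Fin.natAdd m)) X))
      = trace (lift B (permMat N hq σ.1) * legProd (List.finRange m) fun a => X (Fin.castAdd l a))
        * trace (lift B (permMat N hq σ.2)
          * legProd (List.finRange l) fun a => X (Fin.natAdd m a)) := by
  rw [← legProd_append, ← finRange_add]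
  simp only [trace_permMat_mul, invWt_div_sumPerm hq]
  simp only [legProd_apply_of_forall_mem (List.nodup_finRange _) List.mem_finRange]
  simp only [finRange_add, List.map_append, List.map_map, List.prod_append, Function.comp_def, sumPerm_castAdd,
    sumPerm_natAdd]
  rw [Finset.sum_mul_sum, ← sum_fin_add]
  simp only [Function.comp_def, smul_mul_smul_comm]

/-- With the second block multiplied first, the traces factor in the opposite order. Comparing this
with `trace_sumPerm` is how an equality of traces becomes a commutation relation. -/
theorem trace_sumPerm_reverse {m l : ℕ} {q : F} (hq : q ≠ 0) (σ : Perm (Fin m) × Perm (Fin l))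
    (X : Fin (m + l) → Matrix (Fin N) (Fin N) B) :
    trace (lift B (permMat N hq (sumPerm m l σ)) *
        (legProd ((List.finRange l).map (Fin.natAdd m)) X
          * legProd ((List.finRange m).map (Fin.castAdd l)) X))
      = trace (lift B (permMat N hq σ.2) * legProd (List.finRange l) fun a => X (Fin.natAdd m a))
        * trace (lift B (permMat N hq σ.1)
          * legProd (List.finRange m) fun a => X (Fin.castAdd l a)) := by
  have hperm : ((List.finRange l).map (Fin.natAdd m)
      ++ (List.finRange m).map (Fin.castAdd l)).Perm (List.finRange (m + l)) := by
    rw [finRange_add]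
    exact List.perm_append_comm
  rw [← legProd_append]
  simp only [trace_permMat_mul, invWt_div_sumPerm hq]
  simp only [legProd_apply_of_forall_mem (List.nodup_finRange _) List.mem_finRange,
    legProd_apply_of_forall_mem (hperm.nodup_iff.2 (List.nodup_finRange _))
      fun c => hperm.mem_iff.2 (List.mem_finRange c),
    List.map_append, List.map_map, List.prod_append, Function.comp_def, sumPerm_castAdd,
    sumPerm_natAdd]
  rw [Finset.sum_mul_sum, Finset.sum_comm, ← sum_fin_add]
  refine Finset.sum_congr rfl fun I _ => ?_
  rw [smul_mul_smul_comm, mul_comm (invWt q _ / _)]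
  rfl

theorem permTrace_sumPerm {m l : ℕ} {q : F} (hq : q ≠ 0) (s : ℕ)
    (M : ℕ → Matrix (Fin N) (Fin N) B) (σ : Perm (Fin m) × Perm (Fin l)) :
    permTrace hq (m + l) s M (sumPerm m l σ)
      = permTrace hq m s M σ.1 * permTrace hq l (s + m) M σ.2 := by
  rw [permTrace, strMat, finRange_add, legProd_append, trace_sumPerm]
  simp only [permTrace, strMat, Fin.val_castAdd, Fin.val_natAdd, add_assoc]

theorem lift_permMat_swap_mul_self {q : F} (hq : q ≠ 0) (a b : Fin n) :
    lift B (permMat N hq (swap a b)) * lift B (permMat N hq (swap a b)) = 1 := by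
  rw [← map_mul, ← map_mul, Equiv.swap_mul_self, map_one, map_one]

section Manin

variable [CharZero F]

/-- Insert 2 = (1 + P) + (1 - P) between Z and Z'. -/
theorem symm_mul {E : Type*} [Ring E] [Algebra F E] {P Z Z' : E} (h : (1 - P) * Z * (1 + P) = 0)
    (h' : (1 - P) * Z' * (1 + P) = 0) : (1 - P) * (Z * Z') * (1 + P) = 0 := by
  have h2 : (2 : F) • ((1 - P) * (Z * Z') * (1 + P)) = 0 := by
    calc (2 : F) • ((1 - P) * (Z * Z') * (1 + P))
        = (1 - P) * Z * (1 + P) * (Z' * (1 + P)) + (1 - P) * Z * ((1 - P) * Z' * (1 + P)) := by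
          rw [two_smul]; noncomm_ring
      _ = 0 := by rw [h, h']; simp
  exact (smul_eq_zero.1 h2).resolve_left two_ne_zero

/-- The elements `Z` that preserve the symmetric tensors of an involution `P`. -/
def symmSubmonoid (F : Type) [Field F] [CharZero F] {E : Type*} [Ring E] [Algebra F E] (P : E)
    (hP : P * P = 1) : Submonoid E where
  carrier := {Z | (1 - P) * Z * (1 + P) = 0}
  one_mem' := by
    show (1 - P) * 1 * (1 + P) = 0
    rw [mul_one, sub_mul, mul_add, mul_add, hP]; simp [add_comm]
  mul_mem' h h' := symm_mul (F := F) h h'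

theorem mem_symmSubmonoid {E : Type*} [Ring E] [Algebra F E] {P : E} {hP : P * P = 1} {Z : E} :
    Z ∈ symmSubmonoid F P hP ↔ (1 - P) * Z * (1 + P) = 0 := Iff.rfl

theorem mem_symmSubmonoid_of_comm {E : Type*} [Ring E] [Algebra F E] {P : E} (hP : P * P = 1)
    {Z : E} (h : P * Z = Z * P) : Z ∈ symmSubmonoid F P hP := by
  have : (1 - P) * Z * (1 + P) = Z * ((1 - P) * 1 * (1 + P)) := by
    rw [sub_mul, one_mul, h]; noncomm_ring
  rw [mem_symmSubmonoid, this, (symmSubmonoid F P hP).one_mem', mul_zero]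

theorem mem_symmSubmonoid_of_exists {E : Type*} [Ring E] [Algebra F E] {P : E} (hP : P * P = 1)
    {Z Z' : E} (h : (1 - P) * Z = Z' * (1 - P)) : Z ∈ symmSubmonoid F P hP := by
  have := (symmSubmonoid F P hP).one_mem'
  rw [mem_symmSubmonoid, h, mul_assoc, ← mul_one (1 - P), this, mul_zero]

/-- The submonoid of operators that preserve the deformed symmetric tensors in two factors. -/
def swapSubmonoid (B : Type) [Ring B] [Algebra F B] (N : ℕ) {q : F} (hq : q ≠ 0) (a b : Fin n) :
    Submonoid (TensorMat N n B) :=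
  symmSubmonoid F _ (lift_permMat_swap_mul_self (B := B) (N := N) hq a b)

theorem leg_mem_swapSubmonoid {q : F} (hq : q ≠ 0) {a b c : Fin n} (hab : (b : ℕ) = a + 1)
    (hca : a ≠ c) (hcb : b ≠ c) (M : Matrix (Fin N) (Fin N) B) :
    leg c M ∈ swapSubmonoid B N hq a b := by
  refine mem_symmSubmonoid_of_comm _ ?_
  rw [permMat_swap hq hab, lift_twoLeg_comm_leg hca hcb]

/-- Two matrices whose product, in consecutive factors, preserves the deformed symmetric
tensors. -/
def ManinPair {q : F} (hq : q ≠ 0) (M M' : Matrix (Fin N) (Fin N) B) : Prop :=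
  ∀ (n : ℕ) (a b : Fin n), (b : ℕ) = a + 1 → leg a M * leg b M' ∈ swapSubmonoid B N hq a b

/-- Every leg other than a, b commutes with the flip of a and b, so only the adjacent factors X_a
X_b need the Manin property. -/
theorem legProd_mem_swapSubmonoid {q : F} (hq : q ≠ 0) {a b : Fin n} (hab : (b : ℕ) = a + 1)
    {l : List (Fin n)} (hl : l.Nodup) (hmem : a ∉ l ∧ b ∉ l ∨ ∃ l₁ l₂, l = l₁ ++ a :: b :: l₂)
    {X : Fin n → Matrix (Fin N) (Fin N) B} (hX : ManinPair hq (X a) (X b)) :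
    legProd l X ∈ swapSubmonoid B N hq a b := by
  have key : ∀ l : List (Fin n), a ∉ l → b ∉ l → legProd l X ∈ swapSubmonoid B N hq a b := by
    intro l ha hb
    refine Submonoid.list_prod_mem _ fun Z hZ => ?_
    obtain ⟨c, hc, rfl⟩ := List.mem_map.1 hZ
    exact leg_mem_swapSubmonoid hq hab (by rintro rfl; exact ha hc) (by rintro rfl; exact hb hc) _
  rcases hmem with h | ⟨l₁, l₂, rfl⟩
  · exact key l h.1 h.2
  · have h1 := List.nodup_append.1 hl
    have h2 := List.nodup_cons.1 h1.2.1
    have h3 := List.nodup_cons.1 h2.2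
    have e : legProd (l₁ ++ a :: b :: l₂) X
        = legProd l₁ X * (leg a (X a) * leg b (X b)) * legProd l₂ X := by
      simp [legProd, mul_assoc]
    rw [e]
    refine mul_mem (mul_mem (key l₁ ?_ ?_) (hX n a b hab)) (key l₂ ?_ h3.1)
    · exact fun h => h1.2.2 a h a (by simp) rfl
    · exact fun h => h1.2.2 b h b (by simp) rfl
    · exact fun h => h2.1 (by simp [h])

theorem exists_finRange_eq {a b : Fin n} (hab : (b : ℕ) = a + 1) :
    ∃ l₁ l₂, List.finRange n = l₁ ++ a :: b :: l₂ := by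
  refine ⟨(List.finRange n).take a, (List.finRange n).drop (a + 2), ?_⟩
  have hb := b.2
  conv_lhs => rw [← List.take_append_drop a (List.finRange n)]
  rw [List.drop_eq_getElem_cons (by simp), List.drop_eq_getElem_cons (by simp; omega)]
  simp [← hab]
  omega

theorem strMat_mem_swapSubmonoid {q : F} (hq : q ≠ 0) {a b : Fin n} (hab : (b : ℕ) = a + 1) (s : ℕ)
    {M : ℕ → Matrix (Fin N) (Fin N) B} (hM : ∀ x, ManinPair hq (M x) (M (x + 1))) :
    strMat n s M ∈ swapSubmonoid B N hq a b := by
  refine legProd_mem_swapSubmonoid hq hab (List.nodup_finRange _) (.inr (exists_finRange_eq hab)) ?_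
  rw [hab]
  exact hM _

end Manin

end Strings

/-! ### Symmetric groups of blocks, coset decompositions and cycles -/

section Generation

/-- A submonoid that contains the adjacent transpositions of a block of `m` points contains the
symmetric group of the block. -/
theorem mem_of_adjacent_mem {m : ℕ} {G : Type*} [Monoid G] (f : Perm (Fin m) →* G)
    (S : Submonoid G) (h : ∀ a b : Fin m, (b : ℕ) = a + 1 → f (swap a b) ∈ S) (σ : Perm (Fin m)) :
    f σ ∈ S := by
  cases m with
  | zero => rw [Subsingleton.elim σ 1, map_one]; exact S.one_mem
  | succ m =>
    have : (⊤ : Submonoid (Perm (Fin (m + 1)))) ≤ S.comap f := by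
      rw [← Perm.mclosure_swap_castSucc_succ, Submonoid.closure_le]
      rintro _ ⟨i, rfl⟩
      exact h _ _ (by simp)
    exact this (Submonoid.mem_top σ)

theorem sumPerm_one_swap {m l : ℕ} (a b : Fin l) :
    sumPerm m l (1, swap a b) = swap (Fin.natAdd m a) (Fin.natAdd m b) := by
  ext x
  refine Fin.addCases (fun x => ?_) (fun x => ?_) x
  · rw [sumPerm_castAdd, swap_apply_of_ne_of_ne] <;> simp [Fin.ext_iff] <;> omega
  · rw [sumPerm_natAdd]
    simp only [swap_apply_def, Fin.ext_iff, Fin.val_natAdd]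
    split_ifs <;> simp_all

theorem sumPerm_swap_one {m l : ℕ} (a b : Fin m) :
    sumPerm m l (swap a b, 1) = swap (Fin.castAdd l a) (Fin.castAdd l b) := by
  ext x
  refine Fin.addCases (fun x => ?_) (fun x => ?_) x
  · rw [sumPerm_castAdd]
    simp only [swap_apply_def, Fin.ext_iff, Fin.val_castAdd]
    split_ifs <;> simp_all
  · rw [sumPerm_natAdd, swap_apply_of_ne_of_ne] <;> simp [Fin.ext_iff] <;> omega

/-- The permutations that fix all points from the `m`-th on. -/
def fixGE (k m : ℕ) : Finset (Perm (Fin k)) :=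
  Finset.univ.filter fun σ => ∀ a : Fin k, m ≤ a → σ a = a

theorem mem_fixGE {k m : ℕ} {σ : Perm (Fin k)} : σ ∈ fixGE k m ↔ ∀ a : Fin k, m ≤ a → σ a = a := by
  simp [fixGE]

theorem mul_mem_fixGE {k m : ℕ} {σ τ : Perm (Fin k)} (h : σ ∈ fixGE k m) (h' : τ ∈ fixGE k m) :
    σ * τ ∈ fixGE k m := by
  rw [mem_fixGE] at *
  intro a ha
  rw [Perm.mul_apply, h' a ha, h a ha]

theorem inv_mem_fixGE {k m : ℕ} {σ : Perm (Fin k)} (h : σ ∈ fixGE k m) : σ⁻¹ ∈ fixGE k m := by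
  rw [mem_fixGE] at *
  intro a ha
  rw [Perm.inv_eq_iff_eq, h a ha]

theorem swap_mem_fixGE {k m : ℕ} {a b : Fin k} (ha : (a : ℕ) < m) (hb : (b : ℕ) < m) :
    swap a b ∈ fixGE k m := by
  rw [mem_fixGE]
  intro c hc
  exact swap_apply_of_ne_of_ne (by rintro rfl; omega) (by rintro rfl; omega)

theorem sumPerm_mem_fixGE {m l : ℕ} (σ : Perm (Fin m)) : sumPerm m l (σ, 1) ∈ fixGE (m + l) m := by
  rw [mem_fixGE]
  intro a
  refine Fin.addCases (fun x h => ?_) (fun x _ => ?_) a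
  · simp only [Fin.val_castAdd] at h; omega
  · simp

theorem exists_sumPerm_eq {m l : ℕ} {σ : Perm (Fin (m + l))} (h : σ ∈ fixGE (m + l) m) :
    ∃ τ : Perm (Fin m), sumPerm m l (τ, 1) = σ := by
  rw [mem_fixGE] at h
  have h1 : Set.MapsTo (finSumFinEquiv.symm.permCongr σ) (Set.range Sum.inl)
      (Set.range (Sum.inl : Fin m → Fin m ⊕ Fin l)) := by
    rw [Perm.perm_mapsTo_inl_iff_mapsTo_inr]
    rintro _ ⟨b, rfl⟩
    refine ⟨b, ?_⟩
    rw [Equiv.permCongr_apply, Equiv.symm_symm, finSumFinEquiv_apply_right, h _ (by simp)]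
    simp
  obtain ⟨⟨τ, τ'⟩, ht⟩ := Perm.mem_sumCongrHom_range_of_perm_mapsTo_inl h1
  have h2 : sumPerm m l (τ, τ') = σ := by
    rw [sumPerm, MonoidHom.comp_apply, ht]
    ext x
    simp [Equiv.permCongr_apply]
  have h3 : τ' = 1 := by
    ext b
    have := h (Fin.natAdd m b) (by simp)
    rw [← h2, sumPerm_natAdd] at this
    simpa [Fin.ext_iff] using this
  exact ⟨τ, h3 ▸ h2⟩

theorem sum_fixGE {m l : ℕ} {A : Type*} [AddCommMonoid A] (f : Perm (Fin (m + l)) → A) :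
    ∑ σ ∈ fixGE (m + l) m, f σ = ∑ σ : Perm (Fin m), f (sumPerm m l (σ, 1)) := by
  refine (Finset.sum_bij (fun σ _ => sumPerm m l (σ, 1)) (fun σ _ => sumPerm_mem_fixGE σ) ?_ ?_
    fun _ _ => rfl).symm
  · intro σ _ τ _ h
    ext a
    have := congrArg (fun p => (p (Fin.castAdd l a) : ℕ)) h
    simpa using this
  · intro σ hσ
    obtain ⟨τ, h⟩ := exists_sumPerm_eq hσ
    exact ⟨τ, Finset.mem_univ _, h⟩

theorem fixGE_zero (k : ℕ) : fixGE k 0 = {1} := by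
  ext σ
  rw [mem_fixGE, Finset.mem_singleton]
  exact ⟨fun h => Equiv.ext fun a => h a (Nat.zero_le _), fun h => by simp [h]⟩

theorem fixGE_self (k : ℕ) : fixGE k k = Finset.univ := by
  ext σ
  simp only [mem_fixGE, Finset.mem_univ, iff_true]
  intro a ha
  omega

/-- Coset decomposition of the symmetric group on m + 1 points over that on m points: σ is sorted by
the image a = σ(m), with coset representative the transposition of a and m. -/
theorem sum_fixGE_succ {k m : ℕ} (hm : m < k) {A : Type*} [AddCommMonoid A]
    (f : Perm (Fin k) → A) :
    ∑ σ ∈ fixGE k (m + 1), f σ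
      = ∑ a ∈ Finset.univ.filter (fun a : Fin k => (a : ℕ) ≤ m),
          ∑ σ ∈ fixGE k m, f (swap a ⟨m, hm⟩ * σ) := by
  rw [← Finset.sum_product']
  refine Finset.sum_bij' (fun σ _ => (σ ⟨m, hm⟩, swap (σ ⟨m, hm⟩) ⟨m, hm⟩ * σ))
    (fun p _ => swap p.1 ⟨m, hm⟩ * p.2) ?_ ?_ ?_ ?_ ?_
  · intro σ hσ
    have h1 : (σ ⟨m, hm⟩ : ℕ) ≤ m := by
      by_contra hc
      have := (mem_fixGE.1 hσ) (σ ⟨m, hm⟩) (by omega)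
      have := σ.injective this
      rw [this] at hc
      simp at hc
    rw [Finset.mem_product, Finset.mem_filter]
    refine ⟨⟨Finset.mem_univ _, h1⟩, mem_fixGE.2 fun a ha => ?_⟩
    rcases Nat.eq_or_lt_of_le ha with h | h
    · have : a = ⟨m, hm⟩ := Fin.ext h.symm
      subst this
      simp
    · have h2 := (mem_fixGE.1 hσ) a h
      rw [Perm.mul_apply, h2, swap_apply_of_ne_of_ne]
      · intro h3
        have := congrArg Fin.val h3
        omega
      · rintro rfl; simp at h
  · intro p hp
    rw [Finset.mem_product, Finset.mem_filter] at hp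
    refine mul_mem_fixGE (swap_mem_fixGE (Nat.lt_succ_of_le hp.1.2) (by simp)) ?_
    rw [mem_fixGE]
    exact fun a ha => mem_fixGE.1 hp.2 a (by omega)
  · intro σ _
    simp [← mul_assoc]
  · intro p hp
    rw [Finset.mem_product, Finset.mem_filter] at hp
    have h1 : p.2 ⟨m, hm⟩ = ⟨m, hm⟩ := mem_fixGE.1 hp.2 _ le_rfl
    refine Prod.ext ?_ ?_
    · simp [h1]
    · simp [h1, ← mul_assoc]
  · intro σ _
    simp [← mul_assoc]

/-- The transposition of `a` and `a + 1`. -/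
def adjSwap (k a : ℕ) : Perm (Fin k) :=
  if h : a + 1 < k then swap ⟨a, by omega⟩ ⟨a + 1, h⟩ else 1

/-- The product `s_{m+r-1} ⋯ s_{m+1} s_m` of adjacent transpositions. -/
def cyc (k : ℕ) : ℕ → ℕ → Perm (Fin k)
  | _, 0 => 1
  | m, r + 1 => cyc k (m + 1) r * adjSwap k m

theorem adjSwap_add (m l j : ℕ) : adjSwap (m + l) (m + j) = sumPerm m l (1, adjSwap l j) := by
  unfold adjSwap
  by_cases h : j + 1 < l
  · rw [dif_pos (by omega), dif_pos h, sumPerm_one_swap]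
    rfl
  · rw [dif_neg (by omega), dif_neg h]
    exact (map_one (sumPerm m l)).symm

theorem cyc_add (m l j r : ℕ) : cyc (m + l) (m + j) r = sumPerm m l (1, cyc l j r) := by
  induction r generalizing j with
  | zero => exact (map_one (sumPerm m l)).symm
  | succ r ih =>
    rw [cyc, cyc, add_assoc, ih, adjSwap_add, ← map_mul]
    rfl

end Generation

/-! ### Antisymmetrizers and noncommutative Newton identities -/

section Newton

variable {N n : ℕ} {F : Type} [Field F] {B : Type} [Ring B] [Algebra F B] {q : F} (hq : q ≠ 0)

/-- The sign of a permutation as a scalar. -/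
def sgnF (F : Type) [Field F] {n : ℕ} : Perm (Fin n) →* F :=
  (Int.castRingHom F).toMonoidHom.comp ((Units.coeHom ℤ).comp Perm.sign)

theorem sgnF_apply (σ : Perm (Fin n)) : sgnF F σ = ((Perm.sign σ : ℤ) : F) := rfl

theorem sgnF_mul_self (σ : Perm (Fin n)) : sgnF F σ * sgnF F σ = 1 := by
  rw [sgnF_apply, ← Int.cast_mul, ← Units.val_mul, Int.units_mul_self]
  simp

theorem sgnF_swap {a b : Fin n} (h : a ≠ b) : sgnF F (swap a b) = -1 := by
  rw [sgnF_apply, Perm.sign_swap h]; simp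

/-- The (unnormalized) deformed antisymmetrizer in the first `m` factors. -/
def antisym (N : ℕ) (n m : ℕ) : TensorMat N n F :=
  ∑ σ ∈ fixGE n m, sgnF F σ • permMat N hq σ

theorem permMat_mul_antisym {m : ℕ} {g : Perm (Fin n)} (hg : g ∈ fixGE n m) :
    permMat N hq g * antisym hq N n m = sgnF F g • antisym hq N n m := by
  rw [antisym, Finset.mul_sum, Finset.smul_sum]
  refine Finset.sum_bij' (fun σ _ => g * σ) (fun σ _ => g⁻¹ * σ)
    (fun σ hσ => mul_mem_fixGE hg hσ) (fun σ hσ => mul_mem_fixGE (inv_mem_fixGE hg) hσ)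
    (by simp) (by simp) ?_
  intro σ _
  rw [map_mul, map_mul, smul_smul, ← mul_assoc, sgnF_mul_self, one_mul, mul_smul_comm]

theorem antisym_mul_permMat {m : ℕ} {g : Perm (Fin n)} (hg : g ∈ fixGE n m) :
    antisym hq N n m * permMat N hq g = sgnF F g • antisym hq N n m := by
  rw [antisym, Finset.sum_mul, Finset.smul_sum]
  refine Finset.sum_bij' (fun σ _ => σ * g) (fun σ _ => σ * g⁻¹)
    (fun σ hσ => mul_mem_fixGE hσ hg) (fun σ hσ => mul_mem_fixGE hσ (inv_mem_fixGE hg))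
    (by simp) (by simp) ?_
  intro σ _
  rw [map_mul, map_mul, smul_smul, mul_comm (sgnF F σ), ← mul_assoc, sgnF_mul_self, one_mul,
    smul_mul_assoc]

theorem antisym_zero : antisym hq N n 0 = 1 := by
  simp [antisym, fixGE_zero]

theorem antisym_succ {m : ℕ} (hm : m < n) :
    antisym hq N n (m + 1) = antisym hq N n m
      - ∑ a ∈ Finset.univ.filter (fun a : Fin n => (a : ℕ) < m),
          permMat N hq (swap a ⟨m, hm⟩) * antisym hq N n m := by
  have h : Finset.univ.filter (fun a : Fin n => (a : ℕ) ≤ m)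
      = insert ⟨m, hm⟩ (Finset.univ.filter (fun a : Fin n => (a : ℕ) < m)) := by
    ext a
    simp only [Finset.mem_filter, Finset.mem_univ, true_and, Finset.mem_insert, Fin.ext_iff]
    omega
  rw [antisym, sum_fixGE_succ hm, h, Finset.sum_insert (by simp), sub_eq_add_neg,
    ← Finset.sum_neg_distrib]
  congr 1
  · rw [Equiv.swap_self]
    rfl
  · refine Finset.sum_congr rfl fun a ha => ?_
    have ha' : a ≠ ⟨m, hm⟩ := by rintro rfl; simp at ha
    rw [antisym, Finset.mul_sum, ← Finset.sum_neg_distrib]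
    refine Finset.sum_congr rfl fun σ _ => ?_
    rw [map_mul, map_mul, sgnF_swap ha', mul_smul_comm]
    simp

section

variable [CharZero F]

set_option linter.unusedSectionVars false

/-- If `A` is antisymmetric and `Z` preserves symmetric tensors, then `A Z` is antisymmetric. -/
theorem mul_swapSubmonoid {A Z : TensorMat N n B} {a b : Fin n}
    (hA : A * lift B (permMat N hq (swap a b)) = -A) (hZ : Z ∈ swapSubmonoid B N hq a b) :
    A * Z * lift B (permMat N hq (swap a b)) = -(A * Z) := by
  have h := congrArg (A * ·) (mem_symmSubmonoid.1 hZ)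
  simp only [mul_zero] at h
  rw [← mul_assoc, ← mul_assoc, mul_sub, mul_one, hA, sub_neg_eq_add, ← two_smul F A,
    smul_mul_assoc, smul_mul_assoc] at h
  have h2 := (smul_eq_zero.1 h).resolve_left two_ne_zero
  rw [mul_add, mul_one] at h2
  exact (neg_eq_of_add_eq_zero_right h2).symm

/-- The permutations that act by their sign on `A`, from the right. -/
def signSubmonoid (A : TensorMat N n B) : Submonoid (Perm (Fin n)) where
  carrier := {g | A * lift B (permMat N hq g) = sgnF F g • A}
  one_mem' := by simp
  mul_mem' {g g'} h h' := by
    change _ = _ at h h' ⊢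
    rw [map_mul, map_mul, ← mul_assoc, h, smul_mul_assoc, h', smul_smul, map_mul]

theorem mem_signSubmonoid {A : TensorMat N n B} {g : Perm (Fin n)} :
    g ∈ signSubmonoid hq A ↔ A * lift B (permMat N hq g) = sgnF F g • A := Iff.rfl

theorem swap_mem_signSubmonoid {A : TensorMat N n B} {a b : Fin n} (hab : (b : ℕ) = a + 1) :
    swap a b ∈ signSubmonoid hq A ↔ A * lift B (permMat N hq (swap a b)) = -A := by
  rw [mem_signSubmonoid, sgnF_swap (by rintro rfl; omega), neg_one_smul]

theorem lift_smul {ι : Type*} [Fintype ι] [DecidableEq ι] (c : F) (S : Matrix ι ι F) :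
    lift B (c • S) = c • lift B S := by
  ext i j
  rw [Matrix.smul_apply, RingHom.mapMatrix_apply, RingHom.mapMatrix_apply, Matrix.map_apply,
    Matrix.map_apply, Matrix.smul_apply, smul_eq_mul, map_mul, Algebra.smul_def]

/-- An operator preserving the symmetric tensors of P keeps right antisymmetry under P. Doing this
for all adjacent transpositions of the first m points covers the group they generate. -/
theorem antisym_mul_mem {m : ℕ} {Z : TensorMat N n B}
    (hZ : ∀ a b : Fin n, (b : ℕ) = a + 1 → (b : ℕ) < m → Z ∈ swapSubmonoid B N hq a b)
    {g : Perm (Fin n)} (hg : g ∈ fixGE n m) :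
    g ∈ signSubmonoid hq (lift B (antisym hq N n m) * Z) := by
  -- If m exceeds the number of factors, `fixGE n m` is the whole symmetric group and no
  -- complementary block exists.
  rcases Nat.lt_or_ge n m with h | h
  · have h0 : fixGE n m = fixGE n n := by
      ext σ
      simp only [mem_fixGE]
      exact ⟨fun _ a ha => by omega, fun _ a ha => by omega⟩
    have := mem_of_adjacent_mem (MonoidHom.id _)
      (signSubmonoid hq (lift B (antisym hq N n m) * Z)) (fun a b hab => ?_) g
    · exact this
    · rw [MonoidHom.id_apply, swap_mem_signSubmonoid hq hab]
      refine mul_swapSubmonoid hq ?_ (hZ a b hab (by omega))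
      rw [← map_mul, antisym_mul_permMat hq (swap_mem_fixGE (by omega) (by omega)), lift_smul,
        sgnF_swap (by rintro rfl; omega), neg_one_smul]
  · obtain ⟨l, rfl⟩ := Nat.exists_eq_add_of_le h
    obtain ⟨σ, rfl⟩ := exists_sumPerm_eq hg
    refine mem_of_adjacent_mem ((sumPerm m l).comp (MonoidHom.inl _ _)) _ (fun a b hab => ?_) σ
    simp only [MonoidHom.comp_apply, MonoidHom.inl_apply, sumPerm_swap_one]
    have hab' : (Fin.castAdd l b : ℕ) = Fin.castAdd l a + 1 := by simpa using hab
    rw [swap_mem_signSubmonoid hq hab']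
    refine mul_swapSubmonoid hq ?_ (hZ _ _ hab' (by simp))
    rw [← map_mul, antisym_mul_permMat hq (swap_mem_fixGE (by simp) (by simp)), lift_smul,
      sgnF_swap (by rw [Ne, Fin.ext_iff]; omega), neg_one_smul]

/-- The trace of a string against a permutation times an antisymmetrizer. -/
def hookTrace (n s : ℕ) (M : ℕ → Matrix (Fin N) (Fin N) B) (c : Perm (Fin n)) (m : ℕ) : B :=
  trace (lift B (permMat N hq c * antisym hq N n m) * strMat n s M)

/-- The trace of a string against the full antisymmetrizer. -/
def altTrace (n s : ℕ) (M : ℕ → Matrix (Fin N) (Fin N) B) : B :=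
  ∑ σ : Perm (Fin n), sgnF F σ • permTrace hq n s M σ

/-- The trace of a string against a full cycle. -/
def cycTrace (n s : ℕ) (M : ℕ → Matrix (Fin N) (Fin N) B) : B :=
  permTrace hq n s M (cyc n 0 (n - 1))

theorem hookTrace_eq_sum (s : ℕ) (M : ℕ → Matrix (Fin N) (Fin N) B) (c : Perm (Fin n)) (m : ℕ) :
    hookTrace hq n s M c m = ∑ σ ∈ fixGE n m, sgnF F σ • permTrace hq n s M (c * σ) := by
  simp only [hookTrace, antisym, Finset.mul_sum, map_sum, mul_smul_comm, ← map_mul, lift_smul,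
    Finset.sum_mul, smul_mul_assoc, trace_sum, trace_smul]
  rfl

theorem hookTrace_zero (s : ℕ) (M : ℕ → Matrix (Fin N) (Fin N) B) (c : Perm (Fin n)) :
    hookTrace hq n s M c 0 = permTrace hq n s M c := by
  rw [hookTrace, antisym_zero, mul_one, permTrace]

theorem hookTrace_one_self (s : ℕ) (M : ℕ → Matrix (Fin N) (Fin N) B) :
    hookTrace hq n s M 1 n = altTrace hq n s M := by
  rw [hookTrace_eq_sum, fixGE_self]
  simp [altTrace]

theorem hookTrace_cyc (m l s r : ℕ) (M : ℕ → Matrix (Fin N) (Fin N) B) :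
    hookTrace hq (m + l) s M (cyc (m + l) m r) m
      = altTrace hq m s M * permTrace hq l (s + m) M (cyc l 0 r) := by
  rw [hookTrace_eq_sum, sum_fixGE, altTrace, Finset.sum_mul]
  refine Finset.sum_congr rfl fun σ _ => ?_
  have h1 := cyc_add m l 0 r
  rw [add_zero] at h1
  rw [h1, ← map_mul, permTrace_sumPerm, sgnF_apply, sign_sumPerm, sgnF_apply]
  simp

variable {M : ℕ → Matrix (Fin N) (Fin N) B}

/-- Expand the antisymmetrizer on m + 2 points over cosets. All transpositions of a point a ≤ m with
the new point m + 1 contribute equally: each is the conjugate of (m, m+1) by g = (a m). The right g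
is absorbed by the antisymmetrizer. The left g passes through c and around the trace, and is then
absorbed by antisymmetrizer times string, which is still antisymmetric by the Manin property. The
two signs cancel. -/
theorem hookTrace_succ (hM : ∀ x, ManinPair hq (M x) (M (x + 1))) (s : ℕ) {m : ℕ}
    (hm : m + 1 < n) {c : Perm (Fin n)} (hc : ∀ g ∈ fixGE n (m + 1), c * g = g * c) :
    hookTrace hq n s M c (m + 2) = hookTrace hq n s M c (m + 1)
      - (m + 1) • hookTrace hq n s M (c * adjSwap n m) (m + 1) := by
  have key : ∀ a : Fin n, (a : ℕ) < m + 1 →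
      trace (lift B (permMat N hq c * (permMat N hq (swap a ⟨m + 1, hm⟩) * antisym hq N n (m + 1)))
        * strMat n s M) = hookTrace hq n s M (c * adjSwap n m) (m + 1) := by
    intro a ha
    set b : Fin n := ⟨m, by omega⟩ with hb
    set d : Fin n := ⟨m + 1, hm⟩ with hd
    have hbd : adjSwap n m = swap b d := by rw [adjSwap, dif_pos hm]
    set g := swap a b with hg
    have hgm : g ∈ fixGE n (m + 1) := swap_mem_fixGE ha (by simp [hb])
    have h1 : swap a d = g * swap b d * g := by
      have h2 : d ≠ a := by rintro h; rw [← h] at ha; simp [hd] at ha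
      have h3 : d ≠ b := by rw [hd, hb, Ne, Fin.ext_iff]; simp
      rw [mul_swap_eq_swap_mul g b d, hg, swap_apply_right, swap_apply_of_ne_of_ne h2 h3, mul_assoc,
        Equiv.swap_mul_self, mul_one]
    have h2 : permMat N hq c * (permMat N hq (swap a d) * antisym hq N n (m + 1))
        = permMat N hq g * (sgnF F g • (permMat N hq (c * swap b d) * antisym hq N n (m + 1))) := by
      rw [h1, map_mul, mul_assoc (permMat N hq (g * _)), permMat_mul_antisym hq hgm,
        mul_smul_comm, mul_smul_comm, mul_smul_comm, ← mul_assoc, ← mul_assoc, ← map_mul,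
        ← map_mul, ← mul_assoc, hc g hgm, mul_assoc]
    rw [h2, map_mul, mul_assoc, trace_lift_mul_comm, hookTrace, hbd, lift_smul, smul_mul_assoc,
      smul_mul_assoc, trace_smul, map_mul, mul_assoc, mul_assoc, ← mul_assoc (lift B (antisym _ _ _ _))]
    rw [(mem_signSubmonoid hq).1 (antisym_mul_mem hq
      (fun a b hab _ => strMat_mem_swapSubmonoid hq hab s hM) hgm), mul_smul_comm, trace_smul,
      smul_smul, sgnF_mul_self, one_smul, mul_assoc]
  have hcard : (Finset.univ.filter (fun a : Fin n => (a : ℕ) < m + 1)).card = m + 1 := by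
    rw [Fin.card_filter_val_lt]
    omega
  rw [hookTrace, antisym_succ hq hm, mul_sub, Finset.mul_sum, map_sub, map_sum, sub_mul,
    Finset.sum_mul, trace_sub, trace_sum, hookTrace]
  congr 1
  rw [Finset.sum_congr rfl fun a ha => key a (by simpa using ha), Finset.sum_const, hcard]

theorem hookTrace_one (s : ℕ) (hn : 0 < n) (c : Perm (Fin n)) :
    hookTrace hq n s M c 1 = hookTrace hq n s M c 0 := by
  rw [hookTrace, antisym_succ hq hn]
  simp [hookTrace]

/-- An element that commutes with all alternating traces commutes with all cycle traces. -/
theorem commute_cycTrace (hM : ∀ x, ManinPair hq (M x) (M (x + 1))) {Z : B}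
    (hZ : ∀ n s, Commute Z (altTrace hq n s M)) (n s : ℕ) (hn : 1 ≤ n) :
    Commute Z (cycTrace hq n s M) := by
  induction n using Nat.strong_induction_on generalizing s with
  | _ k ih =>
    -- Start from the full antisymmetrizer (r = 0) and trade antisymmetrized points for points of
    -- the cycle. In the recursion one term is known from the previous r and another is an
    -- alternating trace times a shorter cycle trace, so the third commutes with Z after division by
    -- m + 1. At m = 0 only the full cycle is left.
    have key : ∀ r m, m + 1 + r = k → Commute Z (hookTrace hq k s M (cyc k m r) (m + 1)) := by
      intro r
      induction r with
      | zero =>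
        rintro m rfl
        rw [cyc, add_zero, hookTrace_one_self]
        exact hZ _ _
      | succ r ihr =>
        intro m hk
        have h1 := ihr (m + 1) (by omega)
        have h2 : Commute Z (hookTrace hq k s M (cyc k (m + 1) r) (m + 1)) := by
          obtain rfl : k = (m + 1) + (r + 1) := by omega
          rw [hookTrace_cyc]
          refine (hZ _ _).mul_right ?_
          exact ih (r + 1) (by omega) (s + (m + 1)) (by omega)
        have hc : ∀ g ∈ fixGE k (m + 1), cyc k (m + 1) r * g = g * cyc k (m + 1) r := by
          obtain rfl : k = (m + 1) + (r + 1) := by omega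
          intro g hg
          obtain ⟨σ, rfl⟩ := exists_sumPerm_eq hg
          have h := cyc_add (m + 1) (r + 1) 0 r
          rw [add_zero] at h
          rw [h, ← map_mul, ← map_mul]
          simp
        have h3 := hookTrace_succ hq hM s (by omega : m + 1 < k) hc
        rw [cyc]
        set y := hookTrace hq k s M (cyc k (m + 1) r * adjSwap k m) (m + 1)
        have h4 : Commute Z ((m + 1) • y) := by
          rw [show (m + 1) • y = hookTrace hq k s M (cyc k (m + 1) r) (m + 1)
            - hookTrace hq k s M (cyc k (m + 1) r) (m + 2) by rw [h3]; abel]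
          exact h2.sub_right h1
        have h5 : y = ((m + 1 : ℕ) : F)⁻¹ • ((m + 1) • y) := by
          rw [← Nat.cast_smul_eq_nsmul F, smul_smul, inv_mul_cancel₀ (Nat.cast_ne_zero.2 m.succ_ne_zero), one_smul]
        rw [h5]
        exact h4.smul_right _
    have := key (k - 1) 0 (by omega)
    rwa [zero_add, hookTrace_one hq s (by omega), hookTrace_zero] at this

end

end Newton

/-! ### Moving intertwiners through ordered products -/

section Lists

variable {E ι : Type*}

theorem commute_list_prod [Monoid E] {l : List ι} {f : ι → E} {z : E}
    (h : ∀ a ∈ l, Commute z (f a)) : Commute z (l.map f).prod := by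
  refine Commute.list_prod_right _ _ fun x hx => ?_
  obtain ⟨a, ha, rfl⟩ := List.mem_map.1 hx
  exact h a ha

/-- The train argument: y is carried past the x_a one at a time, each crossing costing r_a, while an
r_a commutes with every x_b for b ≠ a. -/
theorem list_prod_intertwine [Monoid E] {l : List ι} (hl : l.Nodup) {r x : ι → E} {y : E}
    (h : ∀ a, r a * (x a * y) = y * x a * r a) (hc : ∀ a b, a ≠ b → Commute (r a) (x b)) :
    (l.map r).prod * ((l.map x).prod * y) = y * (l.map x).prod * (l.map r).prod := by
  induction l with
  | nil => simp
  | cons a l ih =>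
    rw [List.nodup_cons] at hl
    have ih := ih hl.2
    have h1 : Commute (x a) (l.map r).prod := commute_list_prod fun b hb =>
      (hc b a (by rintro rfl; exact hl.1 hb)).symm
    have h2 : Commute (r a) (l.map x).prod := commute_list_prod fun b hb =>
      hc a b (by rintro rfl; exact hl.1 hb)
    simp only [List.map_cons, List.prod_cons]
    calc _ = r a * ((l.map r).prod * x a) * ((l.map x).prod * y) := by simp only [mul_assoc]
      _ = r a * x a * ((l.map r).prod * ((l.map x).prod * y)) := by
          rw [← h1.eq]; simp only [mul_assoc]
      _ = r a * (x a * y) * (l.map x).prod * (l.map r).prod := by rw [ih]; simp only [mul_assoc]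
      _ = y * x a * (r a * (l.map x).prod) * (l.map r).prod := by rw [h]; simp only [mul_assoc]
      _ = _ := by rw [h2.eq]; simp only [mul_assoc]

theorem list_prod_reverse_intertwine [Monoid E] {l : List ι} (hl : l.Nodup) {r y : ι → E} {x : E}
    (h : ∀ b, r b * (x * y b) = y b * x * r b) (hc : ∀ a b, a ≠ b → Commute (r a) (y b)) :
    (l.reverse.map r).prod * (x * (l.map y).prod)
      = (l.map y).prod * x * (l.reverse.map r).prod := by
  induction l with
  | nil => simp
  | cons b l ih =>
    rw [List.nodup_cons] at hl
    have ih := ih hl.2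
    have h1 : Commute (y b) (l.reverse.map r).prod := commute_list_prod fun a ha =>
      (hc a b (by rintro rfl; exact hl.1 (List.mem_reverse.1 ha))).symm
    have h2 : Commute (r b) (l.map y).prod := commute_list_prod fun a ha =>
      hc b a (by rintro rfl; exact hl.1 ha)
    simp only [List.reverse_cons, List.map_append, List.map_cons, List.map_nil, List.prod_append,
      List.prod_cons, List.prod_nil, mul_one]
    calc _ = (l.reverse.map r).prod * (r b * (x * y b)) * (l.map y).prod := by
          simp only [mul_assoc]
      _ = ((l.reverse.map r).prod * y b) * x * (r b * (l.map y).prod) := by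
          rw [h]; simp only [mul_assoc]
      _ = y b * ((l.reverse.map r).prod * (x * (l.map y).prod)) * r b := by
          rw [← h1.eq, h2.eq]; simp only [mul_assoc]
      _ = _ := by rw [ih]; simp only [mul_assoc]

theorem list_prod_mul_list_prod [Monoid E] {l : List ι} (hl : l.Nodup) {f g : ι → E}
    (hc : ∀ a b, a ≠ b → Commute (f a) (g b)) :
    (l.map f).prod * (l.map g).prod = (l.map fun a => f a * g a).prod := by
  induction l with
  | nil => simp
  | cons a l ih =>
    rw [List.nodup_cons] at hl
    have h1 : Commute (g a) (l.map f).prod := commute_list_prod fun b hb =>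
      (hc b a (by rintro rfl; exact hl.1 hb)).symm
    simp only [List.map_cons, List.prod_cons, ← ih hl.2]
    calc _ = f a * ((l.map f).prod * g a) * (l.map g).prod := by simp only [mul_assoc]
      _ = _ := by rw [← h1.eq]; simp only [mul_assoc]

theorem list_prod_mem_of_pair [Monoid E] (S : Submonoid E) {l₁ l₂ : List ι} {a b : ι}
    (hl : (l₁ ++ a :: b :: l₂).Nodup) {f : ι → E} (hab : f a * f b ∈ S)
    (hf : ∀ c, c ≠ a → c ≠ b → f c ∈ S) : ((l₁ ++ a :: b :: l₂).map f).prod ∈ S := by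
  have h1 := List.nodup_append.1 hl
  have h2 := List.nodup_cons.1 h1.2.1
  have h3 := List.nodup_cons.1 h2.2
  have key : ∀ l : List ι, a ∉ l → b ∉ l → (l.map f).prod ∈ S := by
    intro l ha hb
    refine Submonoid.list_prod_mem _ fun z hz => ?_
    obtain ⟨c, hc, rfl⟩ := List.mem_map.1 hz
    exact hf c (by rintro rfl; exact ha hc) (by rintro rfl; exact hb hc)
  have e : ((l₁ ++ a :: b :: l₂).map f).prod = (l₁.map f).prod * (f a * f b) * (l₂.map f).prod := by
    simp [mul_assoc]
  rw [e]
  refine mul_mem (mul_mem (key l₁ ?_ ?_) hab) (key l₂ ?_ h3.1)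
  · exact fun h => h1.2.2 a h a (by simp) rfl
  · exact fun h => h1.2.2 b h b (by simp) rfl
  · exact fun h => h2.1 (by simp [h])

end Lists

/-! ### Idempotents compatible with an intertwiner -/

section Corner

variable {F : Type} [Field F] {B : Type} [Ring B] [Algebra F B] {ι : Type*} [Fintype ι]
  [DecidableEq ι]

/-- The hypothesis says that R maps the kernel of Q into itself. By finite dimension and injectivity
R maps it onto itself, so R⁻¹ preserves it too. -/
theorem corner_inv {Q R : Matrix ι ι F} (hQ : Q * Q = Q) (hR : IsUnit R)
    (h : Q * R * Q = Q * R) : Q * R⁻¹ * Q = Q * R⁻¹ := by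
  have hR' : R * R⁻¹ = 1 := Matrix.mul_nonsing_inv R ((Matrix.isUnit_iff_isUnit_det R).1 hR)
  have h1 : Q * R * (Q * R⁻¹ * Q) = Q := by
    rw [← mul_assoc, ← mul_assoc, h, mul_assoc Q, hR', mul_one, hQ]
  -- Finite dimension enters here: this right inverse is also a left inverse.
  have h2 : (Q * R * Q + (1 - Q)) * (Q * R⁻¹ * Q + (1 - Q)) = 1 := by
    have e1 : Q * R * Q * (1 - Q) = 0 := by rw [mul_sub, mul_one, mul_assoc (Q * R) Q Q, hQ, sub_self]
    have e2 : (1 - Q) * (Q * R⁻¹ * Q) = 0 := by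
      rw [← mul_assoc, ← mul_assoc, sub_mul, one_mul, hQ, sub_self, zero_mul, zero_mul]
    have e3 : (1 - Q) * (1 - Q) = 1 - Q := by rw [mul_sub, sub_mul, sub_mul, hQ]; simp
    rw [add_mul, mul_add, mul_add, e1, e2, e3, h, h1]
    simp
  have h3 := mul_eq_one_comm.1 h2
  have h4 := congrArg (Q * · * (R⁻¹)) h3
  simp only [mul_one] at h4
  have e4 : Q * ((Q * R⁻¹ * Q + (1 - Q)) * (Q * R * Q + (1 - Q))) = Q * R⁻¹ * (Q * R) := by
    have e5 : Q * (Q * R⁻¹ * Q + (1 - Q)) = Q * R⁻¹ * Q := by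
      rw [mul_add, ← mul_assoc, ← mul_assoc, hQ, mul_sub, hQ, mul_one, sub_self, add_zero]
    have e6 : Q * (Q * R * Q + (1 - Q)) = Q * R := by
      rw [mul_add, ← mul_assoc, ← mul_assoc, hQ, mul_sub, hQ, mul_one, sub_self, add_zero, h]
    rw [← mul_assoc, e5, mul_assoc (Q * R⁻¹), e6]
  rw [e4, mul_assoc, mul_assoc Q R, hR', mul_one] at h4
  exact h4

/-- Write T = R⁻¹ T' R. The idempotent can be inserted on both sides of T', and then R and R⁻¹ meet
around the trace and cancel. Only scalar matrices are moved cyclically. -/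
theorem trace_eq_of_intertwine {Q R : Matrix ι ι F} (hQ : Q * Q = Q) (hR : IsUnit R)
    (h : Q * R * Q = Q * R) {T T' : Matrix ι ι B} (hT : lift B R * T = T' * lift B R)
    (hT' : lift B Q * T' * lift B Q = lift B Q * T') :
    trace (lift B Q * T) = trace (lift B Q * T') := by
  have hd := (Matrix.isUnit_iff_isUnit_det R).1 hR
  have hR1 : R⁻¹ * R = 1 := Matrix.nonsing_inv_mul R hd
  have hR2 : R * R⁻¹ = 1 := Matrix.mul_nonsing_inv R hd
  have e1 : T = lift B (R⁻¹) * (T' * lift B R) := by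
    rw [← hT, ← mul_assoc, ← map_mul, hR1, map_one, one_mul]
  have e2 : lift B Q * T = lift B (Q * R⁻¹) * (lift B Q * T' * lift B Q * lift B R) := by
    rw [hT', e1, ← mul_assoc, ← map_mul]
    conv_lhs => rw [← corner_inv hQ hR h, map_mul]
    simp only [mul_assoc]
  have e3 : lift B Q * lift B R * lift B (Q * R⁻¹) = lift B Q := by
    rw [← map_mul, ← map_mul, ← mul_assoc, h, mul_assoc, hR2, mul_one]
  rw [e2, trace_lift_mul_comm, mul_assoc, mul_assoc (lift B Q * T'),
    ← mul_assoc (lift B Q) (lift B R), e3, hT']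

end Corner

/-! ### Fusion: commuting traces along strings of ratio q⁻² -/

section Fusion

variable {N n : ℕ} {F : Type} [Field F] [CharZero F] {B : Type} [Ring B] [Algebra F B]
  {q : F} (hq : q ≠ 0)

set_option linter.unusedSectionVars false

/-- The degeneration point of the R-matrix, and the source of the Manin property: at ratio q⁻² the
exchange relation has the form (1 - P) Z = Z' (1 - P), so Z preserves symmetric tensors. -/
theorem rLeg_special (x : F) {a b : Fin n} (hab : (b : ℕ) = a + 1) :
    (rLeg q q⁻¹ x (x * (q ^ 2)⁻¹) a b : TensorMat N n F)
      = (x * ((q ^ 2)⁻¹ - 1)) • (1 - permMat N hq (swap a b)) := by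
  rw [permMat_swap hq hab]
  refine ext_mulVec fun f I => ?_
  simp only [smul_mulVec, sub_mulVec, one_mulVec, Pi.smul_apply, Pi.sub_apply, rLeg, twoLeg_mulVec,
    smul_eq_mul, zero_mul, zero_add]
  rcases lt_trichotomy (I a) (I b) with h | h | h
  · simp only [rDiag, rFlip, flipWt, h, h.ne, if_true, if_false]
    field_simp
    ring
  · have : I ∘ swap a b = I := by
      funext c
      by_cases hca : c = a
      · subst hca; simp [h]
      by_cases hcb : c = b
      · subst hcb; simp [h]
      simp [swap_apply_of_ne_of_ne hca hcb]
    simp only [rDiag, rFlip, flipWt, h, lt_irrefl, if_true, if_false, this]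
    field_simp
    ring
  · simp only [rDiag, rFlip, flipWt, h, h.ne', h.not_gt, if_true, if_false]
    field_simp
    ring

theorem mem_swapSubmonoid_of_rLeg (hq2 : q ^ 2 ≠ 1) {x : F} (hx : x ≠ 0) {a b : Fin n}
    (hab : (b : ℕ) = a + 1) {Z Z' : TensorMat N n B}
    (h : lift B (rLeg q q⁻¹ x (x * (q ^ 2)⁻¹) a b) * Z
      = Z' * lift B (rLeg q q⁻¹ x (x * (q ^ 2)⁻¹) a b)) :
    Z ∈ swapSubmonoid B N hq a b := by
  have hc : x * ((q ^ 2)⁻¹ - 1) ≠ 0 :=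
    mul_ne_zero hx (sub_ne_zero.2 fun h => hq2 (inv_eq_one.1 h))
  rw [rLeg_special hq x hab, lift_smul, smul_mul_assoc, mul_smul_comm, map_sub, map_one] at h
  exact mem_symmSubmonoid_of_exists _ (smul_right_injective _ hc h)

/-- A family of matrices satisfying the quadratic exchange relations. -/
def RLL (q : F) (L : F → Matrix (Fin N) (Fin N) B) : Prop :=
  ∀ x y, Exchange (rDiag q q⁻¹ x y) (rFlip q q⁻¹ x y) (L x) (L y)

theorem RLL.maninPair (hq2 : q ^ 2 ≠ 1) {L : F → Matrix (Fin N) (Fin N) B} (hL : RLL q L) {x : F}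
    (hx : x ≠ 0) : ManinPair hq (L x) (L (x * (q ^ 2)⁻¹)) := by
  intro n a b hab
  exact mem_swapSubmonoid_of_rLeg hq hq2 hx hab
    ((hL x (x * (q ^ 2)⁻¹)).leg (by rintro rfl; omega))

theorem lift_self {ι : Type*} [Fintype ι] [DecidableEq ι] (S : Matrix ι ι F) : lift F S = S := by
  ext; rfl

/-- The antisymmetrizer in the first `k` and in the last `l` factors. -/
def blockAntisym (N k l : ℕ) : TensorMat N (k + l) F :=
  ∑ g : Perm (Fin k) × Perm (Fin l), sgnF F (sumPerm k l g) • permMat N hq (sumPerm k l g)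

theorem blockAntisym_mul_permMat {k l : ℕ} (g : Perm (Fin k) × Perm (Fin l)) :
    blockAntisym hq N k l * permMat N hq (sumPerm k l g)
      = sgnF F (sumPerm k l g) • blockAntisym hq N k l := by
  rw [blockAntisym, Finset.sum_mul, Finset.smul_sum]
  refine Fintype.sum_equiv (Equiv.mulRight g) _ _ fun σ => ?_
  rw [Equiv.coe_mulRight, map_mul, map_mul, map_mul, smul_smul, mul_comm (sgnF F _), mul_assoc,
    sgnF_mul_self, mul_one, smul_mul_assoc]

/-- Adjacent positions within one of the two blocks. -/
def BlockAdj (k l : ℕ) (a b : Fin (k + l)) : Prop := (b : ℕ) = a + 1 ∧ (b : ℕ) ≠ k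

theorem sumPerm_mem_of_blockAdj {k l : ℕ} (S : Submonoid (Perm (Fin (k + l))))
    (h : ∀ a b, BlockAdj k l a b → swap a b ∈ S) (g : Perm (Fin k) × Perm (Fin l)) :
    sumPerm k l g ∈ S := by
  have h1 : sumPerm k l (g.1, 1) ∈ S := by
    refine mem_of_adjacent_mem ((sumPerm k l).comp (MonoidHom.inl _ _)) S (fun a b hab => ?_) g.1
    simp only [MonoidHom.comp_apply, MonoidHom.inl_apply, sumPerm_swap_one]
    exact h _ _ ⟨by simpa using hab, by simp; omega⟩
  have h2 : sumPerm k l (1, g.2) ∈ S := by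
    refine mem_of_adjacent_mem ((sumPerm k l).comp (MonoidHom.inr _ _)) S (fun a b hab => ?_) g.2
    simp only [MonoidHom.comp_apply, MonoidHom.inr_apply, sumPerm_one_swap]
    exact h _ _ ⟨by simp; omega, by simp; omega⟩
  have := mul_mem h1 h2
  rw [← map_mul] at this
  simpa using this

theorem swap_blockAdj {k l : ℕ} {a b : Fin (k + l)} (h : BlockAdj k l a b) :
    ∃ g, sumPerm k l g = swap a b := by
  obtain ⟨h1, h2⟩ := h
  have hb := b.2
  rcases Nat.lt_or_ge b k with h | h
  · refine ⟨(swap ⟨a, by omega⟩ ⟨b, h⟩, 1), ?_⟩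
    rw [sumPerm_swap_one]
    rfl
  · refine ⟨(1, swap ⟨a - k, by omega⟩ ⟨b - k, by omega⟩), ?_⟩
    rw [sumPerm_one_swap]
    congr 1 <;> simp only [Fin.ext_iff, Fin.val_natAdd] <;> omega

/-- A Z is already antisymmetric from the right, so every signed permutation in the second copy of A
acts on it as the identity. -/
theorem blockAntisym_mul_mul {k l : ℕ} {Z : TensorMat N (k + l) B}
    (hZ : ∀ a b, BlockAdj k l a b → Z ∈ swapSubmonoid B N hq a b) :
    lift B (blockAntisym hq N k l) * Z * lift B (blockAntisym hq N k l)
      = (Fintype.card (Perm (Fin k) × Perm (Fin l)) : F)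
        • (lift B (blockAntisym hq N k l) * Z) := by
  have h : ∀ g, sumPerm k l g ∈ signSubmonoid hq (lift B (blockAntisym hq N k l) * Z) := by
    refine sumPerm_mem_of_blockAdj _ fun a b hab => ?_
    rw [swap_mem_signSubmonoid hq hab.1]
    refine mul_swapSubmonoid hq ?_ (hZ a b hab)
    obtain ⟨g, hg⟩ := swap_blockAdj hab
    rw [← map_mul, ← hg, blockAntisym_mul_permMat, lift_smul, hg,
      sgnF_swap (by rintro rfl; have := hab.1; omega), neg_one_smul]
  have e : lift B (blockAntisym hq N k l) = ∑ g : Perm (Fin k) × Perm (Fin l),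
      lift B (sgnF F (sumPerm k l g) • permMat N hq (sumPerm k l g)) := by
    rw [blockAntisym, map_sum]
  conv_lhs => rhs; rw [e]
  rw [Finset.mul_sum]
  have h2 : ∀ g : Perm (Fin k) × Perm (Fin l), lift B (blockAntisym hq N k l) * Z
      * lift B (sgnF F (sumPerm k l g) • permMat N hq (sumPerm k l g))
      = lift B (blockAntisym hq N k l) * Z := by
    intro g
    rw [lift_smul, mul_smul_comm, (mem_signSubmonoid hq).1 (h g), smul_smul, sgnF_mul_self,
      one_smul]
  rw [Finset.sum_congr rfl fun g _ => h2 g, Finset.sum_const, Nat.cast_smul_eq_nsmul]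
  rfl

/-- The normalized antisymmetrizer in the first `k` and in the last `l` factors. -/
def blockProj (N k l : ℕ) : TensorMat N (k + l) F :=
  (Fintype.card (Perm (Fin k) × Perm (Fin l)) : F)⁻¹ • blockAntisym hq N k l

theorem blockProj_mul_mul {k l : ℕ} {Z : TensorMat N (k + l) B}
    (hZ : ∀ a b, BlockAdj k l a b → Z ∈ swapSubmonoid B N hq a b) :
    lift B (blockProj hq N k l) * Z * lift B (blockProj hq N k l)
      = lift B (blockProj hq N k l) * Z := by
  have hc : (Fintype.card (Perm (Fin k) × Perm (Fin l)) : F) ≠ 0 :=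
    Nat.cast_ne_zero.2 Fintype.card_ne_zero
  rw [blockProj, lift_smul, smul_mul_assoc, smul_mul_assoc, mul_smul_comm,
    blockAntisym_mul_mul hq hZ, smul_smul (_)⁻¹ (Nat.cast _), inv_mul_cancel₀ hc, one_smul]

variable {k l : ℕ} (x : Fin k → F) (y : Fin l → F)

/-- The product of the `R_{a b}`, `a` in the first block, for a fixed `b` in the second block. -/
def rCol (N : ℕ) (q : F) (x : Fin k → F) (y : Fin l → F) (b : Fin l) : TensorMat N (k + l) F :=
  ((List.finRange k).map fun a =>
    rLeg q q⁻¹ (x a) (y b) (Fin.castAdd l a) (Fin.natAdd k b)).prod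

/-- The intertwiner between the two blocks. -/
def rBlock (N : ℕ) (q : F) (x : Fin k → F) (y : Fin l → F) : TensorMat N (k + l) F :=
  ((List.finRange l).reverse.map (rCol N q x y)).prod

theorem castAdd_ne_natAdd (a : Fin k) (b : Fin l) : Fin.castAdd l a ≠ Fin.natAdd k b := by
  rw [Ne, Fin.ext_iff]; simp; omega

theorem isUnit_rBlock (hq : q ≠ 0) (x : Fin k → F) (y : Fin l → F)
    (h1 : ∀ a b, q * y b - q⁻¹ * x a ≠ 0) (h2 : ∀ a b, q * x a - q⁻¹ * y b ≠ 0) :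
    IsUnit (rBlock N q x y) := by
  refine Submonoid.list_prod_mem (IsUnit.submonoid _) fun z hz => ?_
  obtain ⟨b, _, rfl⟩ := List.mem_map.1 hz
  refine Submonoid.list_prod_mem (IsUnit.submonoid _) fun z hz => ?_
  obtain ⟨a, _, rfl⟩ := List.mem_map.1 hz
  have h := rLeg_mul_rLeg (N := N) (mul_inv_cancel₀ hq) (x a) (y b) (castAdd_ne_natAdd a b)
  have hc : (q * y b - q⁻¹ * x a) * (q * x a - q⁻¹ * y b) ≠ 0 := mul_ne_zero (h1 a b) (h2 a b)
  refine IsUnit.of_mul_eq_one (((q * y b - q⁻¹ * x a) * (q * x a - q⁻¹ * y b))⁻¹ • _)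
    (?_ : _ * ((_ : F)⁻¹ • rLeg q q⁻¹ (y b) (x a) (Fin.natAdd k b) (Fin.castAdd l a)) = 1)
  rw [mul_smul_comm, h, smul_smul, inv_mul_cancel₀ hc, one_smul]

theorem rBlock_intertwine {L : F → Matrix (Fin N) (Fin N) B} (hL : RLL q L)
    {X : Fin (k + l) → Matrix (Fin N) (Fin N) B} (hX : ∀ a, X (Fin.castAdd l a) = L (x a))
    (hX' : ∀ b, X (Fin.natAdd k b) = L (y b)) :
    lift B (rBlock N q x y) * (legProd ((List.finRange k).map (Fin.castAdd l)) X
          * legProd ((List.finRange l).map (Fin.natAdd k)) X)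
      = legProd ((List.finRange l).map (Fin.natAdd k)) X
        * legProd ((List.finRange k).map (Fin.castAdd l)) X * lift B (rBlock N q x y) := by
  simp only [legProd, List.map_map, rBlock, map_list_prod]
  refine list_prod_reverse_intertwine (List.nodup_finRange _) (fun b => ?_) fun b b' hb => ?_
  · simp only [Function.comp_apply, rCol, map_list_prod, List.map_map]
    refine list_prod_intertwine (List.nodup_finRange _) (fun a => ?_) fun a a' ha => ?_
    · simp only [Function.comp_apply, hX, hX']
      exact (hL (x a) (y b)).leg (castAdd_ne_natAdd a b)
    · exact lift_twoLeg_comm_leg (by simpa [Fin.ext_iff] using ha) (castAdd_ne_natAdd _ _).symm _ _ _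
  · simp only [Function.comp_apply, rCol, map_list_prod, List.map_map]
    refine (commute_list_prod fun a _ => ?_).symm
    exact (lift_twoLeg_comm_leg (castAdd_ne_natAdd _ _) (by simpa [Fin.ext_iff] using hb) _ _ _).symm

/-- Consecutive parameters inside a block have ratio q⁻², so 1 - P is a degenerate R-matrix there.
The Yang–Baxter equation carries it through the two R-matrices involving the neighbouring pair; the
other factors commute with P. -/
theorem rBlock_mem (hq2 : q ^ 2 ≠ 1) (hx0 : ∀ a, x a ≠ 0) (hy0 : ∀ b, y b ≠ 0)
    (hx : ∀ a a' : Fin k, (a' : ℕ) = a + 1 → x a' = x a * (q ^ 2)⁻¹)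
    (hy : ∀ b b' : Fin l, (b' : ℕ) = b + 1 → y b' = y b * (q ^ 2)⁻¹) (a b : Fin (k + l))
    (hab : BlockAdj k l a b) : rBlock N q x y ∈ swapSubmonoid F N hq a b := by
  have hcomm : ∀ (c : Fin k) (d : Fin l), a ≠ Fin.castAdd l c → b ≠ Fin.castAdd l c →
      a ≠ Fin.natAdd k d → b ≠ Fin.natAdd k d →
      (rLeg q q⁻¹ (x c) (y d) (Fin.castAdd l c) (Fin.natAdd k d) : TensorMat N (k + l) F)
        ∈ swapSubmonoid F N hq a b := by
    intro c d h1 h2 h3 h4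
    refine mem_symmSubmonoid_of_comm _ ?_
    rw [lift_self, permMat_swap hq hab.1]
    exact twoLeg_comm h1 h3 h2 h4 _ _ _ _
  have hyb := yangBaxter (N := N) (n := k + l) (mul_inv_cancel₀ hq)
  obtain ⟨hab1, hab2⟩ := hab
  have hb := b.2
  rcases Nat.lt_or_ge b k with h | h
  · obtain ⟨a', rfl⟩ : ∃ a' : Fin k, a = Fin.castAdd l a' := ⟨⟨a, by omega⟩, rfl⟩
    obtain ⟨b', rfl⟩ : ∃ b' : Fin k, b = Fin.castAdd l b' := ⟨⟨b, by omega⟩, rfl⟩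
    simp only [Fin.val_castAdd] at hab1
    refine Submonoid.list_prod_mem _ fun z hz => ?_
    obtain ⟨d, _, rfl⟩ := List.mem_map.1 hz
    obtain ⟨l₁, l₂, hl⟩ := exists_finRange_eq hab1
    rw [rCol, hl]
    refine list_prod_mem_of_pair _ (hl ▸ List.nodup_finRange k) ?_ fun c hc hc' =>
      hcomm c d (by simpa [Fin.ext_iff] using Ne.symm (Fin.val_ne_of_ne hc))
        (by simpa [Fin.ext_iff] using Ne.symm (Fin.val_ne_of_ne hc'))
        (castAdd_ne_natAdd _ _) (castAdd_ne_natAdd _ _)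
    refine mem_swapSubmonoid_of_rLeg hq hq2 (hx0 a') (by simpa using hab1)
      (Z' := rLeg q q⁻¹ (x b') (y d) (Fin.castAdd l b') (Fin.natAdd k d)
        * rLeg q q⁻¹ (x a') (y d) (Fin.castAdd l a') (Fin.natAdd k d)) ?_
    rw [lift_self, ← hx a' b' hab1, ← mul_assoc]
    exact hyb (x a') (x b') (y d) (by rw [Ne, Fin.ext_iff]; simp; omega)
      (castAdd_ne_natAdd _ _) (castAdd_ne_natAdd _ _)
  · obtain ⟨a', rfl⟩ : ∃ a' : Fin l, a = Fin.natAdd k a' :=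
      ⟨⟨a - k, by omega⟩, by rw [Fin.ext_iff]; simp; omega⟩
    obtain ⟨b', rfl⟩ : ∃ b' : Fin l, b = Fin.natAdd k b' :=
      ⟨⟨b - k, by omega⟩, by rw [Fin.ext_iff]; simp; omega⟩
    have hab1' : (b' : ℕ) = a' + 1 := by simp at hab1; omega
    obtain ⟨l₁, l₂, hl⟩ := exists_finRange_eq hab1'
    have hr : (List.finRange l).reverse = l₂.reverse ++ b' :: a' :: l₁.reverse := by
      rw [hl]; simp
    rw [rBlock, hr]
    refine list_prod_mem_of_pair _ (hr ▸ List.nodup_reverse.2 (List.nodup_finRange l)) ?_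
      fun d hd hd' => Submonoid.list_prod_mem _ fun z hz => ?_
    -- Interleave the two neighbouring columns so that, for each c in the first block, the
    -- R-matrices joining c to the two neighbours stand next to each other.
    · rw [rCol, rCol, list_prod_mul_list_prod (List.nodup_finRange k)]
      · refine Submonoid.list_prod_mem _ fun z hz => ?_
        obtain ⟨c, _, rfl⟩ := List.mem_map.1 hz
        refine mem_swapSubmonoid_of_rLeg hq hq2 (hy0 a') (by simpa using hab1)
          (Z' := rLeg q q⁻¹ (x c) (y a') (Fin.castAdd l c) (Fin.natAdd k a')
            * rLeg q q⁻¹ (x c) (y b') (Fin.castAdd l c) (Fin.natAdd k b')) ?_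
        rw [lift_self, ← hy a' b' hab1', ← mul_assoc]
        exact (hyb (x c) (y a') (y b') (castAdd_ne_natAdd _ _) (castAdd_ne_natAdd _ _)
          (by rw [Ne, Fin.ext_iff]; simp; omega)).symm
      · intro c c' hc
        exact twoLeg_comm (by simpa [Fin.ext_iff] using hc) (castAdd_ne_natAdd _ _)
          (castAdd_ne_natAdd _ _).symm (by rw [Ne, Fin.ext_iff]; simp; omega) _ _ _ _
    · obtain ⟨c, _, rfl⟩ := List.mem_map.1 hz
      exact hcomm c d (castAdd_ne_natAdd _ _).symm (castAdd_ne_natAdd _ _).symm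
        (by simpa [Fin.ext_iff] using Ne.symm (Fin.val_ne_of_ne hd'))
        (by simpa [Fin.ext_iff] using Ne.symm (Fin.val_ne_of_ne hd))

/-- The fusion argument. The product of all R-matrices between the blocks exchanges the two strings.
It is invertible for generic parameters by unitarity and is compatible with the block
antisymmetrizer, as are the strings. So both orders of the strings have the same antisymmetrized
trace, and these traces factor over the blocks. -/
theorem commute_altTrace_aux (hq2 : q ^ 2 ≠ 1) (hx0 : ∀ a, x a ≠ 0) (hy0 : ∀ b, y b ≠ 0)
    (hx : ∀ a a' : Fin k, (a' : ℕ) = a + 1 → x a' = x a * (q ^ 2)⁻¹)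
    (hy : ∀ b b' : Fin l, (b' : ℕ) = b + 1 → y b' = y b * (q ^ 2)⁻¹)
    (h1 : ∀ a b, q * y b - q⁻¹ * x a ≠ 0) (h2 : ∀ a b, q * x a - q⁻¹ * y b ≠ 0)
    {L : F → Matrix (Fin N) (Fin N) B} (hL : RLL q L) :
    Commute
      (∑ σ : Perm (Fin k), sgnF F σ •
        trace (lift B (permMat N hq σ) * legProd (List.finRange k) fun a => L (x a)))
      (∑ τ : Perm (Fin l), sgnF F τ •
        trace (lift B (permMat N hq τ) * legProd (List.finRange l) fun b => L (y b))) := by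
  let X : Fin (k + l) → Matrix (Fin N) (Fin N) B :=
    Fin.addCases (fun a => L (x a)) (fun b => L (y b))
  have hX : ∀ a, X (Fin.castAdd l a) = L (x a) := fun a => by simp [X]
  have hX' : ∀ b, X (Fin.natAdd k b) = L (y b) := fun b => by simp [X]
  set TL := legProd ((List.finRange k).map (Fin.castAdd l)) X with hTL
  set TR := legProd ((List.finRange l).map (Fin.natAdd k)) X with hTR
  have hXm : ∀ a b, BlockAdj k l a b → ManinPair hq (X a) (X b) := by
    rintro a b ⟨hab1, hab2⟩
    have hb := b.2
    rcases Nat.lt_or_ge b k with h | h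
    · obtain ⟨a', rfl⟩ : ∃ a' : Fin k, a = Fin.castAdd l a' := ⟨⟨a, by omega⟩, rfl⟩
      obtain ⟨b', rfl⟩ : ∃ b' : Fin k, b = Fin.castAdd l b' := ⟨⟨b, by omega⟩, rfl⟩
      rw [hX, hX, hx a' b' (by simpa using hab1)]
      exact hL.maninPair hq hq2 (hx0 a')
    · obtain ⟨a', rfl⟩ : ∃ a' : Fin l, a = Fin.natAdd k a' :=
        ⟨⟨a - k, by omega⟩, by rw [Fin.ext_iff]; simp; omega⟩
      obtain ⟨b', rfl⟩ : ∃ b' : Fin l, b = Fin.natAdd k b' :=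
        ⟨⟨b - k, by omega⟩, by rw [Fin.ext_iff]; simp; omega⟩
      rw [hX', hX', hy a' b' (by simp at hab1; omega)]
      exact hL.maninPair hq hq2 (hy0 a')
  have hTLm : ∀ a b, BlockAdj k l a b → TL ∈ swapSubmonoid B N hq a b := by
    rintro a b hab
    refine legProd_mem_swapSubmonoid hq hab.1
      ((List.nodup_finRange k).map (Fin.castAdd_injective k l)) ?_ (hXm a b hab)
    obtain ⟨hab1, hab2⟩ := hab
    rcases Nat.lt_or_ge b k with h | h
    · obtain ⟨l₁, l₂, hl⟩ := exists_finRange_eq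
        (a := (⟨a, by omega⟩ : Fin k)) (b := (⟨b, h⟩ : Fin k)) hab1
      exact .inr ⟨l₁.map (Fin.castAdd l), l₂.map (Fin.castAdd l), by rw [hl]; simp⟩
    · refine .inl ⟨?_, ?_⟩ <;> simp [Fin.ext_iff] <;> intro c <;> omega
  have hTRm : ∀ a b, BlockAdj k l a b → TR ∈ swapSubmonoid B N hq a b := by
    rintro a b hab
    refine legProd_mem_swapSubmonoid hq hab.1
      ((List.nodup_finRange l).map (Fin.natAdd_injective l k)) ?_ (hXm a b hab)
    obtain ⟨hab1, hab2⟩ := hab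
    have hb := b.2
    rcases Nat.lt_or_ge b k with h | h
    · refine .inl ⟨?_, ?_⟩ <;> simp [Fin.ext_iff] <;> intro c <;> omega
    · obtain ⟨l₁, l₂, hl⟩ := exists_finRange_eq
        (a := (⟨a - k, by omega⟩ : Fin l)) (b := (⟨b - k, by omega⟩ : Fin l)) (by simp; omega)
      refine .inr ⟨l₁.map (Fin.natAdd k), l₂.map (Fin.natAdd k), ?_⟩
      rw [hl]
      simp [Fin.ext_iff]
      omega
  have hone : lift F (blockProj hq N k l) * 1 * lift F (blockProj hq N k l)
      = lift F (blockProj hq N k l) * 1 :=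
    blockProj_mul_mul hq fun a b _ => one_mem _
  have hR : lift F (blockProj hq N k l) * rBlock N q x y * lift F (blockProj hq N k l)
      = lift F (blockProj hq N k l) * rBlock N q x y :=
    blockProj_mul_mul hq fun a b hab => rBlock_mem hq x y hq2 hx0 hy0 hx hy a b hab
  simp only [lift_self, mul_one] at hone hR
  have key : trace (lift B (blockProj hq N k l) * (TL * TR))
      = trace (lift B (blockProj hq N k l) * (TR * TL)) :=
    trace_eq_of_intertwine hone (isUnit_rBlock hq x y h1 h2) hR
      (rBlock_intertwine x y hL hX hX')
      (blockProj_mul_mul hq fun a b hab => mul_mem (hTRm a b hab) (hTLm a b hab))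
  have hc : (Fintype.card (Perm (Fin k) × Perm (Fin l)) : F)⁻¹ ≠ 0 :=
    inv_ne_zero (Nat.cast_ne_zero.2 Fintype.card_ne_zero)
  simp only [blockProj, lift_smul, smul_mul_assoc, trace_smul] at key
  have key := smul_right_injective _ hc key
  simp only [blockAntisym, map_sum, lift_smul, Finset.sum_mul, smul_mul_assoc, trace_sum,
    trace_smul, hTL, hTR, trace_sumPerm, trace_sumPerm_reverse, hX, hX',
    Fintype.sum_prod_type, sgnF_apply, sign_sumPerm, Units.val_mul, Int.cast_mul] at key
  rw [commute_iff_eq]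
  simp only [sgnF_apply, Finset.sum_mul, Finset.mul_sum, smul_mul_smul_comm]
  rw [Finset.sum_comm, key]
  refine Finset.sum_congr rfl fun σ _ => Finset.sum_congr rfl fun τ _ => ?_
  rw [mul_comm ((Perm.sign σ : ℤ) : F)]

/-- The sequence `L(u), L(u q⁻²), L(u q⁻⁴), …`. -/
def qString (q : F) (L : F → Matrix (Fin N) (Fin N) B) (u : F) (a : ℕ) :
    Matrix (Fin N) (Fin N) B := L (u * ((q ^ 2)⁻¹) ^ a)

theorem qString_generic (hq : q ≠ 0) {u v : F} (h : ∀ i j : ℕ, u * q ^ i ≠ v * q ^ j) (a b : ℕ) :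
    q * (v * ((q ^ 2)⁻¹) ^ b) - q⁻¹ * (u * ((q ^ 2)⁻¹) ^ a) ≠ 0 := by
  intro h0
  apply h (2 * b) (2 * a + 2)
  rw [sub_eq_zero] at h0
  have h1 := congrArg (· * (q * q ^ (2 * a) * q ^ (2 * b))) h0
  rw [inv_pow, inv_pow, ← pow_mul, ← pow_mul] at h1
  field_simp at h1
  rw [pow_add, ← mul_assoc, mul_right_comm]
  linear_combination -h1

theorem commute_altTrace (hq2 : q ^ 2 ≠ 1) {u v : F} (hu : u ≠ 0) (hv : v ≠ 0)
    (h : ∀ i j : ℕ, u * q ^ i ≠ v * q ^ j) {L : F → Matrix (Fin N) (Fin N) B} (hL : RLL q L)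
    (k s l s' : ℕ) :
    Commute (altTrace hq k s (qString q L u)) (altTrace hq l s' (qString q L v)) := by
  have hc : ((q ^ 2)⁻¹ : F) ≠ 0 := inv_ne_zero (pow_ne_zero 2 hq)
  refine commute_altTrace_aux hq (fun a : Fin k => u * ((q ^ 2)⁻¹) ^ (s + a))
    (fun b : Fin l => v * ((q ^ 2)⁻¹) ^ (s' + b)) hq2 (fun a => mul_ne_zero hu (pow_ne_zero _ hc))
    (fun a => mul_ne_zero hv (pow_ne_zero _ hc)) (fun a a' ha => ?_) (fun a a' ha => ?_)
    (fun a b => qString_generic hq h _ _) (fun a b => qString_generic hq (fun i j => (h j i).symm) _ _)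
    hL
  · rw [ha, ← add_assoc, pow_succ, mul_assoc]
  · rw [ha, ← add_assoc, pow_succ, mul_assoc]

/-- Newton's recursion is applied in each argument in turn, starting from the commuting alternating
traces. -/
theorem commute_cycTrace_cycTrace (hq2 : q ^ 2 ≠ 1) {u v : F} (hu : u ≠ 0) (hv : v ≠ 0)
    (h : ∀ i j : ℕ, u * q ^ i ≠ v * q ^ j) {L : F → Matrix (Fin N) (Fin N) B} (hL : RLL q L)
    (k s l s' : ℕ) (hk : 1 ≤ k) (hl : 1 ≤ l) :
    Commute (cycTrace hq k s (qString q L u)) (cycTrace hq l s' (qString q L v)) := by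
  have hc : ((q ^ 2)⁻¹ : F) ≠ 0 := inv_ne_zero (pow_ne_zero 2 hq)
  have hM : ∀ {u : F}, u ≠ 0 → ∀ x, ManinPair hq (qString q L u x) (qString q L u (x + 1)) := by
    intro u hu x
    have := hL.maninPair hq hq2 (mul_ne_zero hu (pow_ne_zero x hc))
    rwa [mul_assoc, ← pow_succ] at this
  refine commute_cycTrace hq (hM hv) (fun n t => Commute.symm ?_) l s' hl
  exact commute_cycTrace hq (hM hu) (fun n' t' => (commute_altTrace hq hq2 hu hv h hL n' t' n t).symm)
    k s hk

end Fusion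

/-! ### Traces against a product of weighted flips as sums over closed paths -/

section CycleTrace

variable {N : ℕ} {F : Type} [CommRing F] {A : Type} [Ring A] [Algebra F A]

/-- The weighted flip of the factors `a` and `a + 1`. -/
def flipLeg (n : ℕ) (c : Fin N → Fin N → F) (a : ℕ) : TensorMat N n F :=
  if h : a + 1 < n then twoLeg ⟨a, by omega⟩ ⟨a + 1, h⟩ (fun _ _ => 0) c else 1

/-- The product of the weighted flips at `r - 1, …, 1, 0`. -/
def flipProd (n : ℕ) (c : Fin N → Fin N → F) : ℕ → TensorMat N n F
  | 0 => 1
  | r + 1 => flipLeg n c r * flipProd n c r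

/-- Rotation of the first `r + 1` entries of a multi-index. -/
def rotIdx {s : ℕ} (r : ℕ) (hr : r ≤ s) (I : Fin (s + 1) → Fin N) : Fin (s + 1) → Fin N := fun a =>
  if (a : ℕ) = 0 then I ⟨r, by omega⟩
  else if h : (a : ℕ) ≤ r then I ⟨a - 1, by omega⟩ else I a

/-- The flips carry the entry at position r to the front, past every earlier entry. Hence all
weights have this same entry as second argument. -/
theorem lift_flipProd_mulVec {s : ℕ} (c : Fin N → Fin N → F) (r : ℕ) (hr : r ≤ s)
    (f : (Fin (s + 1) → Fin N) → A) (I : Fin (s + 1) → Fin N) :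
    (lift A (flipProd (s + 1) c r) *ᵥ f) I
      = (∏ a : Fin r, c (I ⟨a, by omega⟩) (I ⟨r, by omega⟩)) • f (rotIdx r hr I) := by
  induction r generalizing I with
  | zero =>
    have : rotIdx 0 hr I = I := by
      funext a
      unfold rotIdx
      split_ifs with h1 h2
      · congr 1; exact Fin.ext h1.symm
      · exact absurd h2 (by omega)
      · rfl
    simp [flipProd, this]
  | succ r ih =>
    have hr' : r + 1 < s + 1 := by omega
    rw [flipProd, map_mul, ← mulVec_mulVec, flipLeg, dif_pos hr', lift_twoLeg_mulVec,
      zero_smul, zero_add, ih (by omega), smul_smul, Fin.prod_univ_castSucc, mul_comm]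
    have hsw : ∀ a : Fin (s + 1), (a : ℕ) ≠ r → (a : ℕ) ≠ r + 1 →
        swap (⟨r, by omega⟩ : Fin (s + 1)) ⟨r + 1, hr'⟩ a = a := fun a h1 h2 =>
      swap_apply_of_ne_of_ne (fun h => h1 (by rw [h])) (fun h => h2 (by rw [h]))
    congr 1
    · simp only [Function.comp_apply, swap_apply_left]
      congr 1
      refine Finset.prod_congr rfl fun a _ => ?_
      rw [hsw _ (by simp; omega) (by simp; omega)]
      rfl
    · congr 1
      funext a
      unfold rotIdx
      by_cases h0 : (a : ℕ) = 0
      · simp [h0]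
      · simp only [h0, if_false, Function.comp_apply]
        by_cases h1 : (a : ℕ) ≤ r
        · rw [dif_pos h1, dif_pos (by omega), hsw _ (by simp; omega) (by simp; omega)]
        · rw [dif_neg h1]
          by_cases h2 : (a : ℕ) ≤ r + 1
          · rw [dif_pos h2]
            have : a = ⟨r + 1, hr'⟩ := Fin.ext (by simp; omega)
            subst this
            simp
          · rw [dif_neg h2, hsw _ (by omega) (by omega)]

theorem sum_path (c : Fin N → F) (s : ℕ) (M : Fin (s + 1) → Matrix (Fin N) (Fin N) A)
    (i j : Fin N) :
    ∑ K : Fin s → Fin N, (∏ a, c (K a)) •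
        (List.ofFn fun a : Fin (s + 1) => M a ((Fin.cons i K : Fin (s + 1) → Fin N) a)
          ((Fin.snoc K j : Fin (s + 1) → Fin N) a)).prod
      = (M 0 * (List.ofFn fun a : Fin s =>
          lift A (diagonal c) * M a.succ).prod) i j := by
  induction s generalizing i with
  | zero =>
    simp [Fin.snoc]
  | succ s ih =>
    rw [← Equiv.sum_comp (Fin.consEquiv fun _ : Fin (s + 1) => Fin N), Fintype.sum_prod_type,
      List.ofFn_succ, List.prod_cons, Matrix.mul_apply]
    refine Finset.sum_congr rfl fun k _ => ?_
    have h1 : (lift A (diagonal c) * M (Fin.succ 0) * (List.ofFn fun a : Fin s =>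
          lift A (diagonal c) * M a.succ.succ).prod) k j
        = c k • ((M (Fin.succ 0) * (List.ofFn fun a : Fin s =>
          lift A (diagonal c) * M a.succ.succ).prod) k j) := by
      rw [mul_assoc, RingHom.mapMatrix_apply, diagonal_map (map_zero _), diagonal_mul,
        Algebra.smul_def]
    rw [h1, ← ih (fun a => M a.succ) k, Finset.smul_sum, Finset.mul_sum]
    refine Finset.sum_congr rfl fun K _ => ?_
    rw [smul_smul, mul_smul_comm]
    have hc : (Fin.consEquiv fun _ => Fin N) (k, K) = (Fin.cons k K : Fin (s + 1) → Fin N) := rfl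
    rw [hc, List.ofFn_succ, List.prod_cons, Fin.prod_univ_succ, ← Fin.cons_snoc_eq_snoc_cons]
    simp

/-- After the rotation the indices form a closed path starting and ending at j = I(last). Each
intermediate vertex i has weight c(i, j), so for fixed j the weights form one diagonal matrix. -/
theorem trace_flipProd (c : Fin N → Fin N → F) (s : ℕ)
    (M : Fin (s + 1) → Matrix (Fin N) (Fin N) A) :
    trace (lift A (flipProd (s + 1) c s) * legProd (List.finRange (s + 1)) M)
      = ∑ j, (M 0 * (List.ofFn fun a : Fin s =>
          lift A (diagonal fun i => c i j) * M a.succ).prod) j j := by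
  have h1 : trace (lift A (flipProd (s + 1) c s) * legProd (List.finRange (s + 1)) M)
      = ∑ I : Fin (s + 1) → Fin N, (∏ a : Fin s, c (I a.castSucc) (I (Fin.last s))) •
        legProd (List.finRange (s + 1)) M (rotIdx s le_rfl I) I := by
    rw [trace]
    refine Finset.sum_congr rfl fun I _ => ?_
    exact lift_flipProd_mulVec c s le_rfl
      (fun J => legProd (List.finRange (s + 1)) M J I) I
  rw [h1, ← Equiv.sum_comp (Fin.snocEquiv fun _ : Fin (s + 1) => Fin N), Fintype.sum_prod_type]
  refine Finset.sum_congr rfl fun j _ => ?_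
  rw [← sum_path (fun i => c i j)]
  refine Finset.sum_congr rfl fun K _ => ?_
  rw [legProd_apply_of_forall_mem (List.nodup_finRange _) List.mem_finRange, ← List.ofFn_eq_map]
  congr 1
  · refine Finset.prod_congr rfl fun a _ => ?_
    simp [Fin.snocEquiv]
  · congr 2
    funext a
    congr 1
    refine Fin.cases ?_ (fun a => ?_) a
    · simp only [rotIdx, Fin.val_zero, if_true, Fin.cons_zero]
      exact Fin.snoc_last (α := fun _ => Fin N) j K
    · simp only [rotIdx, Fin.val_succ, Nat.add_one_ne_zero, if_false, Fin.cons_succ]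
      rw [dif_pos (by simp)]
      exact Fin.snoc_castSucc (α := fun _ => Fin N) j K a

end CycleTrace

/-! ### Cycle traces in matrix form -/

section CycTrace

variable {N : ℕ} {F : Type} [Field F] {B : Type} [Ring B] [Algebra F B] {q : F} (hq : q ≠ 0)

theorem cyc_succ (k m r : ℕ) : cyc k m (r + 1) = adjSwap k (m + r) * cyc k m r := by
  induction r generalizing m with
  | zero => simp [cyc]
  | succ r ih =>
    rw [cyc, ih, cyc, mul_assoc, add_assoc, add_comm 1 r]

theorem permMat_cyc (n r : ℕ) : permMat N hq (cyc n 0 r) = flipProd n (flipWt q) r := by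
  induction r with
  | zero => exact map_one _
  | succ r ih =>
    rw [cyc_succ, map_mul, ih, flipProd, zero_add]
    congr 1
    unfold adjSwap flipLeg
    split_ifs with h
    · exact permMat_swap hq rfl
    · exact map_one _

theorem cycTrace_eq (n s : ℕ) (hn : 1 ≤ n) (M : ℕ → Matrix (Fin N) (Fin N) B) :
    cycTrace hq n s M = ∑ j, ((List.ofFn fun a : Fin n =>
      lift B (diagonal fun i => flipWt q i j) * M (s + a)).prod : Matrix (Fin N) (Fin N) B) j j := by
  obtain ⟨n, rfl⟩ : ∃ m, n = m + 1 := ⟨n - 1, by omega⟩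
  rw [cycTrace, permTrace, permMat_cyc, strMat, Nat.add_sub_cancel, trace_flipProd]
  refine Finset.sum_congr rfl fun j _ => ?_
  -- The diagonal factor before the first matrix is harmless: at the (j, j) entry it contributes
  -- `flipWt q j j`, which is 1.
  rw [List.ofFn_succ, List.prod_cons, mul_assoc, RingHom.mapMatrix_apply,
    diagonal_map (map_zero _), diagonal_mul]
  simp [flipWt]

end CycTrace

/-! ### Resummation of geometric series -/

section SeriesAlgebra

variable (B : Type) [Ring B] [Algebra ℂ B]

/-- Power series over a `ℂ`-algebra form an algebra over `ℂ⟦X⟧`. -/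
@[reducible] def seriesAlgebra : Algebra ℂ⟦X⟧ B⟦X⟧ :=
  (PowerSeries.map (algebraMap ℂ B)).toAlgebra' fun c x => by
    ext n
    rw [coeff_mul, coeff_mul, ← Finset.Nat.sum_antidiagonal_swap]
    refine Finset.sum_congr rfl fun p _ => ?_
    simp [Algebra.commutes]

attribute [local instance] seriesAlgebra

variable {B}

theorem seriesAlgebra_algebraMap (c : ℂ⟦X⟧) :
    algebraMap ℂ⟦X⟧ B⟦X⟧ c = PowerSeries.map (algebraMap ℂ B) c := rfl

theorem X_smul_eq (x : B⟦X⟧) : (X : ℂ⟦X⟧) • x = X * x := by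
  rw [Algebra.smul_def, seriesAlgebra_algebraMap, map_X]

theorem X_pow_smul_eq (k : ℕ) (x : B⟦X⟧) : (X ^ k : ℂ⟦X⟧) • x = X ^ k * x := by
  rw [Algebra.smul_def, seriesAlgebra_algebraMap, map_pow, map_X]

variable {N : ℕ}

/-- The geometric series of a matrix. -/
def geomMat (P : Matrix (Fin N) (Fin N) B) : Matrix (Fin N) (Fin N) B⟦X⟧ :=
  of fun i j => PowerSeries.mk fun n => (P ^ n) i j

theorem geomMat_mul (P : Matrix (Fin N) (Fin N) B) :
    geomMat P * (1 - (X : ℂ⟦X⟧) • P.map (C (R := B))) = 1 := by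
  rw [mul_sub, mul_one, mul_smul_comm]
  ext i j n
  rw [Matrix.sub_apply, Matrix.smul_apply, map_sub, X_smul_eq]
  rcases n with _ | n
  · simp [geomMat, one_apply]
  · rw [coeff_succ_X_mul, Matrix.mul_apply, map_sum]
    simp only [geomMat, of_apply, coeff_mk, map_apply, coeff_mul_C, one_apply]
    rw [pow_succ, Matrix.mul_apply, sub_self]
    split_ifs <;> simp [coeff_one]

/-- With D = (1 - yΓ)⁻¹ one has (1 - yΓ)(1 - yDL) = 1 - y(L + Γ). So ∑_s (yDL)^s is (1 - y(L + Γ))⁻¹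
(1 - yΓ), and its j-th column loses the last factor since Γ_j = 0. The truncation only produces an
error divisible by y^{m+1}. -/
theorem coeff_sum_pow (Γ : Fin N → ℂ) (j : Fin N) (hΓ : Γ j = 0) (L : Matrix (Fin N) (Fin N) B)
    (D : Fin N → ℂ⟦X⟧) (hD : ∀ i, (1 - X * C (Γ i)) * D i = 1) (m : ℕ) (hm : 1 ≤ m) :
    coeff m ((∑ s ∈ Finset.range (m + 1),
      ((X : ℂ⟦X⟧) • (lift B⟦X⟧ (diagonal D) * L.map (C (R := B)))) ^ s) j j)
      = ((L + diagonal fun i => algebraMap ℂ B (Γ i)) ^ m) j j := by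
  set P := L + diagonal fun i => algebraMap ℂ B (Γ i) with hP
  set DD : Matrix (Fin N) (Fin N) B⟦X⟧ := lift B⟦X⟧ (diagonal D)
  set W := DD * L.map (C (R := B))
  set G : Matrix (Fin N) (Fin N) B⟦X⟧ := lift B⟦X⟧ (diagonal fun i => C (Γ i)) with hG
  set S := ∑ s ∈ Finset.range (m + 1), ((X : ℂ⟦X⟧) • W) ^ s with hS
  have h1 : (1 - (X : ℂ⟦X⟧) • W) * S = 1 - ((X : ℂ⟦X⟧) • W) ^ (m + 1) := mul_neg_geom_sum _ _
  have h2 : (1 - (X : ℂ⟦X⟧) • G) * DD = 1 := by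
    rw [← map_one (lift (F := ℂ⟦X⟧) B⟦X⟧)]
    have : (X : ℂ⟦X⟧) • G = lift B⟦X⟧ (diagonal fun i => X * C (Γ i)) := by
      refine Matrix.ext fun i k => ?_
      simp only [hG, Matrix.smul_apply, RingHom.mapMatrix_apply, map_apply, diagonal_apply]
      split_ifs
      · rw [Algebra.smul_def, map_mul]
      · simp
    rw [this, ← map_sub, ← map_mul]
    congr 1
    rw [← diagonal_one, diagonal_sub, diagonal_mul_diagonal]
    exact congrArg diagonal (funext hD)
  have h3 : (1 - (X : ℂ⟦X⟧) • G) * (1 - (X : ℂ⟦X⟧) • W) = 1 - (X : ℂ⟦X⟧) • P.map (C (R := B)) := by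
    have : P.map (C (R := B)) = L.map (C (R := B)) + G := by
      refine Matrix.ext fun i k => ?_
      simp only [hP, hG, map_apply, Matrix.add_apply, map_add, RingHom.mapMatrix_apply, diagonal_apply]
      congr 1
      split_ifs
      · rw [seriesAlgebra_algebraMap, map_C]
      · simp
    rw [mul_sub, mul_one, mul_smul_comm, ← mul_assoc, h2, one_mul, this, smul_add]
    abel
  have h4 : S = geomMat P * (1 - (X : ℂ⟦X⟧) • G)
      - (X ^ (m + 1) : ℂ⟦X⟧) • (geomMat P * (1 - (X : ℂ⟦X⟧) • G) * W ^ (m + 1)) := by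
    calc S = geomMat P * (1 - (X : ℂ⟦X⟧) • P.map (C (R := B))) * S := by rw [geomMat_mul, one_mul]
      _ = geomMat P * (1 - (X : ℂ⟦X⟧) • G) * (1 - (X ^ (m + 1) : ℂ⟦X⟧) • W ^ (m + 1)) := by
        rw [← h3, mul_assoc, mul_assoc, h1, smul_pow, mul_assoc]
      _ = _ := by rw [mul_sub _ 1, mul_one, mul_smul_comm]
  obtain ⟨m, rfl⟩ : ∃ k, m = k + 1 := ⟨m - 1, by omega⟩
  rw [h4, Matrix.sub_apply, Matrix.smul_apply, map_sub, X_pow_smul_eq, coeff_X_pow_mul', if_neg (by omega),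
    sub_zero, mul_sub, mul_one, mul_smul_comm, Matrix.sub_apply, Matrix.smul_apply, X_smul_eq, map_sub,
    coeff_succ_X_mul, hG, RingHom.mapMatrix_apply, diagonal_map (map_zero _), mul_diagonal, hΓ]
  simp [geomMat]

theorem sum_coeff_mul_pow (Γ : Fin N → ℂ) (j : Fin N) (hΓ : Γ j = 0)
    (L : Matrix (Fin N) (Fin N) B) (D : Fin N → ℂ⟦X⟧) (hD : ∀ i, (1 - X * C (Γ i)) * D i = 1)
    (hj : D j = 1) (m : ℕ) (hm : 1 ≤ m) :
    ∑ s ∈ Finset.range m, coeff m (X ^ (s + 1) * (L.map (C (R := B)) *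
      (lift B⟦X⟧ (diagonal D) * L.map (C (R := B))) ^ s : Matrix (Fin N) (Fin N) B⟦X⟧) j j)
      = ((L + diagonal fun i => algebraMap ℂ B (Γ i)) ^ m : Matrix (Fin N) (Fin N) B) j j := by
  rw [← coeff_sum_pow Γ j hΓ L D hD m hm, Finset.sum_range_succ', Matrix.add_apply, map_add,
    Matrix.sum_apply, map_sum, pow_zero, one_apply_eq, coeff_one, if_neg (by omega), add_zero]
  refine Finset.sum_congr rfl fun s _ => ?_
  rw [smul_pow, Matrix.smul_apply, X_pow_smul_eq, pow_succ' (lift B⟦X⟧ _ * _) s,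
    mul_assoc (lift B⟦X⟧ _), RingHom.mapMatrix_apply, diagonal_map (map_zero _), diagonal_mul, hj,
    map_one, one_mul]

end SeriesAlgebra

/-! ### A closed formula for θ_m -/

section Theta

attribute [local instance] seriesAlgebra

variable {N : ℕ}

/-- The weights of the weighted flip `T(y)`. -/
def tWt (i j : Fin N) : ℂ⟦X⟧ :=
  if i < j then (1 - X)⁻¹ else if j < i then (1 + X)⁻¹ else 1

theorem tMatrix_apply (i j k l : Fin N) :
    tMatrix N (i, j) (k, l) = if k = j ∧ l = i then tWt i j else 0 := by
  have h : ∀ a b : Fin N, flipUnit ℂ⟦X⟧ a b (i, j) (k, l)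
      = if a = i then if b = j then if k = j ∧ l = i then 1 else 0 else 0 else 0 := by
    intro a b
    simp only [flipUnit, kroneckerMap_apply, single_apply]
    split_ifs <;> simp_all
  have h' : ∀ p : Fin N → Fin N → Prop, ∀ [∀ a b, Decidable (p a b)],
      (∑ a, ∑ b, if p a b then flipUnit ℂ⟦X⟧ a b else 0) (i, j) (k, l)
        = if p i j then if k = j ∧ l = i then 1 else 0 else 0 := by
    intro p _
    simp only [Matrix.sum_apply]
    have : ∀ a b : Fin N, (if p a b then flipUnit ℂ⟦X⟧ a b else 0) (i, j) (k, l)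
        = if a = i then if b = j then if p i j then if k = j ∧ l = i then 1 else 0 else 0 else 0
          else 0 := by
      intro a b
      split_ifs <;> simp_all
    simp only [this]
    simp
  rw [tMatrix, Matrix.add_apply, Matrix.add_apply, Matrix.smul_apply, Matrix.smul_apply, h' (fun a b => a < b),
    h' (fun a b => b < a), Matrix.sum_apply]
  simp only [h, tWt]
  rcases lt_trichotomy i j with hij | rfl | hij
  · simp [hij, hij.ne, hij.le.not_gt]
  · simp
  · simp [hij, hij.ne', hij.le.not_gt]

theorem leg₂_tMatrix (s : ℕ) (a : Fin s) :
    leg₂ (s := s + 1) a.castSucc a.succ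
        ((tMatrix N).map (PowerSeries.map (algebraMap ℂ (OpAlg N))))
      = lift (OpAlg N)⟦X⟧ (flipLeg (s + 1) tWt a) := by
  have hab : a.castSucc ≠ a.succ := Fin.castSucc_lt_succ.ne
  ext I J : 2
  rw [flipLeg, dif_pos (by omega), RingHom.mapMatrix_apply, map_apply]
  simp only [leg₂, twoLeg, map_apply, tMatrix_apply, ite_self, zero_add]
  have : (J = I ∘ swap a.castSucc a.succ) ↔ (∀ c, c ≠ a.castSucc → c ≠ a.succ → I c = J c) ∧
      J a.castSucc = I a.succ ∧ J a.succ = I a.castSucc := by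
    constructor
    · rintro rfl
      refine ⟨fun c h1 h2 => ?_, by simp, by simp⟩
      simp [swap_apply_of_ne_of_ne h1 h2]
    · rintro ⟨h1, h2, h3⟩
      funext c
      by_cases hc : c = a.castSucc
      · subst hc; simpa using h2
      by_cases hc' : c = a.succ
      · subst hc'; simpa using h3
      simp [swap_apply_of_ne_of_ne hc hc', h1 c hc hc']
  have e1 : (⟨(a : ℕ), by omega⟩ : Fin (s + 1)) = a.castSucc := rfl
  have e2 : (⟨(a : ℕ) + 1, by omega⟩ : Fin (s + 1)) = a.succ := rfl
  simp only [e1, e2, this]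
  by_cases h1 : ∀ c, c ≠ a.castSucc → c ≠ a.succ → I c = J c
  · rw [if_pos h1]
    by_cases h2 : J a.castSucc = I a.succ ∧ J a.succ = I a.castSucc
    · rw [if_pos h2, if_pos ⟨h1, h2⟩]; rfl
    · rw [if_neg h2, if_neg (fun h => h2 h.2)]; simp
  · rw [if_neg h1, if_neg (fun h => h1 h.1)]; simp

theorem flipProd_eq {F : Type} [CommRing F] (A : Type) [Ring A] [Algebra F A]
    (n : ℕ) (c : Fin N → Fin N → F) (r : ℕ) :
    (List.ofFn fun a : Fin r => lift A (flipLeg n c a)).reverse.prod = lift A (flipProd n c r) := by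
  induction r with
  | zero => simp [flipProd]
  | succ r ih =>
    rw [List.ofFn_succ', List.concat_eq_append, List.reverse_append, List.prod_append]
    rw [flipProd, map_mul, ← ih]
    simp

theorem traceTerm_eq (s : ℕ) :
    traceTerm N s = ∑ j, ((lOp N).map (C (R := OpAlg N)) *
      (lift (OpAlg N)⟦X⟧ (diagonal fun i => tWt i j) * (lOp N).map (C (R := OpAlg N))) ^ s :
        Matrix (Fin N) (Fin N) (OpAlg N)⟦X⟧) j j := by
  unfold traceTerm
  simp only [leg₂_tMatrix]
  rw [flipProd_eq, List.ofFn_eq_map (f := fun a => leg a ((lOp N).map (C (R := OpAlg N))))]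
  refine (trace_flipProd tWt s fun _ => (lOp N).map (C (R := OpAlg N))).trans ?_
  simp [List.ofFn_const]

/-- The scalar `sgn(j - i)` as an operator, placed on the diagonal at `i`. -/
def sgnDiag (B : Type) [Ring B] [Algebra ℂ B] (j : Fin N) : Matrix (Fin N) (Fin N) B :=
  diagonal fun i => algebraMap ℂ B (sgn i j : ℂ)

/-- For fixed j the flip weight T at i is 1/(1 - sgn(j-i)y), so summing over s replaces ℒ by ℒ +
diag_i sgn(j-i). All later arguments use this form of θ_m. -/
theorem theta_eq (m : ℕ) (hm : 1 ≤ m) :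
    theta N m = ∑ j, ((lOp N + sgnDiag (OpAlg N) j) ^ m : Matrix (Fin N) (Fin N) (OpAlg N)) j j := by
  have hjj : ∀ j : Fin N, sgn j j = 0 := fun j => by simp [sgn]
  have hD : ∀ i j : Fin N, (1 - X * C (sgn i j : ℂ)) * tWt i j = 1 := by
    intro i j
    unfold tWt sgn
    rcases lt_trichotomy i j with hij | rfl | hij
    · rw [if_pos hij, Int.sign_eq_one_of_pos (by have : (i : ℕ) < j := hij; omega)]
      simp only [Int.cast_one, map_one, mul_one]
      exact PowerSeries.mul_inv_cancel _ (by simp)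
    · simp
    · rw [if_neg hij.le.not_gt, if_pos hij,
        Int.sign_eq_neg_one_of_neg (by have : (j : ℕ) < i := hij; omega)]
      simp only [Int.cast_neg, Int.cast_one, map_neg, map_one, mul_neg, mul_one, sub_neg_eq_add]
      exact PowerSeries.mul_inv_cancel _ (by simp)
  rw [theta]
  simp only [traceTerm_eq, Finset.mul_sum, map_sum]
  rw [Finset.sum_comm]
  exact Finset.sum_congr rfl fun j _ => sum_coeff_mul_pow (B := OpAlg N) (fun i => (sgn i j : ℂ)) j
    (by simp [hjj]) (lOp N) (fun i => tWt i j) (fun i => hD i j) (by simp [tWt]) m hm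

end Theta

/-! ### Differential operators and their coefficients -/

section DiffOps

variable {N : ℕ}

theorem coeff_du (f : (UPlus N)⟦X⟧) (n : ℕ) :
    coeff n (du N f) = ((n : ℂ) + 1) • coeff (n + 1) f := by
  simp [du]

theorem du_mul (f g : (UPlus N)⟦X⟧) : du N (f * g) = du N f * g + f * du N g := by
  ext n
  have h1 : ((n : ℂ) + 1) • coeff (n + 1) (f * g)
      = ∑ p ∈ Finset.HasAntidiagonal.antidiagonal (n + 1), ((p.1 : ℂ) • (coeff p.1 f * coeff p.2 g)
        + (p.2 : ℂ) • (coeff p.1 f * coeff p.2 g)) := by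
    rw [coeff_mul, Finset.smul_sum]
    refine Finset.sum_congr rfl fun p hp => ?_
    rw [← add_smul, ← Nat.cast_add, Finset.HasAntidiagonal.mem_antidiagonal.mp hp]
    push_cast
    rfl
  rw [coeff_du, h1, Finset.sum_add_distrib, Finset.Nat.sum_antidiagonal_succ,
    Finset.Nat.sum_antidiagonal_succ' (f := fun p : ℕ × ℕ => (p.2 : ℂ) • (coeff p.1 f * coeff p.2 g)),
    map_add, coeff_mul, coeff_mul]
  simp [coeff_du]

theorem mulOp_apply (c f : (UPlus N)⟦X⟧) : mulOp N c f = c * f := rfl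

theorem du_mulOp (c : (UPlus N)⟦X⟧) :
    du N * mulOp N c = mulOp N (du N c) + mulOp N c * du N := by
  ext1 f
  simp [du_mul]

theorem du_pow_X_pow (k p : ℕ) :
    (du N ^ k) (X ^ p) = (p.descFactorial k : ℂ) • (X : (UPlus N)⟦X⟧) ^ (p - k) := by
  have h1 : ∀ p : ℕ, du N (X ^ p) = (p : ℂ) • (X : (UPlus N)⟦X⟧) ^ (p - 1) := by
    intro p
    ext n
    rw [coeff_du, coeff_smul, coeff_X_pow, coeff_X_pow]
    rcases p with _ | p
    · simp
    · by_cases h : n = p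
      · subst h; simp
      · simp [h]
  induction k with
  | zero => simp
  | succ k ih =>
    rw [pow_succ', Module.End.mul_apply, ih, map_smul, h1, smul_smul, Nat.descFactorial_succ,
      mul_comm, Nat.cast_mul, Nat.sub_sub]

variable (N) in
/-- The differential operators of order at most `m`. -/
def diffOps (m : ℕ) : Submodule ℂ (OpAlg N) :=
  Submodule.span ℂ {φ | ∃ c, ∃ k ≤ m, φ = mulOp N c * du N ^ k}

theorem diffOps_mono {m m' : ℕ} (h : m ≤ m') : diffOps N m ≤ diffOps N m' := by
  refine Submodule.span_mono ?_
  rintro _ ⟨c, k, hk, rfl⟩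
  exact ⟨c, k, hk.trans h, rfl⟩

theorem mulOp_mul_mem {m : ℕ} (c : (UPlus N)⟦X⟧) {φ : OpAlg N} (hφ : φ ∈ diffOps N m) :
    mulOp N c * φ ∈ diffOps N m := by
  induction hφ using Submodule.span_induction with
  | mem φ h =>
    obtain ⟨d, k, hk, rfl⟩ := h
    rw [← mul_assoc, ← map_mul]
    exact Submodule.subset_span ⟨_, k, hk, rfl⟩
  | zero => simp
  | add φ ψ _ _ h1 h2 => rw [mul_add]; exact add_mem h1 h2
  | smul a φ _ h => rw [mul_smul_comm]; exact Submodule.smul_mem _ _ h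

theorem du_mul_mem {m : ℕ} {φ : OpAlg N} (hφ : φ ∈ diffOps N m) :
    du N * φ ∈ diffOps N (m + 1) := by
  induction hφ using Submodule.span_induction with
  | mem φ h =>
    obtain ⟨d, k, hk, rfl⟩ := h
    rw [← mul_assoc, du_mulOp, add_mul, mul_assoc, ← pow_succ']
    exact add_mem (Submodule.subset_span ⟨_, k, by omega, rfl⟩)
      (Submodule.subset_span ⟨_, k + 1, by omega, rfl⟩)
  | zero => simp
  | add φ ψ _ _ h1 h2 => rw [mul_add]; exact add_mem h1 h2
  | smul a φ _ h => rw [mul_smul_comm]; exact Submodule.smul_mem _ _ h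

theorem exists_of_mem_diffOps {m : ℕ} {φ : OpAlg N} (hφ : φ ∈ diffOps N m) :
    ∃ c : Fin (m + 1) → (UPlus N)⟦X⟧, φ = ∑ k : Fin (m + 1), mulOp N (c k) * du N ^ (m - (k : ℕ)) := by
  induction hφ using Submodule.span_induction with
  | mem φ h =>
    obtain ⟨d, k, hk, rfl⟩ := h
    refine ⟨Pi.single ⟨m - k, by omega⟩ d, ?_⟩
    rw [Finset.sum_eq_single ⟨m - k, by omega⟩]
    · simp only [Pi.single_eq_same]
      rw [Nat.sub_sub_self hk]
    · intro b _ hb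
      rw [Pi.single_eq_of_ne hb, map_zero, zero_mul]
    · simp
  | zero => exact ⟨0, by simp⟩
  | add φ ψ _ _ h1 h2 =>
    obtain ⟨c, rfl⟩ := h1
    obtain ⟨d, rfl⟩ := h2
    exact ⟨c + d, by simp [add_mul, Finset.sum_add_distrib]⟩
  | smul a φ _ h =>
    obtain ⟨c, rfl⟩ := h
    exact ⟨a • c, by simp [Finset.smul_sum]⟩

/-- Triangularity: on u^k the terms with ∂^l, l > k, vanish, those with l < k are known by
induction, and ∂^k contributes k! c_k. Taking V = 0 yields uniqueness of the coefficients; taking V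
a centralizer yields commutativity. -/
theorem coeff_mem_of_apply_X_pow (V : Submodule ℂ (UPlus N)) (m : ℕ) (c : ℕ → (UPlus N)⟦X⟧)
    (h : ∀ p n, coeff n ((∑ k ∈ Finset.range (m + 1), mulOp N (c k) * du N ^ k) (X ^ p)) ∈ V)
    (k : ℕ) (hk : k ≤ m) (n : ℕ) : coeff n (c k) ∈ V := by
  induction k using Nat.strong_induction_on generalizing n with
  | _ k ih =>
    have h1 := h k n
    rw [LinearMap.sum_apply, map_sum, ← Finset.add_sum_erase _ _ (Finset.mem_range.mpr (by omega : k < m + 1))] at h1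
    have h2 : ∑ l ∈ (Finset.range (m + 1)).erase k,
        coeff n ((mulOp N (c l) * du N ^ l) (X ^ k)) ∈ V := by
      refine Submodule.sum_mem _ fun l hl => ?_
      rw [Module.End.mul_apply, du_pow_X_pow, map_smul, coeff_smul]
      rw [Finset.mem_erase, Finset.mem_range] at hl
      rcases lt_or_gt_of_ne hl.1 with hlk | hlk
      · refine Submodule.smul_mem _ _ ?_
        rw [mulOp_apply, coeff_mul_X_pow']
        split_ifs
        · exact ih l hlk (by omega) _
        · exact zero_mem _
      · rw [Nat.descFactorial_of_lt hlk, Nat.cast_zero, zero_smul]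
        exact zero_mem _
    have h3 := (Submodule.add_mem_iff_left _ h2).mp h1
    rw [Module.End.mul_apply, du_pow_X_pow, map_smul, coeff_smul, Nat.sub_self, pow_zero,
      Nat.descFactorial_self] at h3
    have h4 := (Submodule.smul_mem_iff V (Nat.cast_ne_zero.mpr k.factorial_ne_zero)).mp h3
    simpa using h4

theorem coeff_mem_of_eq_sum (V : Submodule ℂ (UPlus N)) {m : ℕ} {φ : OpAlg N}
    (c : Fin (m + 1) → (UPlus N)⟦X⟧)
    (hφ : φ = ∑ k : Fin (m + 1), mulOp N (c k) * du N ^ (m - (k : ℕ)))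
    (h : ∀ p n, coeff n (φ (X ^ p)) ∈ V) (k : Fin (m + 1)) (n : ℕ) : coeff n (c k) ∈ V := by
  have h1 : φ = ∑ k ∈ Finset.range (m + 1), mulOp N (c (Fin.ofNat (m + 1) (m - k))) * du N ^ k := by
    rw [hφ, ← Finset.sum_range_reflect, Finset.sum_range]
    refine Finset.sum_congr rfl fun a _ => ?_
    have e1 : m + 1 - 1 - (a : ℕ) = m - a := by omega
    have e2 : Fin.ofNat (m + 1) (m - (m - (a : ℕ))) = a := by
      ext; simp [Nat.sub_sub_self (Nat.lt_succ_iff.mp a.2)]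
    rw [e1, e2]
  have h2 := coeff_mem_of_apply_X_pow V m (fun k => c (Fin.ofNat (m + 1) (m - k)))
    (by rw [← h1]; exact h) (m - k) (by omega) n
  have e2 : Fin.ofNat (m + 1) (m - (m - (k : ℕ))) = k := by
    ext; simp [Nat.sub_sub_self (Nat.lt_succ_iff.mp k.2)]
  rwa [e2] at h2

theorem existsUnique_of_mem_diffOps {m : ℕ} {φ : OpAlg N} (hφ : φ ∈ diffOps N m) :
    ∃ θ : ℕ → (UPlus N)⟦X⟧, (∀ c : Fin (m + 1) → (UPlus N)⟦X⟧,
      φ = ∑ k : Fin (m + 1), mulOp N (c k) * du N ^ (m - (k : ℕ)) ↔ ∀ k : Fin (m + 1), c k = θ k) := by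
  obtain ⟨c, hc⟩ := exists_of_mem_diffOps hφ
  refine ⟨fun k => c (Fin.ofNat (m + 1) k), fun d => ?_⟩
  have e : ∀ k : Fin (m + 1), Fin.ofNat (m + 1) (k : ℕ) = k := fun k => by ext; simp
  simp only [e]
  refine ⟨fun hd k => ?_, fun hd => ?_⟩
  · have h0 : (0 : OpAlg N) = ∑ k : Fin (m + 1), mulOp N ((d - c) k) * du N ^ (m - (k : ℕ)) := by
      simp only [Pi.sub_apply, map_sub, sub_mul, Finset.sum_sub_distrib, ← hc, ← hd, sub_self]
    ext n
    have := coeff_mem_of_eq_sum ⊥ _ h0 (by simp) k n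
    rw [Submodule.mem_bot] at this
    simpa [sub_eq_zero] using this
  · rw [hc]; simp only [hd]

theorem lOp_add_mem (Γ : Matrix (Fin N) (Fin N) (OpAlg N)) (hΓ : ∀ i j, ∃ a : ℂ, Γ i j = algebraMap ℂ _ a)
    (m : ℕ) (i j : Fin N) :
    ((lOp N + Γ) ^ m : Matrix (Fin N) (Fin N) (OpAlg N)) i j ∈ diffOps N m := by
  induction m generalizing i j with
  | zero =>
    rw [pow_zero, one_apply]
    split_ifs
    · exact Submodule.subset_span ⟨1, 0, le_rfl, by rw [map_one, pow_zero, mul_one]⟩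
    · exact zero_mem _
  | succ m ih =>
    rw [pow_succ', Matrix.mul_apply]
    refine Submodule.sum_mem _ fun k _ => ?_
    obtain ⟨a, ha⟩ := hΓ i k
    rw [lOp, Matrix.add_apply, Matrix.sub_apply, ha, add_mul, sub_mul, Matrix.map_apply, diagonal_apply]
    refine add_mem (sub_mem ?_ (diffOps_mono (Nat.le_succ m) (mulOp_mul_mem _ (ih _ _)))) ?_
    · split_ifs
      · rw [mul_assoc, mul_assoc, two_mul]
        have := mulOp_mul_mem (X : (UPlus N)⟦X⟧) (du_mul_mem (ih k j))
        exact add_mem this this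
      · rw [zero_mul]; exact zero_mem _
    · rw [← Algebra.smul_def]
      exact Submodule.smul_mem _ _ (diffOps_mono (Nat.le_succ m) (ih _ _))

theorem sgnDiag_apply (B : Type) [Ring B] [Algebra ℂ B] (j i k : Fin N) :
    ∃ a : ℂ, sgnDiag B j i k = algebraMap ℂ B a := by
  rw [sgnDiag, diagonal_apply]
  split_ifs
  · exact ⟨_, rfl⟩
  · exact ⟨0, by simp⟩

theorem theta_mem_diffOps (m : ℕ) (hm : 1 ≤ m) : theta N m ∈ diffOps N m := by
  rw [theta_eq m hm]
  exact Submodule.sum_mem _ fun j _ => lOp_add_mem _ (fun i k => sgnDiag_apply _ _ i k) m j j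

end DiffOps

/-! ### Monodromy and higher transfer matrices over commutative rings -/

section Monodromy

variable {N d : ℕ} {F : Type} [CommRing F]

/-- The monodromy matrix of the sites in a list `l`, at the inhomogeneities `x`. -/
def monodromy (N : ℕ) (q q' : F) (x : Fin d → F) (l : List (Fin d)) (u : F) :
    Matrix (Fin N) (Fin N) (TensorMat N d F) :=
  (l.map fun s => (rLax N q q' (u * x s) 1).map (legHom N F s)).prod

theorem commute_leg_monodromy (q q' : F) (x : Fin d → F) (l : List (Fin d)) (u : F) {s : Fin d}
    (hs : s ∉ l) (A : Matrix (Fin N) (Fin N) F) (i j : Fin N) :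
    legHom N F s A * monodromy N q q' x l u i j = monodromy N q q' x l u i j * legHom N F s A := by
  induction l generalizing i with
  | nil =>
    simp only [monodromy, List.map_nil, List.prod_nil, one_apply]
    split_ifs <;> simp
  | cons t l ih =>
    rw [List.mem_cons, not_or] at hs
    have e : monodromy N q q' x (t :: l) u
      = (rLax N q q' (u * x t) 1).map (legHom N F t) * monodromy N q q' x l u := by
      simp [monodromy]
    rw [e, Matrix.mul_apply, Finset.mul_sum, Finset.sum_mul]
    refine Finset.sum_congr rfl fun k _ => ?_
    rw [mul_assoc, ← ih hs.2, ← mul_assoc, ← mul_assoc, Matrix.map_apply]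
    congr 1
    exact leg_comm_of_ne hs.1 _ _ fun i j k l => mul_comm _ _

theorem monodromy_exchange {q q' : F} (hq : q * q' = 1) (x : Fin d → F) {l : List (Fin d)}
    (hl : l.Nodup) (u v : F) :
    Exchange (rDiag q q' u v) (rFlip q q' u v) (monodromy N q q' x l u) (monodromy N q q' x l v) := by
  induction l with
  | nil => exact Exchange.one _ _ (rFlip_self q q' u v)
  | cons t l ih =>
    rw [List.nodup_cons] at hl
    have e : ∀ u, monodromy N q q' x (t :: l) u
      = (rLax N q q' (u * x t) 1).map (legHom N F t) * monodromy N q q' x l u := by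
      simp [monodromy]
    rw [e, e]
    refine Exchange.mul ((rLax_exchange hq u v 1 (x t)).map (legHom N F t) ?_) (ih hl.2) ?_ ?_
    · intro c b
      ext I J
      simp [legHom, leg]
    · intro i j k m
      exact (commute_leg_monodromy q q' x l u hl.1 _ i j).symm
    · intro i j k m
      exact commute_leg_monodromy q q' x l v hl.1 _ k m

/-- The product `c L(u) c L(u q'²) ⋯` with `k` factors `L`. -/
def stringProd {B : Type} [Ring B] [Algebra F B] (q' : F) (c : Fin N → F)
    (L : F → Matrix (Fin N) (Fin N) B) : ℕ → F → Matrix (Fin N) (Fin N) B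
  | 0, _ => 1
  | k + 1, u => lift B (diagonal c) * L u * stringProd q' c L k (u * q' ^ 2)

/-- The weights of the weighted flip. -/
def qWt (q q' : F) (i j : Fin N) : F := if i < j then q' else if j < i then q else 1

/-- The higher transfer matrices. -/
def transfer (N : ℕ) (q q' : F) (x : Fin d → F) (l : List (Fin d)) (k : ℕ) (u : F) : TensorMat N d F :=
  ∑ j, stringProd q' (fun i => qWt q q' i j) (monodromy N q q' x l) k u j j

variable {F' : Type} [CommRing F']

theorem monodromy_map (φ : F →+* F') (q q' : F) (x : Fin d → F) (l : List (Fin d)) (u : F) :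
    φ.mapMatrix.mapMatrix (monodromy N q q' x l u)
      = monodromy N (φ q) (φ q') (φ ∘ x) l (φ u) := by
  rw [monodromy, map_list_prod, List.map_map, monodromy]
  congr 2
  funext s
  refine Matrix.ext fun i k => ?_
  have h : (rLax N q q' (u * x s) 1 i k).map φ
      = rLax N (φ q) (φ q') (φ u * φ (x s)) 1 i k := by
    ext a b
    simp only [rLax, Matrix.map_apply, Matrix.add_apply, map_add, single_apply, rFlip]
    congr 1
    · split_ifs
      · simp only [diagonal_apply, rDiag]
        split_ifs <;> simp
      · simp
    · split_ifs <;> simp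
  simp only [Function.comp_apply, RingHom.mapMatrix_apply, Matrix.map_apply, ← h]
  exact leg_map φ s _

theorem stringProd_monodromy_map (φ : F →+* F') (q q' : F) (x : Fin d → F) (l : List (Fin d))
    (j : Fin N) (k : ℕ) (u : F) : φ.mapMatrix.mapMatrix
      (stringProd q' (fun i => qWt q q' i j) (monodromy N q q' x l) k u)
      = stringProd (φ q') (fun i => qWt (φ q) (φ q') i j)
        (monodromy N (φ q) (φ q') (φ ∘ x) l) k (φ u) := by
  induction k generalizing u with
  | zero => exact map_one _
  | succ k ih =>
    rw [stringProd, map_mul, map_mul, ih, monodromy_map, stringProd, map_mul, map_pow]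
    congr 2
    refine Matrix.ext fun a b => ?_
    simp only [RingHom.mapMatrix_apply, Matrix.map_apply, diagonal_apply]
    split_ifs with hab
    · ext I J
      simp only [Matrix.map_apply, algebraMap_matrix_apply]
      split_ifs
      · simp only [qWt, Algebra.algebraMap_self, RingHom.id_apply]; split_ifs <;> simp
      · simp
    · simp

/-- Naturality in the base ring. It lets one polynomial identity be proved over a fraction field and
used with power series in u. -/
theorem transfer_map (φ : F →+* F') (q q' : F) (x : Fin d → F) (l : List (Fin d)) (k : ℕ) (u : F) :
    (transfer N q q' x l k u).map φ = transfer N (φ q) (φ q') (φ ∘ x) l k (φ u) := by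
  change φ.mapMatrix (transfer N q q' x l k u) = _
  rw [transfer, map_sum, transfer]
  refine Finset.sum_congr rfl fun j _ => ?_
  rw [← stringProd_monodromy_map]
  rfl

end Monodromy

/-! ### Transfer matrices over a field are cycle traces -/

section TransferField

variable {N d : ℕ} {F : Type} [Field F]

theorem cycTrace_eq_transfer {q : F} (hq : q ≠ 0) (x : Fin d → F) (l : List (Fin d)) (k : ℕ)
    (hk : 1 ≤ k) (u : F) :
    cycTrace hq k 0 (qString q (monodromy N q q⁻¹ x l) u) = transfer N q q⁻¹ x l k u := by
  rw [cycTrace_eq hq k 0 hk, transfer]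
  refine Finset.sum_congr rfl fun j _ => ?_
  refine congrArg (fun M : Matrix (Fin N) (Fin N) (TensorMat N d F) => M j j) ?_
  clear hk
  induction k generalizing u with
  | zero => simp [stringProd]
  | succ k ih =>
    rw [List.ofFn_succ, List.prod_cons, stringProd, ← ih]
    congr 2
    · simp [qString]
    · congr 1
      funext a
      simp only [qString, Fin.val_succ, zero_add, inv_pow]
      congr 2
      rw [pow_succ', mul_assoc, mul_inv]

theorem commute_transfer [CharZero F] {q : F} (hq : q ≠ 0) (hq2 : q ^ 2 ≠ 1) {u v : F} (hu : u ≠ 0)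
    (hv : v ≠ 0) (h : ∀ i j : ℕ, u * q ^ i ≠ v * q ^ j) (x : Fin d → F) {l : List (Fin d)}
    (hl : l.Nodup) {k k' : ℕ} (hk : 1 ≤ k) (hk' : 1 ≤ k') :
    Commute (transfer N q q⁻¹ x l k u) (transfer N q q⁻¹ x l k' v) := by
  rw [← cycTrace_eq_transfer hq x l k hk, ← cycTrace_eq_transfer hq x l k' hk']
  exact commute_cycTrace_cycTrace hq hq2 hu hv h
    (fun u v => monodromy_exchange (mul_inv_cancel₀ hq) x hl u v) k 0 k' 0 hk hk'

end TransferField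

/-! ### Commutativity of the coefficients of transfer matrices -/

section TransferPoly

variable {N d : ℕ} {K : Type} [CommRing K] [IsDomain K] [CharZero K]

open Polynomial in
/-- The coefficients of the transfer matrices commute. -/
theorem commute_coeff_transfer {q q' : K} (hqq : q * q' = 1) (hq2 : q ^ 2 ≠ 1) (x : Fin d → K)
    {l : List (Fin d)} (hl : l.Nodup) {k k' : ℕ} (hk : 1 ≤ k) (hk' : 1 ≤ k') (a b : ℕ) :
    Commute ((transfer N (Polynomial.C q) (Polynomial.C q') (Polynomial.C ∘ x) l k
        (Polynomial.X : K[X])).map fun p => p.coeff a)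
      ((transfer N (Polynomial.C q) (Polynomial.C q') (Polynomial.C ∘ x) l k'
        (Polynomial.X : K[X])).map fun p => p.coeff b) := by
  -- The two spectral parameters become independent variables, the inner one via `φ₁` and the outer
  -- one via `φ₂`. This makes them generic over the fraction field.
  set 𝕂 := FractionRing K[X][X]
  set ι : K[X][X] →+* 𝕂 := algebraMap _ _ with hι
  have hinj : Function.Injective ι := IsFractionRing.injective _ _
  set φ₁ : K[X] →+* K[X][X] := Polynomial.C
  set φ₂ : K[X] →+* K[X][X] := Polynomial.mapRingHom Polynomial.C
  have hC : ∀ c : K, φ₂ (Polynomial.C c) = φ₁ (Polynomial.C c) := by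
    intro c; simp [φ₁, φ₂]
  set t₁ := transfer N (Polynomial.C q) (Polynomial.C q') (Polynomial.C ∘ x) l k (Polynomial.X : K[X])
  set t₂ := transfer N (Polynomial.C q) (Polynomial.C q') (Polynomial.C ∘ x) l k' (Polynomial.X : K[X])
  set Q : 𝕂 := ι (φ₁ (Polynomial.C q)) with hQ
  have hQ' : Q * ι (φ₁ (Polynomial.C q')) = 1 := by
    rw [hQ, ← map_mul, ← map_mul, ← map_mul, hqq, map_one, map_one, map_one]
  have hQ0 : Q ≠ 0 := left_ne_zero_of_mul_eq_one hQ'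
  have hQi : ι (φ₁ (Polynomial.C q')) = Q⁻¹ := eq_inv_of_mul_eq_one_right hQ'
  have hq0 : q ≠ 0 := left_ne_zero_of_mul_eq_one hqq
  have : CharZero 𝕂 := charZero_of_injective_ringHom hinj
  have key : Commute (t₁.map φ₁) (t₂.map φ₂) := by
    have e1 : (t₁.map φ₁).map ι = transfer N Q Q⁻¹ (fun s => ι (φ₁ (Polynomial.C (x s)))) l k
        (ι (φ₁ Polynomial.X)) := by
      rw [transfer_map, transfer_map, ← hQi]; rfl
    have e2 : (t₂.map φ₂).map ι = transfer N Q Q⁻¹ (fun s => ι (φ₁ (Polynomial.C (x s)))) l k'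
        (ι (φ₂ Polynomial.X)) := by
      rw [transfer_map, transfer_map, ← hQi]
      simp only [hC, Function.comp_def]
      rfl
    have hcomm := commute_transfer (N := N) hQ0 (u := ι (φ₁ Polynomial.X)) (v := ι (φ₂ Polynomial.X))
      ?_ ?_ ?_ ?_ (fun s => ι (φ₁ (Polynomial.C (x s)))) hl hk hk'
    · rw [← e1, ← e2] at hcomm
      have h3 : ι.mapMatrix (t₁.map φ₁ * t₂.map φ₂) = ι.mapMatrix (t₂.map φ₂ * t₁.map φ₁) := by
        rw [map_mul, map_mul]; exact hcomm
      exact Matrix.map_injective hinj h3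
    · rw [hQ, ← map_pow, ← map_pow, ← map_pow]
      intro h
      rw [← map_one ι] at h
      have h := hinj h
      rw [← map_one φ₁] at h
      have h := Polynomial.C_injective h
      rw [← Polynomial.C_1] at h
      exact hq2 (Polynomial.C_injective h)
    · rw [Ne, map_eq_zero_iff _ hinj]
      simp [φ₁]
    · rw [Ne, map_eq_zero_iff _ hinj]
      simp [φ₂]
    · intro i j h
      have h : ι (φ₁ Polynomial.X * φ₁ (Polynomial.C q) ^ i)
          = ι (φ₂ Polynomial.X * φ₁ (Polynomial.C q) ^ j) := by
        simpa only [map_mul, map_pow] using h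
      -- Genericity: the right side is divisible by the outer variable, whereas the left side is a
      -- nonzero constant in it.
      have h := congrArg (fun p : K[X][X] => p.coeff 0) (hinj h)
      simp [φ₁, φ₂] at h
      rw [← Polynomial.C_pow, Polynomial.coeff_C_zero] at h
      exact pow_ne_zero i (Polynomial.C_ne_zero.mpr hq0) h
  have hco : ∀ p r : K[X], ((φ₁ p * φ₂ r).coeff b).coeff a = p.coeff a * r.coeff b := by
    intro p r
    simp [φ₁, φ₂]
  refine Matrix.ext fun I J => ?_
  have h := congrArg (fun M : TensorMat N d K[X][X] => ((M I J).coeff b).coeff a) key.eq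
  simp only [Matrix.mul_apply, Matrix.map_apply, Polynomial.finsetSum_coeff, hco] at h ⊢
  rw [h]
  refine Finset.sum_congr rfl fun P _ => ?_
  rw [mul_comm (φ₂ _), hco, mul_comm]

end TransferPoly

/-! ### Coefficientwise representations on power series -/

section SeriesRep

variable {ι : Type} [Fintype ι] [DecidableEq ι] {A : Type} [Ring A]

/-- The coefficientwise extension of a matrix representation to power series. -/
def seriesRep (ρ : A →+* Matrix ι ι ℂ) : A⟦X⟧ →+* Matrix ι ι ℂ⟦X⟧ where
  toFun f := of fun I J => PowerSeries.mk fun n => ρ (coeff n f) I J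
  map_one' := by
    ext I J n
    simp only [of_apply, coeff_mk, coeff_one, one_apply]
    split_ifs <;> simp_all [coeff_one]
  map_zero' := by ext I J n; simp
  map_add' f g := by ext I J n; simp
  map_mul' f g := by
    ext I J n
    simp only [of_apply, coeff_mk, coeff_mul, Matrix.mul_apply, map_sum, map_mul, Matrix.sum_apply]
    rw [Finset.sum_comm]

theorem coeff_seriesRep (ρ : A →+* Matrix ι ι ℂ) (f : A⟦X⟧) (I J : ι) (n : ℕ) :
    coeff n (seriesRep ρ f I J) = ρ (coeff n f) I J := by
  simp [seriesRep]

theorem seriesRep_map_coeff (ρ : A →+* Matrix ι ι ℂ) (f : A⟦X⟧) (n : ℕ) :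
    (seriesRep ρ f).map (coeff n) = ρ (coeff n f) := by
  ext I J
  exact coeff_seriesRep ρ f I J n

end SeriesRep

/-! ### Tensor products of dual evaluation representations -/

section SiteRep

variable {N d : ℕ}

theorem leg_smul {F : Type} [CommRing F] (s : Fin d) (c : F) (M : Matrix (Fin N) (Fin N) F) : leg s (c • M) = c • leg s M := by
  ext I J; simp [leg]

theorem leg_neg (s : Fin d) (M : Matrix (Fin N) (Fin N) ℂ) : leg s (-M) = -leg s M := by
  rw [← neg_one_smul ℂ, leg_smul, neg_one_smul]

theorem leg_sub (s : Fin d) (M M' : Matrix (Fin N) (Fin N) ℂ) : leg s (M - M') = leg s M - leg s M' := by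
  rw [sub_eq_add_neg, leg_add, leg_neg, sub_eq_add_neg]

/-- The dual evaluation representation at a point `x`, in the tensor factor `s`. -/
def siteMap (s : Fin d) (x : ℂ) : gPlus N →ₗ[ℂ] TensorMat N d ℂ where
  toFun A := -leg s ((A : Matrix (Fin N) (Fin N) (Polynomial ℂ)).map (Polynomial.eval x))ᵀ
  map_add' A B := by
    rw [← neg_add, ← leg_add, ← transpose_add]
    congr 3
    ext i j
    simp
  map_smul' c A := by
    rw [RingHom.id_apply, smul_neg, ← leg_smul, ← transpose_smul]
    congr 3
    ext i j
    simp

theorem siteMap_lie (s : Fin d) (x : ℂ) (A B : gPlus N) :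
    siteMap s x ⁅A, B⁆ = ⁅siteMap s x A, siteMap s x B⁆ := by
  have h : ∀ P Q : Matrix (Fin N) (Fin N) (Polynomial ℂ), ((P * Q).map (Polynomial.eval x))ᵀ
      = (Q.map (Polynomial.eval x))ᵀ * (P.map (Polynomial.eval x))ᵀ := by
    intro P Q
    rw [← transpose_mul]
    congr 1
    exact Matrix.map_mul (f := Polynomial.evalRingHom x)
  simp only [siteMap, LinearMap.coe_mk, AddHom.coe_mk, LieSubalgebra.coe_bracket,
    LieRing.of_associative_ring_bracket]
  rw [neg_mul_neg, neg_mul_neg, ← leg_mul, ← leg_mul, ← h, ← h, ← leg_sub, ← leg_neg, ← transpose_sub,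
    ← transpose_neg]
  congr 2
  ext i j
  simp

theorem siteMap_comm {s t : Fin d} (hst : s ≠ t) (x y : ℂ) (A B : gPlus N) :
    siteMap s x A * siteMap t y B = siteMap t y B * siteMap s x A := by
  simp only [siteMap, LinearMap.coe_mk, AddHom.coe_mk, neg_mul_neg]
  exact leg_comm_of_ne hst _ _ fun _ _ _ _ => mul_comm _ _

/-- The tensor product of the dual evaluation representations at the sites in `S`. -/
def siteRep (x : Fin d → ℂ) (S : Finset (Fin d)) : gPlus N →ₗ⁅ℂ⁆ TensorMat N d ℂ :=
  { toLinearMap := ∑ s ∈ S, siteMap s (x s)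
    map_lie' := by
      intro A B
      simp only [AddHom.toFun_eq_coe, LinearMap.coe_toAddHom, LinearMap.sum_apply, siteMap_lie,
        LieRing.of_associative_ring_bracket, Finset.sum_sub_distrib, Finset.sum_mul_sum]
      rw [sub_eq_sub_iff_add_eq_add, Finset.sum_comm (s := S) (t := S)
        (f := fun i j => siteMap i (x i) B * siteMap j (x j) A), ← Finset.sum_add_distrib,
        ← Finset.sum_add_distrib]
      refine Finset.sum_congr rfl fun s hs => ?_
      rw [← Finset.add_sum_erase _ _ hs, 
        ← Finset.add_sum_erase S (fun j => siteMap s (x s) A * siteMap j (x j) B) hs]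
      have : ∑ t ∈ S.erase s, siteMap s (x s) A * siteMap t (x t) B
          = ∑ t ∈ S.erase s, siteMap t (x t) B * siteMap s (x s) A :=
        Finset.sum_congr rfl fun t ht => siteMap_comm (Finset.ne_of_mem_erase ht).symm _ _ _ _
      rw [this]
      abel }

/-- The representation of the universal enveloping algebra attached to the sites in `S`. -/
def uRep (x : Fin d → ℂ) (S : Finset (Fin d)) : UPlus N →ₐ[ℂ] TensorMat N d ℂ :=
  UniversalEnvelopingAlgebra.lift ℂ (siteRep x S)

theorem uRep_ι (x : Fin d → ℂ) (S : Finset (Fin d)) (A : gPlus N) :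
    uRep x S (UniversalEnvelopingAlgebra.ι ℂ A) = ∑ s ∈ S, siteMap s (x s) A := by
  rw [uRep, UniversalEnvelopingAlgebra.lift_ι_apply]
  exact LinearMap.sum_apply _ _ _

/-- The coefficient `(1 + xu)/(1 - xu) + sgn(k - i)` of the classical `r`-matrix. -/
def rCoef (x : ℂ) (i k : Fin N) : ℂ⟦X⟧ :=
  PowerSeries.mk fun n => (if n = 0 then 1 + (sgn i k : ℂ) else 2) * x ^ n

/-- The sign and the transpose of the dual representation turn -(1 + sgn(j-i))E_{ij} and -2E_{ij}t⁻ⁿ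
into positive multiples of e_{ji}, hence ℒ⁺ into the classical r-matrix with its factor e_{ij} ⊗
e_{ji}. -/
theorem siteMap_lPlusElem (s : Fin d) (x : ℂ) (i k : Fin N) (n : ℕ) :
    siteMap s x (lPlusElem N i k n) = (leg s (single k i (rCoef x i k))).map (coeff n) := by
  ext I J
  simp only [siteMap, LinearMap.coe_mk, AddHom.coe_mk, lPlusElem, leg, Matrix.neg_apply,
    Matrix.map_apply, transpose_apply, single_apply, rCoef]
  split_ifs <;> simp_all

theorem seriesRep_lPlus (x : Fin d → ℂ) (S : Finset (Fin d)) (i k : Fin N) :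
    seriesRep (uRep x S).toRingHom (lPlus N i k)
      = ∑ s ∈ S, leg s (single k i (rCoef (x s) i k)) := by
  ext I J n
  rw [coeff_seriesRep, lPlus, coeff_mk]
  change uRep x S _ I J = _
  rw [uRep_ι, Matrix.sum_apply, Matrix.sum_apply, map_sum]
  refine Finset.sum_congr rfl fun s _ => ?_
  rw [siteMap_lPlusElem, Matrix.map_apply]

theorem coeff_two_mul_X_du (f : (UPlus N)⟦X⟧) (n : ℕ) :
    coeff n ((2 * mulOp N X * du N) f) = (2 * n : ℂ) • coeff n f := by
  rw [mul_assoc, two_mul, LinearMap.add_apply, Module.End.mul_apply, mulOp_apply, map_add]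
  rcases n with _ | n
  · simp
  · rw [coeff_succ_X_mul, coeff_du, ← add_smul]
    congr 1
    push_cast
    ring

end SiteRep

/-! ### First order part of the normalized monodromy matrix -/

section Normalized

variable {N d : ℕ} {F : Type} [CommRing F]

/-- The numerators of the first order part of the quantum `R`-matrix. -/
def rNum (q' y : F) (i k : Fin N) : F :=
  if i < k then 1 + q' else if k < i then (1 + q') * y else 1 + q' * y

theorem rLax_eq {h q' : F} (hq : (1 + h) * q' = 1) (y : F) (i k : Fin N) :
    rLax N (1 + h) q' y 1 i k
      = (1 - y) • (1 : Matrix (Fin N) (Fin N) (Matrix (Fin N) (Fin N) F)) i k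
        + h • single k i (rNum q' y i k) := by
  have h1 : 1 + h - q' = h * (1 + q') := by linear_combination (-1) * hq
  ext a b
  simp only [rLax, Matrix.add_apply, Matrix.smul_apply, one_apply, single_apply, rNum, rFlip]
  rcases lt_trichotomy i k with hik | rfl | hik
  · simp only [hik.ne, hik, if_true, if_false, Matrix.zero_apply, smul_eq_mul, mul_zero, zero_add, h1]
    split_ifs <;> simp
  · simp only [lt_irrefl, if_true, if_false, diagonal_apply, rDiag, one_apply, ite_self, add_zero,
      smul_eq_mul]
    by_cases hab : a = b
    · subst hab
      by_cases hia : i = a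
      · subst hia
        simp only [if_true, and_self]
        linear_combination (-y) * hq
      · simp [hia]
    · have : ¬(i = a ∧ i = b) := fun h => hab (h.1.symm.trans h.2)
      simp [hab, this]
  · simp only [hik.ne', hik.le.not_gt, hik, if_true, if_false, Matrix.zero_apply, smul_eq_mul,
      mul_zero, zero_add, h1]
    split_ifs <;> ring

/-- Each Lax matrix is (1 - ux_s) times 1 + O(h). In a product of such factors the first order parts
add up modulo h, since (1 + hR₀)(1 + hR) = 1 + h(R₀ + R + hR₀R). -/
theorem exists_normalized_monodromy {F' : Type} [CommRing F'] (red : F →+* F') {h q' : F}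
    (hred : red h = 0) (hq : (1 + h) * q' = 1) (x : Fin d → F) (u : F) (g : Fin d → F)
    (hg : ∀ s, g s * (1 - u * x s) = 1) (l : List (Fin d)) :
    ∃ R : Matrix (Fin N) (Fin N) (TensorMat N d F),
      (∀ i k, (l.map g).prod • monodromy N (1 + h) q' x l u i k
        = (1 : Matrix (Fin N) (Fin N) (TensorMat N d F)) i k + h • R i k) ∧
      ∀ i k, (R i k).map red
        = (l.map fun s => leg s (single k i (red (g s * rNum q' (u * x s) i k)))).sum := by
  induction l with
  | nil => exact ⟨0, fun i k => by simp [monodromy], fun i k => by ext; simp⟩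
  | cons t l ih =>
    obtain ⟨R, hR, hR'⟩ := ih
    set R₀ : Matrix (Fin N) (Fin N) (TensorMat N d F) :=
      of fun i k => leg t (single k i (g t * rNum q' (u * x t) i k)) with hR₀
    have e1 : ∀ i k, g t • ((rLax N (1 + h) q' (u * x t) 1).map (legHom N F t)) i k
        = (1 : Matrix (Fin N) (Fin N) (TensorMat N d F)) i k + h • R₀ i k := by
      intro i k
      rw [Matrix.map_apply, rLax_eq hq, map_add]
      change g t • (leg t _ + leg t _) = _
      rw [leg_smul, leg_smul, smul_add, smul_smul, hg, one_smul, smul_comm, ← leg_smul, smul_single,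
        smul_eq_mul]
      congr 1
      rw [one_apply, one_apply]
      split_ifs
      · exact leg_one t
      · exact map_zero (legHom N F t)
    have e : monodromy N (1 + h) q' x (t :: l) u
        = (rLax N (1 + h) q' (u * x t) 1).map (legHom N F t) * monodromy N (1 + h) q' x l u := by
      simp [monodromy]
    refine ⟨R₀ + R + h • (R₀ * R), fun i k => ?_, fun i k => ?_⟩
    · rw [List.map_cons, List.prod_cons, e, Matrix.mul_apply, Finset.smul_sum]
      have : ∀ j, (g t * (l.map g).prod) • (((rLax N (1 + h) q' (u * x t) 1).map (legHom N F t)) i j *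
          monodromy N (1 + h) q' x l u j k)
          = ((1 : Matrix (Fin N) (Fin N) (TensorMat N d F)) + h • R₀) i j * (1 + h • R) j k := by
        intro j
        rw [← smul_mul_smul_comm, e1, hR]
        rfl
      rw [Finset.sum_congr rfl fun j _ => this j, ← Matrix.mul_apply]
      have h2 : ((1 : Matrix (Fin N) (Fin N) (TensorMat N d F)) + h • R₀) * (1 + h • R)
          = 1 + h • (R₀ + R + h • (R₀ * R)) := by
        rw [mul_add, mul_one, add_mul, one_mul, smul_mul_smul_comm, smul_add, smul_add, smul_smul]
        abel
      rw [h2]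
      rfl
    · rw [List.map_cons, List.sum_cons, ← hR']
      ext I J
      simp only [Matrix.add_apply, Matrix.smul_apply, Matrix.map_apply, map_add, smul_eq_mul,
        map_mul red h, hred, zero_mul, add_zero]
      congr 1
      simp only [hR₀, of_apply, leg, single_apply]
      split_ifs <;> simp

end Normalized

/-! ### Quantum difference operators and their first order parts -/

section Limit

variable {N d : ℕ} {K : Type} [CommRing K]

/-- Matrices over power series, on which quantum difference operators act. -/
abbrev SeriesMat (N d : ℕ) (K : Type) [CommRing K] : Type := TensorMat N d K⟦X⟧

/-- The substitution `u ↦ c u`. -/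
def dilation (N d : ℕ) (c : K) : Module.End K (SeriesMat N d K) where
  toFun b := b.map (rescale c)
  map_add' a b := by ext; simp
  map_smul' a b := by ext; simp; ring

/-- Coefficientwise multiplication by a sequence. -/
def coeffMul (N d : ℕ) (e : ℕ → K) : Module.End K (SeriesMat N d K) where
  toFun b := b.map fun f => PowerSeries.mk fun n => e n * coeff n f
  map_add' a b := by ext; simp [mul_add]
  map_smul' a b := by ext; simp; ring

/-- The sequence `(1 - q'^{2n})/h`. -/
def eSeq (q' : K) : ℕ → K
  | 0 => 0
  | n + 1 => q' * (1 + q') + q' ^ 2 * eSeq q' n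

theorem h_mul_eSeq {h q' : K} (hq : (1 + h) * q' = 1) (n : ℕ) : h * eSeq q' n = 1 - (q' ^ 2) ^ n := by
  induction n with
  | zero => simp [eSeq]
  | succ n ih =>
    rw [eSeq, mul_add, mul_left_comm h (q' ^ 2), ih, pow_succ]
    linear_combination (1 + q') * hq

theorem map_eSeq (π : K →+* ℂ) {q' : K} (hq : π q' = 1) (n : ℕ) : π (eSeq q' n) = 2 * n := by
  induction n with
  | zero => simp [eSeq]
  | succ n ih =>
    rw [eSeq, map_add, map_mul, map_mul, map_add, map_pow, hq, ih, map_one]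
    push_cast
    ring

theorem dilation_eq {h q' : K} (hq : (1 + h) * q' = 1) :
    1 - dilation N d (q' ^ 2) = h • coeffMul N d (eSeq q') := by
  ext b I J n
  simp only [LinearMap.sub_apply, Module.End.one_apply, LinearMap.smul_apply, dilation, coeffMul,
    LinearMap.coe_mk, AddHom.coe_mk, Matrix.sub_apply, Matrix.smul_apply, Matrix.map_apply, map_sub,
    coeff_rescale, coeff_smul, coeff_mk, smul_eq_mul]
  rw [← mul_assoc, h_mul_eSeq hq]
  ring

/-- The operator `c L δ`, with `δ` the substitution `u ↦ q'² u`. -/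
def diffLax (q' : K) (c : Fin N → K) (L : Matrix (Fin N) (Fin N) (SeriesMat N d K)) :
    Matrix (Fin N) (Fin N) (Module.End K (SeriesMat N d K)) :=
  of fun i k => c i • (Algebra.lmul K (SeriesMat N d K) (L i k) * dilation N d (q' ^ 2))

/-- The first order part of `1 - (1 - h c) (1 + h R) δ`. -/
def firstOrder (q' : K) (c : Fin N → K) (L R : Matrix (Fin N) (Fin N) (SeriesMat N d K)) :
    Matrix (Fin N) (Fin N) (Module.End K (SeriesMat N d K)) :=
  of fun i k => c i • (Algebra.lmul K (SeriesMat N d K) (L i k) * dilation N d (q' ^ 2))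
    - Algebra.lmul K (SeriesMat N d K) (R i k) * dilation N d (q' ^ 2)
    + if i = k then coeffMul N d (eSeq q') else 0

/-- Split off 1 - δ, which is h times the multiplication of the n-th coefficient by (1 - q'^{2n})/h,
a deformation of 2u∂_u. The remaining terms -hRδ and hcLδ deform -ℒ⁺ and the sign term. -/
theorem one_sub_diffLax {h q' : K} (hq : (1 + h) * q' = 1) (c : Fin N → K)
    (L R : Matrix (Fin N) (Fin N) (SeriesMat N d K))
    (hL : ∀ i k, L i k = (1 : Matrix (Fin N) (Fin N) (SeriesMat N d K)) i k + h • R i k) :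
    1 - diffLax q' (fun i => 1 - h * c i) L = h • firstOrder q' c L R := by
  refine Matrix.ext fun i k => ?_
  rw [Matrix.sub_apply, Matrix.smul_apply, diffLax, firstOrder, of_apply, of_apply, smul_add, smul_sub,
    smul_smul]
  have h4 : ∀ T : Module.End K (SeriesMat N d K), (1 - h * c i) • T = T - (h * c i) • T := fun T =>
    (_root_.sub_smul (1 : K) (h * c i) T).trans (by rw [one_smul])
  have h1 : h • (if i = k then coeffMul N d (eSeq q') else 0)
      = if i = k then 1 - dilation N d (q' ^ 2) else 0 := by
    rw [dilation_eq hq]; split_ifs <;> simp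
  have h2 : Algebra.lmul K (SeriesMat N d K) (L i k)
      = (if i = k then 1 else 0) + h • Algebra.lmul K (SeriesMat N d K) (R i k) := by
    rw [hL, map_add, map_smul, one_apply]
    split_ifs
    · rw [map_one]
    · rw [map_zero]
  have h3 : Algebra.lmul K (SeriesMat N d K) (L i k) * dilation N d (q' ^ 2)
      = (if i = k then dilation N d (q' ^ 2) else 0)
        + h • (Algebra.lmul K (SeriesMat N d K) (R i k) * dilation N d (q' ^ 2)) := by
    rw [h2, add_mul, smul_mul_assoc]
    split_ifs <;> simp
  rw [h1, h4, sub_sub_eq_add_sub, h3, one_apply]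
  split_ifs <;> abel

/-- Moving all dilations to the right shifts the arguments of the successive L's by q'² and collects
the scalar series in σ. That σ does not depend on j, i, a is essential: the sum over j is then a
multiple of a transfer matrix. -/
theorem diffLax_pow_apply (q q' : K) (x : Fin d → K) (l : List (Fin d)) (g f : K⟦X⟧)
    (k : ℕ) : ∃ σ : K⟦X⟧, ∀ j i a : Fin N,
      ((diffLax q' (fun i => qWt q q' i j)
        (of fun i k => g • monodromy N (C q) (C q') (C ∘ x) l (X : K⟦X⟧) i k) ^ k :
          Matrix (Fin N) (Fin N) (Module.End K (SeriesMat N d K))) i a) (f • 1)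
      = σ • stringProd (C q') (fun i => qWt (C q) (C q') i j) (monodromy N (C q) (C q') (C ∘ x) l)
        k (X : K⟦X⟧) i a := by
  induction k with
  | zero =>
    refine ⟨f, fun j i a => ?_⟩
    rw [pow_zero, stringProd, one_apply, one_apply]
    split_ifs <;> simp
  | succ k ih =>
    obtain ⟨σ, hσ⟩ := ih
    refine ⟨g * rescale (q' ^ 2) σ, fun j i a => ?_⟩
    rw [pow_succ', Matrix.mul_apply, LinearMap.sum_apply, stringProd, Matrix.mul_apply, Finset.smul_sum]
    refine Finset.sum_congr rfl fun b _ => ?_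
    have h1 : ∀ M : SeriesMat N d K, dilation N d (q' ^ 2) (σ • M)
        = rescale (q' ^ 2) σ • (rescale (q' ^ 2)).mapMatrix M := by
      intro M
      ext I J : 2
      simp [dilation]
    have h2 := congrArg (fun M : Matrix (Fin N) (Fin N) (SeriesMat N d K) => M b a)
      (stringProd_monodromy_map (N := N) (rescale (q' ^ 2)) (C q) (C q') (C ∘ x) l j k (X : K⟦X⟧))
    have hC : ∀ c : K, rescale (q' ^ 2) (C c) = C c := fun c => by
      ext n; rw [coeff_rescale, coeff_C]; split_ifs with hn <;> simp [hn]
    have hCx : (rescale (q' ^ 2)) ∘ C ∘ x = C ∘ x := funext fun s => hC _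
    have hX : rescale (q' ^ 2) (X : K⟦X⟧) = X * C q' ^ 2 := by
      rw [rescale_X, map_pow, mul_comm]
    simp only [hC, hCx, hX] at h2
    rw [Module.End.mul_apply, hσ, diffLax, of_apply, LinearMap.smul_apply, Module.End.mul_apply, h1]
    rw [RingHom.mapMatrix_apply, Matrix.map_apply] at h2
    have h5 : ∀ A B : SeriesMat N d K, Algebra.lmul K (SeriesMat N d K) A B = A * B :=
      fun _ _ => rfl
    rw [h2, of_apply, h5, smul_mul_smul_comm, RingHom.mapMatrix_apply, diagonal_map (map_zero _), diagonal_mul,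
      mul_assoc, ← Algebra.smul_def, smul_comm]
    congr 1
    have hw : qWt (C q) (C q') i j = C (qWt q q' i j) := by unfold qWt; split_ifs <;> simp
    rw [hw]
    ext I J : 2
    simp [PowerSeries.smul_eq_C_mul]

end Limit

/-! ### Coefficients in a fixed subalgebra -/

section CoeffSubmodule

variable {N d : ℕ} {K : Type} [CommRing K]

/-- The matrices of power series all of whose coefficients lie in a given subalgebra. -/
def coeffSubmodule (𝒜 : Subalgebra K (TensorMat N d K)) : Submodule K⟦X⟧ (SeriesMat N d K) where
  carrier := {b | ∀ n, b.map (coeff n) ∈ 𝒜}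
  zero_mem' n := by
    convert 𝒜.zero_mem using 1
    ext; simp
  add_mem' {a b} ha hb n := by
    convert 𝒜.add_mem (ha n) (hb n) using 1
    ext; simp
  smul_mem' f b hb n := by
    have : (f • b).map (coeff n) = ∑ p ∈ Finset.HasAntidiagonal.antidiagonal n,
        coeff p.1 f • b.map (coeff p.2) := by
      ext I J
      simp [coeff_mul, Matrix.sum_apply]
    change (f • b).map (coeff n) ∈ 𝒜
    rw [this]
    exact 𝒜.sum_mem fun p _ => 𝒜.smul_mem (hb p.2) _

theorem one_mem_coeffSubmodule (𝒜 : Subalgebra K (TensorMat N d K)) : 1 ∈ coeffSubmodule 𝒜 := by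
  intro n
  by_cases hn : n = 0
  · convert 𝒜.one_mem using 1
    ext I J
    simp only [Matrix.map_apply, one_apply]
    split_ifs <;> simp [hn]
  · convert 𝒜.zero_mem using 1
    ext I J
    simp only [Matrix.map_apply, one_apply]
    split_ifs <;> simp [coeff_one, hn]

theorem transfer_mem_coeffSubmodule (𝒜 : Subalgebra K (TensorMat N d K)) (q q' : K)
    (x : Fin d → K) (l : List (Fin d))
    (h𝒜 : ∀ k a, 1 ≤ k → ((transfer N (Polynomial.C q) (Polynomial.C q') (Polynomial.C ∘ x) l k
        (Polynomial.X : Polynomial K)).map fun p => p.coeff a) ∈ 𝒜) (k : ℕ) :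
    transfer N (C q) (C q') (C ∘ x) l k (X : K⟦X⟧) ∈ coeffSubmodule 𝒜 := by
  rcases Nat.eq_zero_or_pos k with rfl | hk
  · unfold transfer
    refine Submodule.sum_mem _ fun j _ => ?_
    rw [stringProd, one_apply_eq]
    exact one_mem_coeffSubmodule 𝒜
  · intro n
    have h := transfer_map (N := N) (Polynomial.coeToPowerSeries.ringHom (R := K)) (Polynomial.C q)
      (Polynomial.C q') (Polynomial.C ∘ x) l k Polynomial.X
    have hx : ⇑(Polynomial.coeToPowerSeries.ringHom (R := K)) ∘ Polynomial.C ∘ x = C ∘ x :=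
      funext fun s => by simp
    rw [hx] at h
    simp only [Polynomial.coeToPowerSeries.ringHom_apply, Polynomial.coe_C, Polynomial.coe_X] at h
    rw [← h]
    convert h𝒜 k n hk using 1
    ext I J
    simp

/-- Binomial expansion: each power of c_j L δ, applied to a scalar series and summed over j on the
diagonal, is a scalar series times a transfer matrix. -/
theorem sum_one_sub_pow_mem_coeffSubmodule (𝒜 : Subalgebra K (TensorMat N d K)) (q q' : K)
    (x : Fin d → K) (l : List (Fin d))
    (h𝒜 : ∀ k a, 1 ≤ k → ((transfer N (Polynomial.C q) (Polynomial.C q') (Polynomial.C ∘ x) l k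
        (Polynomial.X : Polynomial K)).map fun p => p.coeff a) ∈ 𝒜) (g f : K⟦X⟧) (m : ℕ) :
    ∑ j, (((1 - diffLax q' (fun i => qWt q q' i j)
        (of fun i k => g • monodromy N (C q) (C q') (C ∘ x) l (X : K⟦X⟧) i k)) ^ m :
          Matrix (Fin N) (Fin N) (Module.End K (SeriesMat N d K))) j j) (f • 1)
      ∈ coeffSubmodule 𝒜 := by
  set A := fun j => diffLax q' (fun i => qWt q q' i j)
        (of fun i k => g • monodromy N (C q) (C q') (C ∘ x) l (X : K⟦X⟧) i k)
  have hA : ∀ k, ∑ j, ((A j ^ k : Matrix (Fin N) (Fin N) (Module.End K (SeriesMat N d K))) j j) (f • 1)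
      ∈ coeffSubmodule 𝒜 := by
    intro k
    obtain ⟨σ, hσ⟩ := diffLax_pow_apply (N := N) q q' x l g f k
    rw [Finset.sum_congr rfl fun j _ => hσ j j j, ← Finset.smul_sum]
    exact Submodule.smul_mem _ _ (transfer_mem_coeffSubmodule 𝒜 q q' x l h𝒜 k)
  have h1 : ∀ j, ((1 - A j) ^ m : Matrix (Fin N) (Fin N) (Module.End K (SeriesMat N d K)))
      = ∑ k ∈ Finset.range (m + 1), (((-1) ^ (m - k) * (m.choose k : ℤ)) • A j ^ (m - k)) := by
    intro j
    rw [sub_eq_add_neg, (Commute.one_left (-A j)).add_pow]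
    refine Finset.sum_congr rfl fun k _ => ?_
    rw [one_pow, one_mul, neg_pow (A j) (m - k), zsmul_eq_mul]
    push_cast
    rw [mul_assoc, mul_assoc, (Nat.cast_commute (m.choose k) (A j ^ (m - k))).eq]
  have h2 : ∀ j, (((1 - A j) ^ m : Matrix (Fin N) (Fin N) (Module.End K (SeriesMat N d K))) j j) (f • 1)
      = ∑ k ∈ Finset.range (m + 1), (((-1) ^ (m - k) * (m.choose k : ℤ)) •
        ((A j ^ (m - k) : Matrix (Fin N) (Fin N) (Module.End K (SeriesMat N d K))) j j) (f • 1)) := by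
    intro j
    rw [h1, Matrix.sum_apply, LinearMap.sum_apply]
    rfl
  rw [Finset.sum_congr rfl fun j _ => h2 j, Finset.sum_comm]
  refine Submodule.sum_mem _ fun k _ => ?_
  rw [← Finset.smul_sum]
  exact zsmul_mem (hA _) _

end CoeffSubmodule

/-! ### Operators compatible with maps to a common target -/

section Intertwines

variable {M₁ M₂ M₃ : Type} [AddCommGroup M₁] [AddCommGroup M₂] [AddCommGroup M₃]
  {k₁ k₂ : Type} [CommRing k₁] [CommRing k₂] [Module k₁ M₁] [Module k₂ M₂] {N : ℕ}

/-- Two operators are compatible with the maps `r` and `s` to a common target. -/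
def Intertwines (r : M₁ →+ M₃) (s : M₂ →+ M₃) (φ : Module.End k₁ M₁) (ψ : Module.End k₂ M₂) : Prop :=
  ∀ a b, r a = s b → r (φ a) = s (ψ b)

theorem Intertwines.matrix_pow {r : M₁ →+ M₃} {s : M₂ →+ M₃}
    {P : Matrix (Fin N) (Fin N) (Module.End k₁ M₁)} {Q : Matrix (Fin N) (Fin N) (Module.End k₂ M₂)}
    (h : ∀ i j, Intertwines r s (P i j) (Q i j)) (m : ℕ) (i j : Fin N) :
    Intertwines r s ((P ^ m) i j) ((Q ^ m) i j) := by
  induction m generalizing i with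
  | zero =>
    intro a b hab
    rw [pow_zero, pow_zero, one_apply, one_apply]
    split_ifs
    · exact hab
    · simp
  | succ m ih =>
    intro a b hab
    rw [pow_succ', pow_succ', Matrix.mul_apply, Matrix.mul_apply, LinearMap.sum_apply,
      LinearMap.sum_apply, map_sum, map_sum]
    exact Finset.sum_congr rfl fun k _ => h i k _ _ (ih k a b hab)

end Intertwines

/-! ### Reduction modulo h and commutativity in representations -/

section ClassicalLimit

variable {N d : ℕ} {K : Type} [CommRing K]

theorem map_geom_mul_rNum (π : K →+* ℂ) {q' : K} (hq' : π q' = 1) (x : K) (i k : Fin N) :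
    PowerSeries.map π ((PowerSeries.mk fun n => x ^ n) * rNum (C q') (X * C x) i k)
      = rCoef (π x) i k := by
  have h1 : PowerSeries.map π (PowerSeries.mk fun n => x ^ n) = PowerSeries.mk fun n => π x ^ n := by
    ext n; simp
  rw [map_mul, h1]
  unfold rNum
  rcases lt_trichotomy i k with hik | rfl | hik
  · have : sgn i k = 1 := Int.sign_eq_one_of_pos (by have : (i : ℕ) < k := hik; omega)
    rw [if_pos hik, map_add, map_one, map_C, hq', map_one, mul_comm]
    ext n
    rw [add_mul, one_mul, map_add]
    simp only [coeff_mk, rCoef, this]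
    split_ifs <;> push_cast <;> ring
  · rw [if_neg (lt_irrefl _), if_neg (lt_irrefl _)]
    have : sgn i i = 0 := by simp [sgn]
    rw [map_add, map_mul, map_mul, map_one, map_C, hq', map_one, one_mul, map_X, map_C, mul_add,
      mul_one, ← mul_assoc]
    ext n
    rw [map_add, coeff_mul_C]
    rcases n with _ | n
    · simp [rCoef, this]
    · rw [coeff_succ_mul_X]
      simp [rCoef]
      ring
  · have : sgn i k = -1 := Int.sign_eq_neg_one_of_neg (by have : (k : ℕ) < i := hik; omega)
    rw [if_neg hik.le.not_gt, if_pos hik]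
    rw [map_mul, map_mul, map_add, map_one, map_C, hq', map_one, map_X, map_C, one_add_one_eq_two,
      mul_left_comm, ← mul_assoc (PowerSeries.mk _), two_mul]
    ext n
    rw [map_add, coeff_mul_C]
    rcases n with _ | n
    · simp [rCoef, this]
    · rw [coeff_succ_mul_X]
      simp [rCoef]
      ring

/-- At h = 0 the dilation is trivial, L is the identity, (1 - q'^{2n})/h becomes 2n and R becomes
the image of ℒ⁺. So the quantum operator and ℒ plus the diagonal sign matrix agree after reduction.
-/
theorem intertwines_firstOrder (π : K →+* ℂ) {q' : K} (hq' : π q' = 1) (x : Fin d → ℂ)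
    (S : Finset (Fin d)) (j : Fin N) (c : Fin N → K) (hc : ∀ i, π (c i) = sgn i j)
    (L R : Matrix (Fin N) (Fin N) (SeriesMat N d K))
    (hL : ∀ i k, (L i k).map (PowerSeries.map π) = (1 : Matrix (Fin N) (Fin N) (TensorMat N d ℂ⟦X⟧)) i k)
    (hR : ∀ i k, (R i k).map (PowerSeries.map π)
      = ∑ s ∈ S, leg s (single k i (rCoef (x s) i k))) (i k : Fin N) :
    Intertwines (seriesRep (uRep (N := N) x S).toRingHom).toAddMonoidHom
      (PowerSeries.map π).mapMatrix.toAddMonoidHom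
      ((lOp N + sgnDiag (OpAlg N) j) i k) (firstOrder q' c L R i k) := by
  intro a b hab
  set r := seriesRep (uRep (N := N) x S).toRingHom
  set ρ := uRep (N := N) x S
  set red : SeriesMat N d K →+* TensorMat N d ℂ⟦X⟧ := (PowerSeries.map π).mapMatrix with hred
  change r a = red b at hab
  change r _ = red _
  have hδ : red (dilation N d (q' ^ 2) b) = red b := by
    ext I J n
    simp [hred, dilation, hq']
  have hL' : red (L i k) = (1 : Matrix (Fin N) (Fin N) (TensorMat N d ℂ⟦X⟧)) i k := hL i k
  have hR' : red (R i k) = r (lPlus N i k) := by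
    rw [seriesRep_lPlus]; exact hR i k
  have hsm : ∀ (t : K) (y : SeriesMat N d K), red (t • y) = π t • red y := by
    intro t y
    ext I J n
    simp [hred]
  have hsm' : ∀ (t : ℂ) (f : (UPlus N)⟦X⟧), r (t • f) = t • r f := by
    intro t f
    ext I J n
    rw [coeff_seriesRep, coeff_smul, Matrix.smul_apply, coeff_smul, coeff_seriesRep]
    exact congrFun (congrFun (map_smul ρ t (coeff n f)) I) J
  have he : r ((2 * mulOp N X * du N) a) = red (coeffMul N d (eSeq q') b) := by
    ext I J n
    rw [coeff_seriesRep, coeff_two_mul_X_du]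
    change ρ _ I J = _
    rw [map_smul, Matrix.smul_apply]
    have h1 : ρ (coeff n a) I J = π (coeff n (b I J)) := by
      have := congrArg (fun M : TensorMat N d ℂ⟦X⟧ => coeff n (M I J)) hab
      simpa [hred, r, coeff_seriesRep] using this
    rw [h1]
    simp [hred, coeffMul, map_eSeq π hq']
  have e1 : (lOp N + sgnDiag (OpAlg N) j) i k a
      = (if i = k then (2 * mulOp N X * du N) a else 0) - lPlus N i k * a
        + if i = k then (sgn i j : ℂ) • a else 0 := by
    rw [lOp, sgnDiag, Matrix.add_apply, Matrix.sub_apply, diagonal_apply, diagonal_apply,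
      LinearMap.add_apply, LinearMap.sub_apply, Matrix.map_apply, mulOp_apply]
    split_ifs
    · rfl
    · simp
  have e2 : firstOrder q' c L R i k b = c i • (L i k * dilation N d (q' ^ 2) b)
      - R i k * dilation N d (q' ^ 2) b + if i = k then coeffMul N d (eSeq q') b else 0 := by
    rw [firstOrder, of_apply, LinearMap.add_apply, LinearMap.sub_apply]
    split_ifs <;> rfl
  rw [e1, e2, map_add, map_sub, map_add, map_sub, hsm, map_mul, map_mul, map_mul, hδ, hR', hL', hab,
    one_apply]
  split_ifs
  · rw [hsm', hab, he, hc, one_mul]; abel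
  · simp

/-- The elements h^m y_m, with y_m a deformation of the image of θ_m(u^p), lie in the algebra
generated by the commuting transfer coefficients. As h is not a zero divisor, the y_m commute before
reduction as well. -/
theorem commute_map_coeff [IsDomain K] [CharZero K] {h q' : K} (π : K →+* ℂ) (hπ : π h = 0)
    (hh : h ≠ 0) (hq : (1 + h) * q' = 1) (x : Fin d → K) (S : Finset (Fin d)) {m m' : ℕ} (hm : 1 ≤ m)
    (hm' : 1 ≤ m') (p p' n n' : ℕ) :
    Commute (uRep (π ∘ x) S (coeff n (theta N m (X ^ p))))
      (uRep (π ∘ x) S (coeff n' (theta N m' (X ^ p')))) := by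
  have hq' : π q' = 1 := by simpa [hπ] using congrArg π hq
  set l := S.toList
  have hl : l.Nodup := S.nodup_toList
  have hCq : (1 + C h) * C q' = (1 : K⟦X⟧) := by rw [← map_one (C (R := K)), ← map_add, ← map_mul, hq]
  have hg : ∀ s, (PowerSeries.mk fun n => x s ^ n) * (1 - X * (C ∘ x) s) = (1 : K⟦X⟧) := by
    intro s
    ext n
    rw [mul_sub, mul_one, ← mul_assoc, Function.comp_apply, map_sub, coeff_mul_C]
    rcases n with _ | n
    · simp
    · rw [coeff_succ_mul_X]; simp [coeff_one, pow_succ]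
  obtain ⟨R, hLR, hR⟩ := exists_normalized_monodromy (N := N) (PowerSeries.map π) (h := C h)
    (q' := C q') (by simp [hπ]) hCq (C ∘ x) X _ hg l
  set G := (l.map fun s => (PowerSeries.mk fun n => x s ^ n : K⟦X⟧)).prod
  have hq1 : (1 + C h : K⟦X⟧) = C (1 + h) := by simp
  rw [hq1] at hLR
  set L : Matrix (Fin N) (Fin N) (SeriesMat N d K) :=
    of fun i k => G • monodromy N (C (1 + h)) (C q') (C ∘ x) l (X : K⟦X⟧) i k with hL
  have hL1 : ∀ i k, L i k = (1 : Matrix (Fin N) (Fin N) (SeriesMat N d K)) i k + h • R i k := by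
    intro i k
    rw [hL, of_apply, hLR]
    congr 1
    ext I J : 2
    simp [PowerSeries.smul_eq_C_mul]
  -- The solution of 1 - hc = q^{-sgn(j-i)}: from (1 + h)q' = 1 one gets 1 - hq' = q', and 1 -
  -- h·(-1) = 1 + h.
  set c : Fin N → Fin N → K := fun i j => if i < j then q' else if j < i then -1 else 0 with hc
  have hc1 : ∀ i j : Fin N, qWt (1 + h) q' i j = 1 - h * c i j := by
    intro i j
    simp only [qWt, hc]
    split_ifs
    · linear_combination hq
    · ring
    · ring
  have hc2 : ∀ i j : Fin N, π (c i j) = sgn i j := by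
    intro i j
    simp only [hc, sgn]
    rcases lt_trichotomy i j with hij | rfl | hij
    · rw [if_pos hij, hq', Int.sign_eq_one_of_pos (by have : (i : ℕ) < j := hij; omega)]
      simp
    · simp
    · rw [if_neg hij.le.not_gt, if_pos hij,
        Int.sign_eq_neg_one_of_neg (by have : (j : ℕ) < i := hij; omega)]
      simp
  set Q := fun j : Fin N => firstOrder q' (fun i => c i j) L R with hQ
  set y : ℕ → ℕ → SeriesMat N d K := fun m p =>
    ∑ j, ((Q j ^ m : Matrix (Fin N) (Fin N) (Module.End K (SeriesMat N d K))) j j)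
      ((X ^ p : K⟦X⟧) • 1) with hy
  -- the deformation of the image of `θ_m (u^p)`
  have hred : ∀ m p n, 1 ≤ m → uRep (π ∘ x) S (coeff n (theta N m (X ^ p)))
      = π.mapMatrix ((y m p).map (coeff n)) := by
    intro m p n hm
    have hint : ∀ j, _ := fun j => Intertwines.matrix_pow (fun i k =>
      intertwines_firstOrder π hq' (π ∘ x) S j (fun i => c i j) (fun i => hc2 i j) L R ?_ ?_ i k) m j j
    · have h1 : seriesRep (uRep (N := N) (π ∘ x) S).toRingHom (theta N m (X ^ p))
          = (PowerSeries.map π).mapMatrix (y m p) := by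
        rw [theta_eq m hm, LinearMap.sum_apply, map_sum, hy, map_sum]
        refine Finset.sum_congr rfl fun j _ => hint j _ _ ?_
        change seriesRep (uRep (N := N) (π ∘ x) S).toRingHom (X ^ p)
          = (PowerSeries.map π).mapMatrix ((X ^ p : K⟦X⟧) • 1)
        ext I J n
        rw [coeff_seriesRep, coeff_X_pow]
        simp only [RingHom.mapMatrix_apply, Matrix.map_apply, Matrix.smul_apply, one_apply, coeff_map,
          smul_eq_mul, mul_ite, mul_one, mul_zero]
        by_cases hn : n = p <;> by_cases hIJ : I = J <;> simp [hn, hIJ, coeff_X_pow]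
      have h2 := congrArg (fun M : TensorMat N d ℂ⟦X⟧ => M.map (coeff n)) h1
      simp only [seriesRep_map_coeff] at h2
      refine Eq.trans h2 ?_
      ext I J
      simp
    · intro i k
      rw [hL1]
      ext I J n
      simp only [Matrix.map_apply, Matrix.add_apply, Matrix.smul_apply, map_add, coeff_map, coeff_smul,
        smul_eq_mul, map_mul, hπ, zero_mul, add_zero, one_apply]
      split_ifs <;> simp [one_apply]
      split_ifs <;> simp
    · intro i k
      rw [hR]
      simp only [Function.comp_apply, map_geom_mul_rNum π hq']
      exact Finset.sum_map_toList S _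
  have hmem : ∀ (𝒜 : Subalgebra K (TensorMat N d K)),
      (∀ k a, 1 ≤ k → ((transfer N (Polynomial.C (1 + h)) (Polynomial.C q') (Polynomial.C ∘ x) l k
        (Polynomial.X : Polynomial K)).map fun p => p.coeff a) ∈ 𝒜) →
      ∀ m p n, h ^ m • (y m p).map (coeff n) ∈ 𝒜 := by
    intro 𝒜 h𝒜 m p n
    have := sum_one_sub_pow_mem_coeffSubmodule 𝒜 (1 + h) q' x l h𝒜 G (X ^ p) m n
    convert this using 1
    have e : ∀ j, 1 - diffLax q' (fun i => qWt (1 + h) q' i j) L = h • Q j := by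
      intro j
      rw [← one_sub_diffLax hq _ L R hL1]
      simp only [hc1]
    rw [← hL]
    simp only [e, smul_pow, hy]
    ext I J
    simp only [Matrix.smul_apply, LinearMap.smul_apply, Matrix.map_apply, Matrix.sum_apply, map_sum,
      Finset.smul_sum, coeff_smul]
  have h2 : (1 + h) ^ 2 ≠ 1 := by
    intro h0
    have h1 : h * (2 + h) = 0 := by linear_combination h0
    rcases mul_eq_zero.mp h1 with h1 | h1
    · exact hh h1
    · have := congrArg π h1
      rw [map_add, hπ, add_zero, map_ofNat, map_zero] at this
      exact two_ne_zero this
  have hcomm : Commute (h ^ m • (y m p).map (coeff n)) (h ^ m' • (y m' p').map (coeff n')) := by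
    -- Membership is applied twice with centralizers as the subalgebra: first that of a transfer
    -- coefficient, then that of h^m y_m.
    have h1 : ∀ k a, 1 ≤ k → ∀ m p n, Commute ((transfer N (Polynomial.C (1 + h)) (Polynomial.C q')
        (Polynomial.C ∘ x) l k (Polynomial.X : Polynomial K)).map fun p => p.coeff a)
        (h ^ m • (y m p).map (coeff n)) := by
      intro k a hk m p n
      have := hmem (Subalgebra.centralizer K {(transfer N (Polynomial.C (1 + h)) (Polynomial.C q')
        (Polynomial.C ∘ x) l k (Polynomial.X : Polynomial K)).map fun p => p.coeff a})
        (fun k' a' hk' => ?_) m p n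
      · exact (Subalgebra.mem_centralizer_iff K).mp this _ rfl
      · rw [Subalgebra.mem_centralizer_iff]
        rintro _ rfl
        exact commute_coeff_transfer hq h2 x hl hk hk' a a'
    have := hmem (Subalgebra.centralizer K {h ^ m • (y m p).map (coeff n)})
      (fun k' a' hk' => ?_) m' p' n'
    · exact (Subalgebra.mem_centralizer_iff K).mp this _ rfl
    · rw [Subalgebra.mem_centralizer_iff]
      rintro _ rfl
      exact (h1 k' a' hk' m p n).symm
  have hcomm' : Commute ((y m p).map (coeff n)) ((y m' p').map (coeff n')) := by
    have h1 := hcomm.eq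
    rw [smul_mul_smul_comm, smul_mul_smul_comm, mul_comm (h ^ m')] at h1
    refine Matrix.ext fun I J => ?_
    have h2 := congrFun (congrFun h1 I) J
    rw [Matrix.smul_apply, Matrix.smul_apply, smul_eq_mul, smul_eq_mul] at h2
    exact mul_left_cancel₀ (mul_ne_zero (pow_ne_zero _ hh) (pow_ne_zero _ hh)) h2
  rw [hred m p n hm, hred m' p' n' hm']
  exact hcomm'.map _

theorem commute_uRep_theta (x : Fin d → ℂ) (S : Finset (Fin d)) {m m' : ℕ} (hm : 1 ≤ m)
    (hm' : 1 ≤ m') (p p' n n' : ℕ) :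
    Commute (uRep x S (coeff n (theta N m (X ^ p)))) (uRep x S (coeff n' (theta N m' (X ^ p')))) := by
  have : CharZero ℂ⟦X⟧ := charZero_of_injective_ringHom (C_injective (R := ℂ))
  -- The generic deformation: K = ℂ⟦h⟧ with q = 1 + h, reduced by the constant coefficient.
  have h := commute_map_coeff (N := N) (K := ℂ⟦X⟧) (h := X) (q' := (1 + X)⁻¹)
    constantCoeff (by simp) X_ne_zero (PowerSeries.mul_inv_cancel _ (by simp)) (C ∘ x) S hm hm' p p' n n'
  have hx : ⇑(constantCoeff (R := ℂ)) ∘ C ∘ x = x := funext fun s => by simp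
  rwa [hx] at h

end ClassicalLimit

/-! ### The degree filtration of the enveloping algebra -/

section Filtration

variable {N : ℕ}

local notation "ιU" => UniversalEnvelopingAlgebra.ι ℂ (L := gPlus N)

theorem one_mem_degreeLE (m : ℕ) : (1 : UPlus N) ∈ degreeLE N m := by
  induction m with
  | zero => rw [degreeLE, pow_zero]; exact (Submodule.one_le.mp le_rfl)
  | succ m ih =>
    rw [degreeLE, pow_succ, ← mul_one (1 : UPlus N)]
    exact Submodule.mul_mem_mul ih (le_sup_left (α := Submodule ℂ (UPlus N)) (Submodule.one_le.mp le_rfl))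

theorem degreeLE_le_succ (m : ℕ) : degreeLE N m ≤ degreeLE N (m + 1) := by
  intro w hw
  rw [degreeLE, pow_succ, ← mul_one w]
  exact Submodule.mul_mem_mul hw (le_sup_left (α := Submodule ℂ (UPlus N)) (Submodule.one_le.mp le_rfl))

theorem degreeLE_mono {m m' : ℕ} (h : m ≤ m') : degreeLE N m ≤ degreeLE N m' :=
  monotone_nat_of_le_succ degreeLE_le_succ h

theorem mul_mem_degreeLE {m m' : ℕ} {a b : UPlus N} (ha : a ∈ degreeLE N m) (hb : b ∈ degreeLE N m') :
    a * b ∈ degreeLE N (m + m') := by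
  rw [degreeLE, pow_add]
  exact Submodule.mul_mem_mul ha hb

theorem ι_mem_degreeLE (g : gPlus N) : ιU g ∈ degreeLE N 1 := by
  rw [degreeLE, pow_one]
  exact le_sup_right (α := Submodule ℂ (UPlus N)) ⟨g, rfl⟩

theorem prod_mem_degreeLE (l : List (gPlus N)) : (l.map ιU).prod ∈ degreeLE N l.length := by
  induction l with
  | nil => exact one_mem_degreeLE 0
  | cons g l ih =>
    rw [List.map_cons, List.prod_cons, List.length_cons, add_comm]
    exact mul_mem_degreeLE (ι_mem_degreeLE g) ih

/-- An adjacent exchange replaces two factors by their bracket, which is a single factor; longer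
permutations follow by transitivity. -/
theorem prod_sub_prod_mem_degreeLE {l l' : List (gPlus N)} (h : l.Perm l') :
    (l.map ιU).prod - (l'.map ιU).prod ∈ degreeLE N (l.length - 1) := by
  induction h with
  | nil => simp
  | @cons x l l' h ih =>
    rcases l with _ | ⟨y, l⟩
    · have := h.nil_eq; subst this; simp
    · simp only [List.map_cons, List.prod_cons, List.length_cons, Nat.add_sub_cancel] at ih ⊢
      rw [← mul_sub, add_comm]
      exact mul_mem_degreeLE (ι_mem_degreeLE x) ih
  | swap x y l =>
    simp only [List.map_cons, List.prod_cons, List.length_cons, Nat.add_sub_cancel]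
    rw [← mul_assoc, ← mul_assoc, ← sub_mul, ← LieRing.of_associative_ring_bracket, ← LieHom.map_lie,
      add_comm]
    exact mul_mem_degreeLE (ι_mem_degreeLE _) (prod_mem_degreeLE l)
  | trans h1 h2 ih1 ih2 =>
    rw [← sub_add_sub_cancel]
    refine add_mem ih1 ?_
    rwa [← h1.length_eq] at ih2

/-- The spanning vectors `ℒ⁺_{ij}[n]` of the Lie algebra. -/
def genElem (t : Fin N × Fin N × ℕ) : gPlus N := lPlusElem N t.1 t.2.1 t.2.2

/-- The scalar in the definition of `lPlusElem`, up to sign. -/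
def genCoef (t : Fin N × Fin N × ℕ) : ℂ := if t.2.2 = 0 then 1 + (sgn t.1 t.2.1 : ℂ) else 2

theorem genElem_coe (t : Fin N × Fin N × ℕ) :
    (genElem t : Matrix (Fin N) (Fin N) (Polynomial ℂ))
      = single t.1 t.2.1 (Polynomial.monomial t.2.2 (-genCoef t)) := by
  unfold genElem lPlusElem genCoef
  simp only
  split_ifs <;> rfl

theorem genElem_eq_zero {t : Fin N × Fin N × ℕ} (h : genCoef t = 0) : genElem t = 0 := by
  refine Subtype.ext ?_
  rw [genElem_coe, h]
  simp

theorem span_genElem : Submodule.span ℂ (Set.range (genElem (N := N))) = ⊤ := by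
  refine eq_top_iff.mpr fun A _ => ?_
  have h : A = ∑ i, ∑ j, ∑ n ∈ ((A : Matrix (Fin N) (Fin N) (Polynomial ℂ)) i j).support,
      (-((A : Matrix (Fin N) (Fin N) (Polynomial ℂ)) i j).coeff n / genCoef (i, j, n)) •
        genElem (i, j, n) := by
    refine Subtype.ext ?_
    have h1 := matrix_eq_sum_single (A : Matrix (Fin N) (Fin N) (Polynomial ℂ))
    refine h1.trans ?_
    have hc : ∀ (s : Finset (Fin N)) (f : Fin N → gPlus N),
        ((∑ i ∈ s, f i : gPlus N) : Matrix (Fin N) (Fin N) (Polynomial ℂ)) = ∑ i ∈ s, (f i : Matrix _ _ _) :=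
      fun s f => map_sum (gPlus N).toSubmodule.subtype f s
    have hc' : ∀ (s : Finset ℕ) (f : ℕ → gPlus N),
        ((∑ i ∈ s, f i : gPlus N) : Matrix (Fin N) (Fin N) (Polynomial ℂ)) = ∑ i ∈ s, (f i : Matrix _ _ _) :=
      fun s f => map_sum (gPlus N).toSubmodule.subtype f s
    rw [hc]
    refine Finset.sum_congr rfl fun i _ => ?_
    rw [hc]
    refine Finset.sum_congr rfl fun j _ => ?_
    rw [hc']
    set p := (A : Matrix (Fin N) (Fin N) (Polynomial ℂ)) i j with hp
    have h2 : single i j p = ∑ n ∈ p.support,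
        (single i j (Polynomial.monomial n (p.coeff n)) : Matrix (Fin N) (Fin N) (Polynomial ℂ)) := by
      conv_lhs => rw [p.as_sum_support]
      exact map_sum (Matrix.singleAddMonoidHom i j) _ _
    rw [h2]
    refine Finset.sum_congr rfl fun n hn => ?_
    change _ = (_ : ℂ) • (genElem (i, j, n) : Matrix (Fin N) (Fin N) (Polynomial ℂ))
    rw [genElem_coe, smul_single, Polynomial.smul_monomial, smul_eq_mul]
    congr 2
    -- The scalar vanishes only for n = 0 and i > j, exactly where membership in the subalgebra
    -- makes the coefficient of A zero.
    have hk : genCoef (i, j, n) ≠ 0 := by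
      intro h0
      unfold genCoef at h0
      simp only at h0
      split_ifs at h0 with hn0
      · subst hn0
        have hji : j < i := by
          by_contra hji
          have : (i : ℕ) ≤ j := not_lt.mp hji
          have h3 : (0 : ℤ) ≤ sgn i j := Int.sign_nonneg_iff.mpr (by omega)
          have h4 : (1 + sgn i j : ℤ) = 0 := by exact_mod_cast h0
          omega
        exact (Polynomial.mem_support_iff.mp hn) (A.2 i j hji)
      · exact two_ne_zero h0
    field_simp
  rw [h]
  exact Submodule.sum_mem _ fun i _ => Submodule.sum_mem _ fun j _ => Submodule.sum_mem _ fun n _ =>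
    Submodule.smul_mem _ _ (Submodule.subset_span ⟨_, rfl⟩)

/-- The product of the generators in a list. -/
def word (l : List (Fin N × Fin N × ℕ)) : UPlus N := (l.map fun t => ιU (genElem t)).prod

theorem degreeLE_eq_span (m : ℕ) :
    degreeLE N m = Submodule.span ℂ {w | ∃ l : List (Fin N × Fin N × ℕ), l.length ≤ m ∧ w = word l} := by
  refine le_antisymm ?_ ?_
  · have hone : (1 ⊔ LinearMap.range (ιU).toLinearMap : Submodule ℂ (UPlus N))
        ≤ Submodule.span ℂ (insert 1 (Set.range fun t => ιU (genElem t))) := by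
      refine sup_le ?_ ?_
      · rw [Submodule.one_eq_span]
        exact Submodule.span_mono (by simp)
      · rw [LinearMap.range_eq_map, ← span_genElem, Submodule.map_span, ← Set.range_comp]
        exact Submodule.span_mono (Set.subset_insert _ _)
    induction m with
    | zero =>
      rw [degreeLE, pow_zero, Submodule.one_eq_span]
      refine Submodule.span_mono ?_
      rintro _ rfl
      exact ⟨[], le_rfl, rfl⟩
    | succ m ih =>
      rw [degreeLE, pow_succ']
      refine (mul_le_mul' hone ih).trans ?_
      rw [Submodule.span_mul_span]
      refine Submodule.span_mono ?_
      rintro _ ⟨a, ha, _, ⟨l, hl, rfl⟩, rfl⟩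
      rcases ha with rfl | ⟨t, rfl⟩
      · exact ⟨l, by omega, by simp⟩
      · exact ⟨t :: l, by simpa using hl, by simp [word]⟩
  · refine Submodule.span_le.mpr ?_
    rintro _ ⟨l, hl, rfl⟩
    have := prod_mem_degreeLE (l.map genElem)
    rw [List.map_map, List.length_map] at this
    exact degreeLE_mono hl this

theorem exists_mem_degreeLE (w : UPlus N) : ∃ m, w ∈ degreeLE N m := by
  obtain ⟨a, rfl⟩ : ∃ a, UniversalEnvelopingAlgebra.mkAlgHom ℂ (gPlus N) a = w :=
    RingCon.mkₐ_surjective _ w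
  induction a using TensorAlgebra.induction with
  | algebraMap r =>
    refine ⟨0, ?_⟩
    rw [AlgHom.commutes, Algebra.algebraMap_eq_smul_one]
    exact Submodule.smul_mem _ _ (one_mem_degreeLE 0)
  | ι x => exact ⟨1, ι_mem_degreeLE x⟩
  | mul a b ha hb =>
    obtain ⟨m, hm⟩ := ha
    obtain ⟨m', hm'⟩ := hb
    exact ⟨m + m', by rw [map_mul]; exact mul_mem_degreeLE hm hm'⟩
  | add a b ha hb =>
    obtain ⟨m, hm⟩ := ha
    obtain ⟨m', hm'⟩ := hb
    refine ⟨max m m', ?_⟩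
    rw [map_add]
    exact add_mem (degreeLE_mono (le_max_left _ _) hm) (degreeLE_mono (le_max_right _ _) hm')

end Filtration

/-! ### Inclusion–exclusion over sets of sites -/

section Alternating

variable {k d : ℕ}

/-- Toggling a site s outside the image of φ does not affect the condition and reverses the sign. -/
theorem sum_alternating_of_not_surjective {φ : Fin k → Fin d} (hφ : ¬Function.Surjective φ) :
    ∑ S : Finset (Fin d), (if ∀ a, φ a ∈ S then (-1 : ℂ) ^ S.card else 0) = 0 := by
  rw [Function.Surjective] at hφ
  push Not at hφ
  obtain ⟨s, hs⟩ := hφ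
  refine Finset.sum_involution (fun S _ => if s ∈ S then S.erase s else insert s S) ?_ ?_ ?_ ?_
  · intro S _
    by_cases h : s ∈ S
    · have h1 : (∀ a, φ a ∈ S.erase s) ↔ ∀ a, φ a ∈ S :=
        forall_congr' fun a => by simp [hs a]
      simp only [h, if_true, h1]
      split_ifs
      · rw [← Finset.card_erase_add_one h, pow_succ]; ring
      · simp
    · have h1 : (∀ a, φ a ∈ insert s S) ↔ ∀ a, φ a ∈ S :=
        forall_congr' fun a => by simp [hs a]
      simp only [h, if_false, h1]
      split_ifs
      · rw [Finset.card_insert_of_notMem h, pow_succ]; ring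
      · simp
  · intro S _ _ h
    by_cases hS : s ∈ S
    · rw [if_pos hS] at h
      rw [← h] at hS
      simp at hS
    · rw [if_neg hS] at h
      rw [← h] at hS
      simp at hS
  · simp
  · intro S _
    by_cases h : s ∈ S
    · simp [h]
    · simp [h]

theorem sum_alternating_of_surjective {φ : Fin k → Fin d} (hφ : Function.Surjective φ) :
    ∑ S : Finset (Fin d), (if ∀ a, φ a ∈ S then (-1 : ℂ) ^ S.card else 0) = (-1) ^ d := by
  rw [Finset.sum_eq_single Finset.univ]
  · simp
  · intro S _ hS
    refine if_neg fun h => hS (Finset.eq_univ_iff_forall.mpr fun s => ?_)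
    obtain ⟨a, rfl⟩ := hφ s
    exact h a
  · simp

end Alternating

/-! ### Separation of points by tensor products of evaluation modules -/

section AltRep

variable {N k d : ℕ}

local notation "ιU" => UniversalEnvelopingAlgebra.ι ℂ (L := gPlus N)

/-- The alternating sum of the representations attached to all sets of sites. -/
def altRep (x : Fin d → ℂ) : UPlus N →ₗ[ℂ] TensorMat N d ℂ :=
  ∑ S : Finset (Fin d), (-1 : ℂ) ^ S.card • (uRep x S).toLinearMap

theorem altRep_prod (x : Fin d → ℂ) (g : Fin k → gPlus N) :
    altRep x (List.ofFn fun a => ιU (g a)).prod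
      = ∑ φ : Fin k → Fin d,
        (∑ S : Finset (Fin d), (if ∀ a, φ a ∈ S then (-1 : ℂ) ^ S.card else 0)) •
          (List.ofFn fun a => siteMap (φ a) (x (φ a)) (g a)).prod := by
  have h : ∀ S : Finset (Fin d), uRep x S (List.ofFn fun a => ιU (g a)).prod
      = ∑ φ : Fin k → Fin d, if ∀ a, φ a ∈ S then
          (List.ofFn fun a => siteMap (φ a) (x (φ a)) (g a)).prod else 0 := by
    intro S
    rw [map_list_prod, List.map_ofFn]
    have h1 : (⇑(uRep x S) ∘ fun a => ιU (g a))
        = fun a => ∑ s ∈ S, siteMap s (x s) (g a) := funext fun a => uRep_ι x S (g a)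
    rw [h1]
    have h2 := MultilinearMap.map_sum_finset (MultilinearMap.mkPiAlgebraFin ℂ k (TensorMat N d ℂ))
      (fun a s => siteMap s (x s) (g a)) (fun _ => S)
    simp only [MultilinearMap.mkPiAlgebraFin_apply] at h2
    rw [h2, ← Finset.sum_filter]
    refine Finset.sum_congr ?_ fun _ _ => rfl
    ext φ
    simp
  rw [altRep, LinearMap.sum_apply]
  simp only [LinearMap.smul_apply, AlgHom.toLinearMap_apply, h, Finset.sum_smul, Finset.smul_sum]
  rw [Finset.sum_comm]
  refine Finset.sum_congr rfl fun φ _ => Finset.sum_congr rfl fun S _ => ?_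
  split_ifs <;> simp

theorem altRep_prod_of_lt (x : Fin d → ℂ) (g : Fin k → gPlus N) (hk : k < d) :
    altRep x (List.ofFn fun a => ιU (g a)).prod = 0 := by
  rw [altRep_prod]
  refine Finset.sum_eq_zero fun φ _ => ?_
  rw [sum_alternating_of_not_surjective, zero_smul]
  intro h
  have := Fintype.card_le_of_surjective φ h
  simp at this
  omega

/-- The matrix of an element of the Lie algebra in the dual evaluation representation. -/
def siteMat (x : ℂ) (A : gPlus N) : Matrix (Fin N) (Fin N) ℂ :=
  -((A : Matrix (Fin N) (Fin N) (Polynomial ℂ)).map (Polynomial.eval x))ᵀ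

theorem siteMap_eq_leg (s : Fin d) (x : ℂ) (A : gPlus N) : siteMap s x A = leg s (siteMat x A) := by
  rw [siteMat, leg_neg]
  rfl

theorem prod_siteMap_apply (x : Fin d → ℂ) (g : Fin d → gPlus N) (σ : Perm (Fin d))
    (I J : Fin d → Fin N) :
    (List.ofFn fun a => siteMap (σ a) (x (σ a)) (g a)).prod I J
      = ∏ s, siteMat (x s) (g (σ⁻¹ s)) (I s) (J s) := by
  have h : (List.ofFn fun a => siteMap (σ a) (x (σ a)) (g a))
      = (List.ofFn σ).map fun s => leg s (siteMat (x s) (g (σ⁻¹ s))) := by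
    rw [List.map_ofFn]
    congr 1
    funext a
    simp [siteMap_eq_leg]
  rw [h]
  have h1 := legProd_apply_of_forall_mem (l := List.ofFn σ) (List.nodup_ofFn.mpr σ.injective)
    (fun c => (List.mem_ofFn' _ _).mpr (σ.surjective c)) (fun s => siteMat (x s) (g (σ⁻¹ s))) I J
  refine h1.trans ?_
  rw [List.map_ofFn, List.prod_ofFn]
  exact Equiv.prod_comp σ fun s => siteMat (x s) (g (σ⁻¹ s)) (I s) (J s)

/-- A product of d elements expands over maps from factors to sites. Only surjections survive the
alternation, and these are permutations. Each site then receives one factor, leaving a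
permanent-like sum. -/
theorem altRep_prod_apply (x : Fin d → ℂ) (g : Fin d → gPlus N) (I J : Fin d → Fin N) :
    altRep x (List.ofFn fun a => ιU (g a)).prod I J
      = (-1) ^ d * ∑ σ : Perm (Fin d), ∏ s, siteMat (x s) (g (σ s)) (I s) (J s) := by
  rw [altRep_prod, ← Equiv.sum_comp (Equiv.inv (Perm (Fin d))), Finset.mul_sum]
  have h : ∑ φ : Fin d → Fin d, (∑ S : Finset (Fin d), (if ∀ a, φ a ∈ S then (-1 : ℂ) ^ S.card else 0)) •
          (List.ofFn fun a => siteMap (φ a) (x (φ a)) (g a)).prod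
      = ∑ σ : Perm (Fin d), (-1 : ℂ) ^ d • (List.ofFn fun a => siteMap (σ a) (x (σ a)) (g a)).prod := by
    symm
    rw [← Finset.sum_subset (Finset.subset_univ
      (Finset.univ.map ⟨fun σ : Perm (Fin d) => (σ : Fin d → Fin d), DFunLike.coe_injective⟩)),
      Finset.sum_map]
    · refine Finset.sum_congr rfl fun σ _ => ?_
      simp only [Function.Embedding.coeFn_mk]
      rw [sum_alternating_of_surjective σ.surjective]
    · intro φ _ hφ
      rw [sum_alternating_of_not_surjective, zero_smul]
      intro hs
      refine hφ (Finset.mem_map.mpr ⟨Equiv.ofBijective φ (Finite.surjective_iff_bijective.mp hs),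
        Finset.mem_univ _, rfl⟩)
  rw [h, Matrix.sum_apply]
  refine Finset.sum_congr rfl fun σ _ => ?_
  rw [Matrix.smul_apply, prod_siteMap_apply, smul_eq_mul]
  rfl

theorem siteMat_genElem (x : ℂ) (t : Fin N × Fin N × ℕ) :
    siteMat x (genElem t) = single t.2.1 t.1 (genCoef t * x ^ t.2.2) := by
  ext i j
  simp only [siteMat, genElem_coe, Matrix.neg_apply, transpose_apply, Matrix.map_apply, single_apply]
  by_cases h : t.1 = j ∧ t.2.1 = i
  · rw [if_pos h, if_pos h.symm]
    simp
  · rw [if_neg h, if_neg (fun h' => h h'.symm)]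
    simp

theorem word_ofFn (f : Fin k → Fin N × Fin N × ℕ) :
    word (List.ofFn f) = (List.ofFn fun a => ιU (genElem (f a))).prod := by
  rw [word, List.map_ofFn]
  rfl

theorem altRep_of_mem_degreeLE (x : Fin (d + 1) → ℂ) {w : UPlus N} (hw : w ∈ degreeLE N d) :
    altRep x w = 0 := by
  rw [degreeLE_eq_span] at hw
  induction hw using Submodule.span_induction with
  | mem w h =>
    obtain ⟨l, hl, rfl⟩ := h
    rw [← List.ofFn_get l, word_ofFn]
    exact altRep_prod_of_lt x _ (by omega)
  | zero => simp
  | add a b _ _ ha hb => rw [map_add, ha, hb, add_zero]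
  | smul c a _ ha => rw [map_smul, ha, smul_zero]

/-- Every term vanishes separately: the entry (I, J) selects the matrix units, and the powers of the
free parameters x_s select the exponents of t⁻¹. -/
theorem linearCombination_word_eq_zero (c : (Fin d → Fin N × Fin N × ℕ) →₀ ℂ)
    (h : ∀ (x : Fin d → ℂ) (I J : Fin d → Fin N),
      c.sum (fun f a => a * ∏ s, siteMat (x s) (genElem (f s)) (I s) (J s)) = 0) :
    c.sum (fun f a => a • word (List.ofFn f)) = 0 := by
  refine Finset.sum_eq_zero fun f₀ hf₀ => ?_
  suffices h0 : c f₀ * ∏ s, genCoef (f₀ s) = 0 by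
    rcases mul_eq_zero.mp h0 with h0 | h0
    · simp only [h0, zero_smul]
    · obtain ⟨s, _, hs⟩ := Finset.prod_eq_zero_iff.mp h0
      have : (0 : UPlus N) ∈ List.ofFn fun a => ιU (genElem (f₀ a)) :=
        (List.mem_ofFn' _ _).mpr ⟨s, by simp only [genElem_eq_zero hs, map_zero]⟩
      simp only
      rw [word_ofFn, List.prod_eq_zero this, smul_zero]
  let e : (Fin d → Fin N × Fin N × ℕ) → (Fin d →₀ ℕ) := fun f => Finsupp.equivFunOnFinite.symm fun s => (f s).2.2
  -- The terms with the same matrix units as `f₀`, as a polynomial in the x_s. It vanishes at all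
  -- points, and the exponents together with the matrix units determine f.
  have hp : (∑ f ∈ c.support, MvPolynomial.monomial (e f)
      (if ∀ s, (f s).2.1 = (f₀ s).2.1 ∧ (f s).1 = (f₀ s).1 then c f * ∏ s, genCoef (f s) else 0) :
      MvPolynomial (Fin d) ℂ) = 0 := by
    refine MvPolynomial.funext fun x => ?_
    rw [map_zero, map_sum]
    refine Eq.trans ?_ (h x (fun s => (f₀ s).2.1) (fun s => (f₀ s).1))
    refine Finset.sum_congr rfl fun f _ => ?_
    rw [MvPolynomial.eval_monomial, Finsupp.prod_fintype _ _ (by simp)]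
    simp only [siteMat_genElem, single_apply]
    split_ifs with hf
    · have : ∏ s, (if (f s).2.1 = (f₀ s).2.1 ∧ (f s).1 = (f₀ s).1 then
          genCoef (f s) * x s ^ (f s).2.2 else 0) = ∏ s, genCoef (f s) * x s ^ (f s).2.2 :=
        Finset.prod_congr rfl fun s _ => if_pos (hf s)
      rw [this, Finset.prod_mul_distrib, mul_assoc]
      rfl
    · push Not at hf
      obtain ⟨s, hs⟩ := hf
      rw [zero_mul, Finset.prod_eq_zero (Finset.mem_univ s), mul_zero]
      exact if_neg fun h' => hs h'.1 h'.2
  have hc := congrArg (MvPolynomial.coeff (e f₀)) hp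
  rw [MvPolynomial.coeff_zero, MvPolynomial.coeff_sum, Finset.sum_eq_single f₀] at hc
  · rw [MvPolynomial.coeff_monomial, if_pos rfl, if_pos (fun s => ⟨rfl, rfl⟩)] at hc
    exact hc
  · intro f _ hf
    rw [MvPolynomial.coeff_monomial]
    split_ifs with h1 h2
    · exfalso
      apply hf
      funext s
      have h3 := DFunLike.congr_fun h1 s
      exact Prod.ext (h2 s).2 (Prod.ext (h2 s).1 h3)
    · rfl
    · rfl
  · intro h1
    exact absurd hf₀ h1

/-- The alternating representation sees only the symmetrized coefficients. If it vanishes, the sum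
over all reorderings of the top words is zero. Modulo lower degree that sum is (d+1)! times the
original top part. -/
theorem mem_degreeLE_of_altRep_eq_zero {w : UPlus N} (hw : w ∈ degreeLE N (d + 1))
    (h : ∀ x : Fin (d + 1) → ℂ, altRep x w = 0) : w ∈ degreeLE N d := by
  have hle : degreeLE N (d + 1) ≤ Submodule.span ℂ (Set.range fun f : Fin (d + 1) → Fin N × Fin N × ℕ =>
      word (List.ofFn f)) ⊔ degreeLE N d := by
    rw [degreeLE_eq_span (d + 1), Submodule.span_le]
    rintro _ ⟨l, hl, rfl⟩
    rcases Nat.lt_or_eq_of_le hl with hl | hl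
    · refine le_sup_right (α := Submodule ℂ (UPlus N)) ?_
      rw [degreeLE_eq_span]
      exact Submodule.subset_span ⟨l, by omega, rfl⟩
    · refine le_sup_left (α := Submodule ℂ (UPlus N)) (Submodule.subset_span ?_)
      rw [← List.ofFn_get l, ← hl]
      exact ⟨_, rfl⟩
  obtain ⟨v, hv, w', hw', rfl⟩ := Submodule.mem_sup.mp (hle hw)
  obtain ⟨c, rfl⟩ := Finsupp.mem_span_range_iff_exists_finsupp.mp hv
  refine add_mem ?_ hw'
  set c' : (Fin (d + 1) → Fin N × Fin N × ℕ) →₀ ℂ :=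
    ∑ σ : Perm (Fin (d + 1)), c.mapDomain fun f => f ∘ σ with hc'
  have hsum : ∀ {M : Type} [AddCommGroup M] [Module ℂ M] (F : (Fin (d + 1) → Fin N × Fin N × ℕ) → M),
      c'.sum (fun f a => a • F f) = ∑ σ : Perm (Fin (d + 1)), c.sum fun f a => a • F (f ∘ σ) := by
    intro M _ _ F
    change Finsupp.linearCombination ℂ F c' = _
    rw [hc', map_sum]
    refine Finset.sum_congr rfl fun σ _ => ?_
    rw [Finsupp.linearCombination_mapDomain]
    rfl
  have hzero : c'.sum (fun f a => a • word (List.ofFn f)) = 0 := by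
    refine linearCombination_word_eq_zero c' fun x I J => ?_
    have h1 := congrFun (congrFun (h x) I) J
    rw [map_add, altRep_of_mem_degreeLE x hw', add_zero, Finsupp.sum, map_sum, Matrix.sum_apply] at h1
    simp only [map_smul, Matrix.smul_apply, word_ofFn, altRep_prod_apply, smul_eq_mul,
      mul_left_comm _ ((-1 : ℂ) ^ (d + 1)), ← Finset.mul_sum] at h1
    have h2 := (mul_eq_zero.mp h1).resolve_left (pow_ne_zero _ (by norm_num))
    refine (hsum fun f => ∏ s, siteMat (x s) (genElem (f s)) (I s) (J s)).trans ?_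
    rw [← h2]
    simp only [Finset.mul_sum, Finsupp.sum]
    rw [Finset.sum_comm]
    rfl
  have hmem : ∀ σ : Perm (Fin (d + 1)), (c.sum fun f a => a • word (List.ofFn (f ∘ σ)))
      - (c.sum fun f a => a • word (List.ofFn f)) ∈ degreeLE N d := by
    intro σ
    rw [Finsupp.sum, Finsupp.sum, ← Finset.sum_sub_distrib]
    refine Submodule.sum_mem _ fun f _ => ?_
    rw [← smul_sub]
    refine Submodule.smul_mem _ _ ?_
    have := prod_sub_prod_mem_degreeLE ((σ.ofFn_comp_perm f).map genElem)
    simpa [word, List.map_map, Function.comp_def] using this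
  have h3 : ∑ σ : Perm (Fin (d + 1)), ((c.sum fun f a => a • word (List.ofFn (f ∘ σ)))
      - (c.sum fun f a => a • word (List.ofFn f))) ∈ degreeLE N d :=
    Submodule.sum_mem _ fun σ _ => hmem σ
  rw [Finset.sum_sub_distrib, ← hsum (fun f => word (List.ofFn f)), hzero, zero_sub, Finset.sum_const,
    ← Nat.cast_smul_eq_nsmul ℂ] at h3
  have h4 := (Submodule.neg_mem_iff _).mp h3
  refine (Submodule.smul_mem_iff _ ?_).mp h4
  rw [Nat.cast_ne_zero, Finset.card_univ]
  exact Fintype.card_ne_zero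

/-- The representations attached to finite sets of sites separate the elements of the universal
enveloping algebra. -/
theorem eq_zero_of_uRep_eq_zero {w : UPlus N}
    (h : ∀ (d : ℕ) (x : Fin d → ℂ) (S : Finset (Fin d)), uRep x S w = 0) : w = 0 := by
  obtain ⟨m, hm⟩ := exists_mem_degreeLE w
  induction m with
  | zero =>
    rw [degreeLE, pow_zero, Submodule.mem_one] at hm
    obtain ⟨a, rfl⟩ := hm
    -- A scalar is detected by the one-dimensional representation with no sites.
    have h0 := congrFun (congrFun (h 0 Fin.elim0 ∅) Fin.elim0) Fin.elim0
    rw [AlgHom.commutes, algebraMap_matrix_apply, if_pos rfl] at h0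
    have : a = 0 := h0
    rw [this, map_zero]
  | succ m ih =>
    refine ih (mem_degreeLE_of_altRep_eq_zero hm fun x => ?_)
    rw [altRep, LinearMap.sum_apply]
    refine Finset.sum_eq_zero fun S _ => ?_
    rw [LinearMap.smul_apply, AlgHom.toLinearMap_apply, h, smul_zero]

end AltRep

/-! ### The leading term of θ_m^{(m)} -/

section Degree

variable {N : ℕ}

theorem coeff_mul_mem_degreeLE {m m' : ℕ} {f g : (UPlus N)⟦X⟧} (hf : ∀ n, coeff n f ∈ degreeLE N m)
    (hg : ∀ n, coeff n g ∈ degreeLE N m') (n : ℕ) : coeff n (f * g) ∈ degreeLE N (m + m') := by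
  rw [coeff_mul]
  exact Submodule.sum_mem _ fun p _ => mul_mem_degreeLE (hf _) (hg _)

theorem coeff_lPlus_mem (i j : Fin N) (n : ℕ) : coeff n (lPlus N i j) ∈ degreeLE N 1 := by
  rw [lPlus, coeff_mk]
  exact ι_mem_degreeLE _

theorem lOp_add_sgnDiag_apply (j i k : Fin N) (f : (UPlus N)⟦X⟧) :
    (lOp N + sgnDiag (OpAlg N) j) i k f
      = (if i = k then (2 * mulOp N X * du N) f + (sgn i j : ℂ) • f else 0) - lPlus N i k * f := by
  rw [lOp, sgnDiag, Matrix.add_apply, Matrix.sub_apply, diagonal_apply, diagonal_apply,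
    LinearMap.add_apply, LinearMap.sub_apply, Matrix.map_apply, mulOp_apply]
  split_ifs
  · rw [Module.algebraMap_end_apply]; abel
  · simp

theorem coeff_pow_apply_one_mem (j : Fin N) (m : ℕ) (i k : Fin N) (n : ℕ) :
    coeff n (((lOp N + sgnDiag (OpAlg N) j) ^ m : Matrix (Fin N) (Fin N) (OpAlg N)) i k 1)
      ∈ degreeLE N m := by
  induction m generalizing i n with
  | zero =>
    rw [pow_zero, one_apply]
    split_ifs
    · rw [Module.End.one_apply, coeff_one]
      split_ifs
      · exact one_mem_degreeLE 0
      · exact zero_mem _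
    · simp
  | succ m ih =>
    rw [pow_succ', Matrix.mul_apply, LinearMap.sum_apply, map_sum]
    refine Submodule.sum_mem _ fun a _ => ?_
    rw [Module.End.mul_apply, lOp_add_sgnDiag_apply, map_sub]
    refine sub_mem ?_ ?_
    · refine degreeLE_le_succ m ?_
      split_ifs
      · rw [map_add, coeff_two_mul_X_du, coeff_smul]
        exact add_mem (Submodule.smul_mem _ _ (ih _ _)) (Submodule.smul_mem _ _ (ih _ _))
      · simp
    · rw [add_comm]
      exact coeff_mul_mem_degreeLE (coeff_lPlus_mem i a) (ih a) n

/-- Expanding one factor, 2u∂_u and the sign matrix keep the degree at most m, and -ℒ⁺ reproduces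
the leading term up to ℒ⁺ times the previous error. `key` isolates this error so that induction can
absorb it. -/
theorem coeff_pow_apply_one_sub_mem (j : Fin N) (m : ℕ) (i k : Fin N) (n : ℕ) :
    coeff n (((lOp N + sgnDiag (OpAlg N) j) ^ (m + 1) : Matrix (Fin N) (Fin N) (OpAlg N)) i k 1
      - (-1) ^ (m + 1) * (lPlus N ^ (m + 1)) i k) ∈ degreeLE N m := by
  have key : ∀ m i n, coeff n
      (((lOp N + sgnDiag (OpAlg N) j) ^ (m + 1) : Matrix (Fin N) (Fin N) (OpAlg N)) i k 1
      - (-1) ^ (m + 1) * (lPlus N ^ (m + 1)) i k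
      + ∑ a, lPlus N i a *
        (((lOp N + sgnDiag (OpAlg N) j) ^ m : Matrix (Fin N) (Fin N) (OpAlg N)) a k 1
          - (-1) ^ m * (lPlus N ^ m) a k)) ∈ degreeLE N m := by
    intro m i n
    have h1 : ((lOp N + sgnDiag (OpAlg N) j) ^ (m + 1) : Matrix (Fin N) (Fin N) (OpAlg N)) i k 1
        - (-1) ^ (m + 1) * (lPlus N ^ (m + 1)) i k
        + ∑ a, lPlus N i a *
          (((lOp N + sgnDiag (OpAlg N) j) ^ m : Matrix (Fin N) (Fin N) (OpAlg N)) a k 1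
            - (-1) ^ m * (lPlus N ^ m) a k)
        = ∑ a, (if i = a then (2 * mulOp N X * du N)
            (((lOp N + sgnDiag (OpAlg N) j) ^ m : Matrix (Fin N) (Fin N) (OpAlg N)) a k 1)
            + (sgn i j : ℂ) •
            (((lOp N + sgnDiag (OpAlg N) j) ^ m : Matrix (Fin N) (Fin N) (OpAlg N)) a k 1) else 0) := by
      rw [pow_succ', Matrix.mul_apply, LinearMap.sum_apply, pow_succ' (lPlus N), Matrix.mul_apply,
        Finset.mul_sum, ← Finset.sum_sub_distrib, ← Finset.sum_add_distrib]
      refine Finset.sum_congr rfl fun a _ => ?_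
      rw [Module.End.mul_apply, lOp_add_sgnDiag_apply, mul_sub, pow_succ, mul_neg_one, neg_mul]
      have : (-1 : (UPlus N)⟦X⟧) ^ m * (lPlus N i a * (lPlus N ^ m) a k)
          = lPlus N i a * ((-1) ^ m * (lPlus N ^ m) a k) := by
        rcases neg_one_pow_eq_or (UPlus N)⟦X⟧ m with h | h <;> simp [h]
      rw [this]
      abel
    rw [h1, map_sum]
    refine Submodule.sum_mem _ fun a _ => ?_
    split_ifs
    · rw [map_add, coeff_two_mul_X_du, coeff_smul]
      exact add_mem (Submodule.smul_mem _ _ (coeff_pow_apply_one_mem j m a k n))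
        (Submodule.smul_mem _ _ (coeff_pow_apply_one_mem j m a k n))
    · simp
  induction m generalizing i n with
  | zero =>
    have h := key 0 i n
    have h0 : ∀ a, ((lOp N + sgnDiag (OpAlg N) j) ^ 0 : Matrix (Fin N) (Fin N) (OpAlg N)) a k 1
          - (-1) ^ 0 * (lPlus N ^ 0) a k = 0 := by
      intro a
      rw [pow_zero, pow_zero, pow_zero, one_mul, one_apply, one_apply]
      split_ifs <;> simp
    simp only [h0, mul_zero, Finset.sum_const_zero, add_zero] at h
    exact h
  | succ m ih =>
    have h := key (m + 1) i n
    rw [map_add] at h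
    refine (Submodule.add_mem_iff_left _ ?_).mp h
    rw [map_sum]
    refine Submodule.sum_mem _ fun a _ => ?_
    have := coeff_mul_mem_degreeLE (coeff_lPlus_mem i a) (ih a) n
    rwa [add_comm 1 m] at this

theorem coeff_theta_one_sub_mem (m : ℕ) (hm : 1 ≤ m) (n : ℕ) :
    coeff n (theta N m 1 - (-1) ^ m * trace (lPlus N ^ m)) ∈ degreeLE N (m - 1) := by
  obtain ⟨m, rfl⟩ : ∃ k, m = k + 1 := ⟨m - 1, by omega⟩
  rw [theta_eq _ hm, LinearMap.sum_apply, trace, Finset.mul_sum, ← Finset.sum_sub_distrib, map_sum]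
  exact Submodule.sum_mem _ fun j _ => coeff_pow_apply_one_sub_mem j m j j n

end Degree

/-! ### The Gaudin model as a tensor product of evaluation modules -/

section Gaudin

variable {N : ℕ}

theorem rescale_rCoef (x : ℂ) (i j : Fin N) :
    rescale x ((1 + X) * (1 - X : ℂ⟦X⟧)⁻¹ + C (sgn i j : ℂ)) = rCoef x i j := by
  have h1 : (1 - X : ℂ⟦X⟧)⁻¹ = PowerSeries.mk 1 :=
    ((PowerSeries.eq_inv_iff_mul_eq_one (by simp)).mpr (mk_one_mul_one_sub_eq_one ℂ)).symm
  ext n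
  rw [h1, coeff_rescale, rCoef, coeff_mk, add_mul, one_mul, map_add, map_add, coeff_C]
  rcases n with _ | n
  · simp
  · rw [coeff_succ_X_mul]
    simp
    ring

theorem rMatrix_apply (i j k l : Fin N) : rMatrix N (i, j) (k, l)
    = if k = j ∧ l = i then (1 + X) * (1 - X : ℂ⟦X⟧)⁻¹ + C (sgn i j : ℂ) else 0 := by
  have h : ∀ a b : Fin N, flipUnit ℂ⟦X⟧ a b (i, j) (k, l)
      = if a = i then if b = j then if k = j ∧ l = i then 1 else 0 else 0 else 0 := by
    intro a b
    simp only [flipUnit, kroneckerMap_apply, single_apply]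
    split_ifs <;> simp_all
  simp only [rMatrix, Matrix.sum_apply, Matrix.smul_apply, h]
  simp

theorem uRep_lPlus_apply {l : ℕ} (a : Fin l → ℂ) (i j : Fin N) (n : ℕ) (I J : Fin l → Fin N) :
    uRep (fun k => (a k)⁻¹) Finset.univ (coeff n (lPlus N i j)) I J
      = coeff n (rSum N a (Fin.cons i I) (Fin.cons j J)) := by
  have h := coeff_seriesRep (uRep (N := N) (fun k => (a k)⁻¹) Finset.univ).toRingHom (lPlus N i j) I J n
  refine h.symm.trans ?_
  rw [seriesRep_lPlus, Matrix.sum_apply, rSum, Matrix.sum_apply]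
  congr 1
  refine Finset.sum_congr rfl fun k _ => ?_
  simp only [leg, leg₂, Matrix.map_apply, Fin.cons_zero, Fin.cons_succ, rMatrix_apply, single_apply]
  have hc : (∀ c : Fin (l + 1), c ≠ 0 → c ≠ k.succ →
      (Fin.cons i I : Fin (l + 1) → Fin N) c = (Fin.cons j J : Fin (l + 1) → Fin N) c)
      ↔ ∀ c, c ≠ k → I c = J c := by
    constructor
    · intro h c hc
      simpa using h c.succ (Fin.succ_ne_zero c) (fun h' => hc (Fin.succ_injective _ h'))
    · intro h c
      refine Fin.cases (fun h0 => absurd rfl h0) (fun c _ hc => ?_) c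
      simpa using h c (fun h' => hc (by rw [h']))
  simp only [hc]
  refine if_congr Iff.rfl ?_ rfl
  by_cases h1 : j = I k ∧ i = J k
  · rw [if_pos h1, if_pos ⟨h1.1, h1.2.symm⟩, ← h1.1, rescale_rCoef]
  · rw [if_neg h1, if_neg fun h' => h1 ⟨h'.1, h'.2.symm⟩, map_zero]

end Gaudin

/-! ### Commutativity in the enveloping algebra -/

section Commutativity

variable {N : ℕ}

theorem commute_coeff_theta {m m' : ℕ} (hm : 1 ≤ m) (hm' : 1 ≤ m') (p p' n n' : ℕ) :
    Commute (coeff n (theta N m (X ^ p))) (coeff n' (theta N m' (X ^ p'))) := by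
  refine sub_eq_zero.mp (eq_zero_of_uRep_eq_zero fun d x S => ?_)
  rw [map_sub, map_mul, map_mul, (commute_uRep_theta x S hm hm' p p' n n').eq, sub_self]

theorem exists_theta_coeff (N : ℕ) : ∃ θ : ℕ → ℕ → (UPlus N)⟦X⟧,
    ∀ m : ℕ, 1 ≤ m → ∀ c : Fin (m + 1) → (UPlus N)⟦X⟧,
      (theta N m = ∑ k : Fin (m + 1), mulOp N (c k) * du N ^ (m - (k : ℕ))) ↔
        ∀ k : Fin (m + 1), c k = θ m k := by
  have h : ∀ m : ℕ, ∃ θ : ℕ → (UPlus N)⟦X⟧, 1 ≤ m → ∀ c : Fin (m + 1) → (UPlus N)⟦X⟧,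
      (theta N m = ∑ k : Fin (m + 1), mulOp N (c k) * du N ^ (m - (k : ℕ))) ↔
        ∀ k : Fin (m + 1), c k = θ k := by
    intro m
    by_cases hm : 1 ≤ m
    · obtain ⟨θ, hθ⟩ := existsUnique_of_mem_diffOps (theta_mem_diffOps (N := N) m hm)
      exact ⟨θ, fun _ => hθ⟩
    · exact ⟨0, fun h => absurd h hm⟩
  choose θ hθ using h
  exact ⟨θ, hθ⟩

theorem coeff_mem_of_theta_mem {θ : ℕ → ℕ → (UPlus N)⟦X⟧} (hθ : ∀ m : ℕ, 1 ≤ m →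
      theta N m = ∑ k : Fin (m + 1), mulOp N (θ m k) * du N ^ (m - (k : ℕ)))
    (V : Submodule ℂ (UPlus N))
    (h : ∀ m p n, 1 ≤ m → coeff n (theta N m (X ^ p)) ∈ V) {x : UPlus N} (hx : x ∈ coeffSet θ) :
    x ∈ V := by
  obtain ⟨m, k, n, hm, hk, rfl⟩ := hx
  exact coeff_mem_of_eq_sum V (fun k : Fin (m + 1) => θ m k) (hθ m hm) (fun p n => h m p n hm)
    ⟨k, by omega⟩ n

/-- The coefficients of θ_m(u^p) commute with each other. The triangular extraction is applied once
in each argument, with a centralizer as the subspace. -/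
theorem commute_of_mem_coeffSet {θ : ℕ → ℕ → (UPlus N)⟦X⟧} (hθ : ∀ m : ℕ, 1 ≤ m →
      theta N m = ∑ k : Fin (m + 1), mulOp N (θ m k) * du N ^ (m - (k : ℕ)))
    {x y : UPlus N} (hx : x ∈ coeffSet θ) (hy : y ∈ coeffSet θ) :
    x * y = y * x := by
  have h1 : ∀ m p n, 1 ≤ m → ∀ y ∈ coeffSet θ,
      coeff n (theta N m (X ^ p)) * y = y * coeff n (theta N m (X ^ p)) := by
    intro m p n hm y hy
    have := coeff_mem_of_theta_mem hθ
      (Subalgebra.centralizer ℂ {coeff n (theta N m (X ^ p))}).toSubmodule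
      (fun m' p' n' hm' => ?_) hy
    · exact (Subalgebra.mem_centralizer_iff ℂ).mp this _ rfl
    · refine (Subalgebra.mem_centralizer_iff ℂ).mpr ?_
      rintro _ rfl
      exact commute_coeff_theta hm hm' p p' n n'
  have := coeff_mem_of_theta_mem hθ (Subalgebra.centralizer ℂ {y}).toSubmodule
    (fun m' p' n' hm' => ?_) hx
  · exact ((Subalgebra.mem_centralizer_iff ℂ).mp this _ rfl).symm
  · refine (Subalgebra.mem_centralizer_iff ℂ).mpr ?_
    intro z hz
    rw [Set.mem_singleton_iff.mp hz]
    exact (h1 m' p' n' hm' y hy).symm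

/-- All positive powers of ∂_u annihilate the constant series 1. -/
theorem theta_coeff_last {θ : ℕ → ℕ → (UPlus N)⟦X⟧} (hθ : ∀ m : ℕ, 1 ≤ m →
      theta N m = ∑ k : Fin (m + 1), mulOp N (θ m k) * du N ^ (m - (k : ℕ)))
    (m : ℕ) (hm : 1 ≤ m) : θ m m = theta N m 1 := by
  rw [hθ m hm, LinearMap.sum_apply, Finset.sum_eq_single (Fin.last m)]
  · simp
  · intro k _ hk
    have hk' : (k : ℕ) < m := by
      have := Fin.lt_last_iff_ne_last.mpr hk
      exact this
    have h := du_pow_X_pow (N := N) (m - k) 0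
    rw [pow_zero, Nat.descFactorial_of_lt (by omega), Nat.cast_zero, zero_smul] at h
    rw [Module.End.mul_apply, h, map_zero]
  · simp

end Commutativity

end TrigGaudin

end

theorem theorem2p1 (N : ℕ) :
    ∃ θ : ℕ → ℕ → PowerSeries (UPlus N),
      -- `θ m k` are the unique power series with `θ_m = ∑_k θ_m^{(k)} ∂_u^{m-k}`
      (∀ m : ℕ, 1 ≤ m → ∀ c : Fin (m + 1) → PowerSeries (UPlus N),
        (theta N m = ∑ k : Fin (m + 1), mulOp N (c k) * du N ^ (m - (k : ℕ))) ↔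
          ∀ k : Fin (m + 1), c k = θ m k) ∧
      -- their coefficients generate a commutative subalgebra
      (∀ x ∈ Algebra.adjoin ℂ (coeffSet θ), ∀ y ∈ Algebra.adjoin ℂ (coeffSet θ),
        x * y = y * x) ∧
      -- `θ_m^{(m)} = (-1)^m tr ℒ⁺(u)^m` plus terms of lower degree
      (∀ m : ℕ, 1 ≤ m → ∀ n : ℕ,
        PowerSeries.coeff n (θ m m - (-1) ^ m * Matrix.trace (lPlus N ^ m))
          ∈ degreeLE N (m - 1)) ∧
      -- image in the Gaudin model with `l` sites `a_1, …, a_l`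
      (∀ (l : ℕ) (a : Fin l → ℂ), (∀ k, a k ≠ 0) →
        ∃ ρ : UPlus N →ₐ[ℂ] TensorMat N l ℂ,
          (∀ (i j : Fin N) (n : ℕ) (I J : Fin l → Fin N),
            ρ (PowerSeries.coeff n (lPlus N i j)) I J =
              PowerSeries.coeff n (rSum N a (Fin.cons i I) (Fin.cons j J))) ∧
          ∀ x ∈ coeffSet θ, ∀ y ∈ coeffSet θ, ρ x * ρ y = ρ y * ρ x) := by
  obtain ⟨θ, hθ⟩ := exists_theta_coeff N
  have hθ' : ∀ m : ℕ, 1 ≤ m →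
      theta N m = ∑ k : Fin (m + 1), mulOp N (θ m k) * du N ^ (m - (k : ℕ)) :=
    fun m hm => (hθ m hm fun k => θ m k).mpr fun _ => rfl
  -- The evaluation parameter at the k-th site is 1/a_k, since r(u/a_k) is expanded in powers of u.
  refine ⟨θ, hθ, fun x hx y hy => ?_, fun m hm n => ?_, fun l a _ =>
    ⟨uRep (fun k => (a k)⁻¹) Finset.univ, uRep_lPlus_apply a, fun x hx y hy => ?_⟩⟩
  · refine Algebra.commute_of_mem_adjoin_of_forall_mem_commute hy fun y hy => ?_
    refine (Algebra.commute_of_mem_adjoin_of_forall_mem_commute hx fun x hx => ?_).symm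
    exact commute_of_mem_coeffSet hθ' hy hx
  · rw [theta_coeff_last hθ' m hm]
    exact coeff_theta_one_sub_mem m hm n
  · rw [← map_mul, ← map_mul, commute_of_mem_coeffSet hθ' hx hy]
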